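/- **SicHash.** A SicHash perfect hash function for a set $S$ of $N\ge 1$ objects has the parameters $b\in\mathbb N$, $b\ge1$ (expected bucket size), $\alpha\in\mathbb Q\cap(0,1]$ (load factor), class fractions $p_1,p_2\in\mathbb Q_{\ge0}$ with $p_1+p_2\le1$, and a Golomb–Rice parameter $2^\kappa$. Let $B=\lceil N/b\rceil$. Each object is hashed to one of $B$ buckets and, independently, to class $1$, $2$ or $3$ with probability $p_1$, $p_2$, $1-p_1-p_2$. The $n$ objects of a bucket are placed into a cuckoo hash table with $\lfloor n/\alpha\rfloor$ cells, an object of class $r$ having $2^r$ candidate cells; insertion uses breadth-first search, and if it fails the bucket is retried with the seeds $0,1,2,\dots$ of the cell hash functions until it succeeds. Stored are the Elias–Fano coded prefix sums of the table sizes, the Golomb–Rice coded seeds (both with a constant-time $\mathrm{select}_1$ directory), and, for $r=1,2,3$, a retrieval data structure that holds, for each object of class $r$, the $r$-bit index of the hash function that placed it. A query returns the offset of the bucket of $x$ plus the cell given by the stored seed and the retrieved index. In the minimal variant (MPHF), with $M$ the total number of cells, values $\ge N$ are re-mapped to the unused values $<N$ through an Elias–Fano coded monotone sequence of length $M-N$.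 **Model.** Time is counted in word-RAM steps. Words of a query have the bit length of $N$ plus the size of the data structure in bits. Hash functions are fully random, are evaluated in one step, and are not counted as space. The retrieval data structure is a given randomized one, with randomness independent of the other hash functions; there is a constant $c$ such that for every $r\in\{1,2,3\}$ and every function with $r$-bit values on $n$ objects, it is almost surely correct, it has expected construction time and expected size in bits at most $c(n+1)$, and its queries almost surely take at most $c$ steps. **Theorem.** 1. There is a load factor $\alpha\in(0,1]$ for which cuckoo table construction has constant success probability: there is $\delta>0$ such that one attempt succeeds with probability at least $\delta$, for every finite set of objects (with $n$ objects and $\lfloor n/\alpha\rfloor$ cells), every assignment of $2$, $4$ or $8$ candidate cells to the objects, and every seed. 2. For every choice of the constants $b,\alpha,p_1,p_2,\kappa$ (in particular for $\alpha$ as in part 1) and every $c$ there is a constant $C$ such that for every set $S$ of $N\ge1$ objects from any universe and every retrieval data structure with constant $c$ as above: * the expected construction time is at most $C N$; * almost surely, every query takes at most $C$ steps; * the expected space consumption is at most $C N$ bits; * almost surely, the resulting function is injective from $S$ to $\{0,\dots,M-1\}$, where $\alpha M\le N$. The same time and space bounds hold for the minimal variant, whose resulting function is almost surely a bijection from $S$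 to $\{0,\dots,N-1\}$. -/

import Mathlib

open MeasureTheory
open scoped ENNReal

namespace SicHash

/-! ## Cost model

Algorithms are written in a cost-counting monad.  `Timed α` is the result of a (possibly
diverging) computation together with the number of steps that it takes on a word RAM; the
cost is `⊤` if the computation never halts.

One step pays for a bounded number of arithmetic operations, comparisons, hash function
evaluations, and accesses to array cells holding one number.
Lists and functions on `ℕ` are used as the contents of arrays with random access; they are used
in a single-threaded way, so that updates are in place.  Writing bits to an output
bit vector costs at least one step per bit.  Reading `len` consecutive bits of a bit vector
costs `1 + len / w` steps, where `w` is the word length. -/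

structure Timed (α : Type) where
  val : α
  cost : ℕ∞

namespace Timed

protected def bind {α β : Type} (x : Timed α) (f : α → Timed β) : Timed β :=
  ⟨(f x.val).val, x.cost + (f x.val).cost⟩

instance : Monad Timed where
  pure a := ⟨a, 0⟩
  bind := Timed.bind

end Timed

/-- Spend `k` steps. -/
def tick (k : ℕ) : Timed Unit := ⟨(), k⟩

open Classical in
/-- Run the attempts `f 0, f 1, f 2, …` one after the other until one succeeds; returns the number
of the first successful attempt and its result.  If no attempt ever succeeds then
the search does not halt. -/
noncomputable def firstSuccess {α : Type} (dflt : α) (f : ℕ → Timed (Option α)) :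
    Timed (ℕ × α) :=
  if h : ∃ s, (f s).val.isSome then
    ⟨(Nat.find h, (f (Nat.find h)).val.getD dflt),
      ∑ s ∈ Finset.range (Nat.find h + 1), ((f s).cost + 1)⟩
  else ⟨(0, dflt), ⊤⟩

/-! ## Bit vectors -/

/-- The contents of a bit vector. -/
abbrev Bits := List Bool

/-- Output the `len` low-order bits of `v`, least significant bit first. -/
def field (len v : ℕ) : Timed Bits := do
  tick (len + 1)
  pure ((List.range len).map fun i => v.testBit i)

/-- Output `len` zero bits. -/
def zeros (len : ℕ) : Timed Bits := do
  tick (len + 1)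
  pure (List.replicate len false)

/-- Loop `for i = 0, …, n - 1`, writing the output of the iterations one after the other. -/
def cat : ℕ → (ℕ → Timed Bits) → Timed Bits
  | 0, _ => pure []
  | n + 1, f => do
    let xs ← cat n f
    let ys ← f n
    tick 1
    pure (xs ++ ys)

/-- Read the number stored in the `len` bits starting at position `at_`; positions past the end
read as zero. -/
def readField (w : ℕ) (bits : Bits) (at_ len : ℕ) : Timed ℕ := do
  tick (1 + len / w)
  pure (∑ i ∈ Finset.range len, if bits.getD (at_ + i) false then 2 ^ i else 0)

/-- The positions of the ones in a bit vector, in increasing order. -/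
def onePositions (v : Bits) : List ℕ :=
  (List.range v.length).filter fun i => v.getD i false

/-- The positions of the ones among the `c` low-order bits of the number `x`. -/
def onesOfNat (c x : ℕ) : List ℕ := (List.range c).filter fun i => x.testBit i

/-! ## Constant-time `select₁`

A two-level directory over a bit vector of length `n` that holds `k` ones.  Let `t` be the bit
length of `n` and `u` twice the bit length of `t`.
* The ones are split into groups of `t`; `top` stores the position of the first one of each group.
* If a group spans at least `t²` bits then the positions of its ones are stored explicitly,
  as `t`-bit numbers, in the vector `spread`, at the place where the group starts.
* Otherwise the group is split into subgroups of `u` ones; `mid` stores their starting positions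
  relative to the group as `u`-bit numbers.
* If a subgroup spans at least `u²` bits, the relative positions of its ones are stored explicitly
  in `spread'` at the place where the subgroup starts.
* Otherwise the subgroup is scanned in chunks of `c = t / 2 + 1` bits, using tables `pop`, `sel`
  for the number of ones and the position of the `j`-th one of each `c`-bit pattern. -/

structure SelectIndex where
  t : ℕ
  u : ℕ
  c : ℕ
  top : Bits
  spread : Bits
  mid : Bits
  spread' : Bits
  pop : Bits
  sel : Bits

/-- Number of bits. -/
def SelectIndex.space (I : SelectIndex) : ℕ :=
  I.t.size + I.u.size + I.c.size + I.top.length + I.spread.length + I.mid.length +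
    I.spread'.length + I.pop.length + I.sel.length

/-- Build the `select₁` directory of the bit vector `v`. -/
def buildSelect (v : Bits) : Timed SelectIndex := do
  let n := v.length
  let t := n.size
  let u := 2 * t.size
  let c := t / 2 + 1
  let z := c.size
  let q := t / u + 1
  let ones := onePositions v
  tick (n + 1)
  let pos : ℕ → ℕ := fun i => ones.getD i n
  -- the first one of subgroup `j` of group `g`, as an index into the sequence of ones
  let sub : ℕ → ℕ → ℕ := fun g j => min (g * t + j * u) ((g + 1) * t)
  let G := ones.length / t + 1
  let top ← cat (G + 1) fun g => field t (pos (g * t))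
  let pre ← zeros (pos 0)
  let spread ← cat G fun g => do
    let len := pos ((g + 1) * t) - pos (g * t)
    if t * t ≤ len then do
      let xs ← cat t fun j => field t (pos (g * t + j))
      let pad ← zeros (len - t * t)
      pure (xs ++ pad)
    else zeros len
  let mid ← cat G fun g => cat (q + 1) fun j => field u (pos (sub g j) - pos (g * t))
  let pre' ← zeros (pos 0)
  let spread' ← cat G fun g => do
    let len := pos ((g + 1) * t) - pos (g * t)
    if t * t ≤ len then zeros len
    else cat q fun j => do
      let len' := pos (sub g (j + 1)) - pos (sub g j)
      if u * u ≤ len' then do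
        let xs ← cat u fun e => field u (pos (g * t + j * u + e) - pos (g * t))
        let pad ← zeros (len' - u * u)
        pure (xs ++ pad)
      else zeros len'
  let pop ← cat (2 ^ c) fun x => do
    tick c
    field z (onesOfNat c x).length
  let sel ← cat (2 ^ c) fun x => cat c fun j => do
    tick c
    field z ((onesOfNat c x).getD j 0)
  pure { t := t, u := u, c := c, top := top, spread := pre ++ spread, mid := mid,
         spread' := pre' ++ spread', pop := pop, sel := sel }

/-- Position of the one with number `e` (counting from `0`) at or after position `p`, looking at
a bounded number of chunks. -/
def scanChunks (w : ℕ) (I : SelectIndex) (v : Bits) : ℕ → ℕ → ℕ → Timed ℕ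
  | 0, _, _ => pure 0
  | k + 1, p, e => do
    let x ← readField w v p I.c
    let m ← readField w I.pop (x * I.c.size) I.c.size
    tick 1
    if e < m then do
      let y ← readField w I.sel ((x * I.c + e) * I.c.size) I.c.size
      pure (p + y)
    else scanChunks w I v k (p + I.c) (e - m)

/-- Position of the one with number `i` (counting from `0`) in `v`. -/
def select (w : ℕ) (I : SelectIndex) (v : Bits) (i : ℕ) : Timed ℕ := do
  tick 1
  let g := i / I.t
  let r := i % I.t
  let P ← readField w I.top (g * I.t) I.t
  let P' ← readField w I.top ((g + 1) * I.t) I.t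
  if I.t * I.t ≤ P' - P then readField w I.spread (P + r * I.t) I.t
  else do
    let q := I.t / I.u + 1
    let s := r / I.u
    let e := r % I.u
    let a ← readField w I.mid ((g * (q + 1) + s) * I.u) I.u
    let a' ← readField w I.mid ((g * (q + 1) + s + 1) * I.u) I.u
    if I.u * I.u ≤ a' - a then do
      let y ← readField w I.spread' (P + a + e * I.u) I.u
      pure (P + y)
    else scanChunks w I v (I.u * I.u / I.c + 1) (P + a) e

/-! ## Elias–Fano and Golomb–Rice coding -/

/-- A sequence of numbers, split into `low` lower bits (stored in `lo`) and
upper parts (stored in unary in `hi`). -/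
structure CodedSeq where
  low : ℕ
  hi : Bits
  lo : Bits
  idx : SelectIndex

def CodedSeq.space (D : CodedSeq) : ℕ :=
  D.low.size + D.hi.length + D.lo.length + D.idx.space

/-- For a monotone sequence `a`, sets bit `(a i >>> ℓ) + i` for every `i`. -/
def eliasFanoUpper (ℓ : ℕ) : ℕ → List ℕ → Timed Bits
  | _, [] => pure []
  | prev, a :: as => do
    let u := a / 2 ^ ℓ
    tick 1
    let z ← zeros (u - prev)
    let rest ← eliasFanoUpper ℓ u as
    pure (z ++ true :: rest)

/-- The unary codes (`q` zeros and a one) of the quotients. -/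
def riceUpper (k : ℕ) : List ℕ → Timed Bits
  | [] => pure []
  | a :: as => do
    tick 1
    let z ← zeros (a / 2 ^ k)
    let rest ← riceUpper k as
    pure (z ++ true :: rest)

def lowerBits (ℓ : ℕ) : List ℕ → Timed Bits
  | [] => pure []
  | a :: as => do
    tick 1
    let x ← field ℓ (a % 2 ^ ℓ)
    let rest ← lowerBits ℓ as
    pure (x ++ rest)

/-- Elias–Fano coding of a monotone sequence of numbers `≤ univ`, with
`⌈log₂ (univ / length)⌉` lower bits per item. -/
def eliasFano (univ : ℕ) (as : List ℕ) : Timed CodedSeq := do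
  tick (as.length + 1)
  let ℓ := Nat.clog 2 ((univ + as.length - 1) / as.length)
  let hi ← eliasFanoUpper ℓ 0 as
  let lo ← lowerBits ℓ as
  let idx ← buildSelect hi
  pure { low := ℓ, hi := hi, lo := lo, idx := idx }

def eliasFanoGet (w : ℕ) (D : CodedSeq) (i : ℕ) : Timed ℕ := do
  let s ← select w D.idx D.hi i
  let y ← readField w D.lo (i * D.low) D.low
  pure ((s - i) * 2 ^ D.low + y)

/-- Golomb–Rice coding with parameter `2 ^ k`. -/
def golombRice (k : ℕ) (as : List ℕ) : Timed CodedSeq := do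
  tick 1
  let hi ← riceUpper k as
  let lo ← lowerBits k as
  let idx ← buildSelect hi
  pure { low := k, hi := hi, lo := lo, idx := idx }

def golombRiceGet (w : ℕ) (D : CodedSeq) (i : ℕ) : Timed ℕ := do
  let s ← select w D.idx D.hi i
  let start ← if i = 0 then (pure 0 : Timed ℕ) else do
    let s' ← select w D.idx D.hi (i - 1)
    pure (s' + 1)
  let y ← readField w D.lo (i * D.low) D.low
  pure ((s - start) * 2 ^ D.low + y)

/-! ## Ideal hash functions -/

/-- Names of the hash functions: the bucket of an object, its class, and its candidate cell number
`idx` in the attempt with the given seed. -/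
inductive HashName where
  | bucket : HashName
  | cls : HashName
  | cell (seed idx : ℕ) : HashName

/-- A realization of all hash functions: for every object, every name, and every
range size `m + 1` a value in `{0, …, m}`. -/
abbrev Hashes (U : Type) : Type := (i : U × HashName × ℕ) → Fin (i.2.2 + 1)

/-- Fully random hash functions: all the values are independent and uniformly distributed. -/
noncomputable def hashMeasure (U : Type) : Measure (Hashes U) :=
  Measure.infinitePi fun i : U × HashName × ℕ => (PMF.uniformOfFintype (Fin (i.2.2 + 1))).toMeasure

/-- The hash value of `x` in `{0, …, m - 1}` (and `0` for `m = 0`). -/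
def hashValue {U : Type} (h : Hashes U) (x : U) (name : HashName) (m : ℕ) : ℕ :=
  match m with
  | 0 => 0
  | k + 1 => (h (x, name, k)).val

/-- Evaluating a hash function takes one step. -/
def hash {U : Type} (h : Hashes U) (x : U) (name : HashName) (m : ℕ) : Timed ℕ := do
  tick 1
  pure (hashValue h x name m)

/-! ## Retrieval data structures -/

/-- A (randomized) retrieval data structure for the objects `U`, used as a black box:
`build ω r kvs` represents a function with `r`-bit values that is given by a list of key–value
pairs; `ω` is the randomness of the construction (such as the hash functions it uses), which
queries can access as well. -/
structure Retrieval (U : Type) where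
  Ω : Type
  mΩ : MeasurableSpace Ω
  μ : Measure Ω
  isProb : IsProbabilityMeasure μ
  build : Ω → (r : ℕ) → List (U × ℕ) → Timed Bits
  query : Ω → (r : ℕ) → Bits → U → Timed ℕ

attribute [instance] Retrieval.mΩ Retrieval.isProb

/-- The retrieval data structure is correct, has linear expected construction time and
space, and constant query time, for values of one, two and three bits; `c` is
the constant. -/
structure Retrieval.IsLinear {U : Type} (R : Retrieval U) (c : ℕ) : Prop where
  measurable_cost : ∀ r kvs, Measurable fun ω => ((R.build ω r kvs).cost : ℝ≥0∞)
  measurable_length : ∀ r kvs, Measurable fun ω => (R.build ω r kvs).val.length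
  correct : ∀ r, 1 ≤ r → r ≤ 3 → ∀ kvs : List (U × ℕ), (kvs.map Prod.fst).Nodup →
    (∀ e ∈ kvs, e.2 < 2 ^ r) →
    ∀ᵐ ω ∂(R.μ), ∀ e ∈ kvs, (R.query ω r (R.build ω r kvs).val e.1).val = e.2
  build_time : ∀ r, 1 ≤ r → r ≤ 3 → ∀ kvs : List (U × ℕ), (kvs.map Prod.fst).Nodup →
    (∀ e ∈ kvs, e.2 < 2 ^ r) →
    ∫⁻ ω, ((R.build ω r kvs).cost : ℝ≥0∞) ∂(R.μ) ≤ c * (kvs.length + 1)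
  space : ∀ r, 1 ≤ r → r ≤ 3 → ∀ kvs : List (U × ℕ), (kvs.map Prod.fst).Nodup →
    (∀ e ∈ kvs, e.2 < 2 ^ r) →
    ∫⁻ ω, ((R.build ω r kvs).val.length : ℝ≥0∞) ∂(R.μ) ≤ c * (kvs.length + 1)
  query_time : ∀ r, 1 ≤ r → r ≤ 3 → ∀ kvs : List (U × ℕ), (kvs.map Prod.fst).Nodup →
    (∀ e ∈ kvs, e.2 < 2 ^ r) →
    ∀ᵐ ω ∂(R.μ), ∀ x, (R.query ω r (R.build ω r kvs).val x).cost ≤ c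

/-! ## Cuckoo hashing with breadth-first-search insertion -/

/-- A cuckoo hash table: the object stored in each cell; for each object its cell and
the number of the hash function that gives this cell.  Objects are numbered `0, 1, …`. -/
structure CuckooTable where
  occ : ℕ → Option ℕ
  pos : ℕ → Option (ℕ × ℕ)

def CuckooTable.empty : CuckooTable := ⟨fun _ => none, fun _ => none⟩

/-- Breadth-first-search predecessors: `pred c = some (j, i)` if cell `c` was first reached as the
`i`-th candidate cell of object `j`. -/
abbrev Pred := ℕ → Option (ℕ × ℕ)

/-- Visit the candidate cells `cand i` of object `j`, for `i` in the given list; returns the newly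
reached cells. -/
def expand (cand : ℕ → ℕ) (j : ℕ) : List ℕ → Pred → Timed (List ℕ × Pred)
  | [], pred => pure ([], pred)
  | i :: is, pred => do
    tick 1
    let c := cand i
    if (pred c).isSome then expand cand j is pred
    else do
      let r ← expand cand j is (Function.update pred c (some (j, i)))
      pure (c :: r.1, r.2)

/-- Process the queue of reached cells until an empty cell is found. -/
def bfs (deg : ℕ → ℕ) (cand : ℕ → ℕ → ℕ) (T : CuckooTable) :
    ℕ → List ℕ → Pred → Timed (Option (ℕ × Pred))
  | 0, _, _ => pure none
  | _ + 1, [], _ => pure none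
  | k + 1, c :: queue, pred => do
    tick 1
    match T.occ c with
    | none => pure (some (c, pred))
    | some j => do
      let r ← expand (cand j) j (List.range (deg j)) pred
      bfs deg cand T k (queue ++ r.1) r.2

/-- Move the objects along the path that ends in the empty cell `c`. -/
def augment (pred : Pred) : ℕ → ℕ → CuckooTable → Timed CuckooTable
  | 0, _, T => pure T
  | k + 1, c, T => do
    tick 1
    match pred c with
    | none => pure T
    | some (j, i) => do
      let T' : CuckooTable :=
        ⟨Function.update T.occ c (some j), Function.update T.pos j (some (c, i))⟩
      match T.pos j with
      | none => pure T'
      | some (c', _) => augment pred k c' T'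

/-- Insert object `j` into a table with `m` cells. -/
def insert (m : ℕ) (deg : ℕ → ℕ) (cand : ℕ → ℕ → ℕ) (T : CuckooTable) (j : ℕ) :
    Timed (Option CuckooTable) := do
  tick (m + 1)
  let r ← expand (cand j) j (List.range (deg j)) fun _ => none
  let res ← bfs deg cand T (m + 1) r.1 r.2
  match res with
  | none => pure none
  | some (c, pred) => do
    let T' ← augment pred (m + 1) c T
    pure (some T')

/-- Insert the objects of a list one after the other, giving up as soon as an insertion fails. -/
def insertAll (m : ℕ) (deg : ℕ → ℕ) (cand : ℕ → ℕ → ℕ) :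
    List ℕ → CuckooTable → Timed (Option CuckooTable)
  | [], T => pure (some T)
  | j :: js, T => do
    let res ← insert m deg cand T j
    match res with
    | none => pure none
    | some T' => insertAll m deg cand js T'

/-- One attempt, with a given seed, to place the objects `X` in a table of `m` cells, where the
`j`-th object has `deg j` candidate cells. -/
def tryTable {U : Type} (h : Hashes U) (X : List U) (m : ℕ) (deg : ℕ → ℕ) (seed : ℕ) :
    Timed (Option CuckooTable) := do
  tick (m + X.length + 1)
  insertAll m deg
    (fun j i => match X[j]? with
      | some x => hashValue h x (.cell seed i) m
      | none => 0)
    (List.range X.length) CuckooTable.empty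

/-! ## SicHash -/

/-- The tuning parameters of SicHash. -/
structure Params where
  /-- expected bucket size -/
  b : ℕ
  b_pos : 0 < b
  /-- load factor of the cuckoo hash tables -/
  α : ℚ
  α_pos : 0 < α
  α_le : α ≤ 1
  /-- fraction of the objects with two candidate cells -/
  p₁ : ℚ
  /-- fraction of the objects with four candidate cells; the others have eight -/
  p₂ : ℚ
  p₁_nonneg : 0 ≤ p₁
  p₂_nonneg : 0 ≤ p₂
  p_le : p₁ + p₂ ≤ 1
  /-- the Golomb–Rice parameter is `2 ^ rice` -/
  rice : ℕ

/-- The number of cells of a table with load factor `α` for `n` objects. -/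
def numCells (α : ℚ) (n : ℕ) : ℕ := ⌊(n : ℚ) / α⌋₊

/-- The number of buckets for `N` objects. -/
def Params.numBuckets (P : Params) (N : ℕ) : ℕ := (N + P.b - 1) / P.b

/-- The class of an object is `1`, `2`, `3` with probability `p₁`, `p₂`, `1 - p₁ - p₂`.
Objects of class `r` have `2 ^ r` candidate cells. -/
def classOf {U : Type} (P : Params) (h : Hashes U) (x : U) : Timed ℕ := do
  let q := P.p₁.den * P.p₂.den
  let v ← hash h x .cls q
  pure (if (v : ℚ) < P.p₁ * q then 1 else if (v : ℚ) < (P.p₁ + P.p₂) * q then 2 else 3)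

def classesOf {U : Type} (P : Params) (h : Hashes U) : List U → Timed (List ℕ)
  | [] => pure []
  | x :: xs => do
    let r ← classOf P h x
    let rs ← classesOf P h xs
    pure (r :: rs)

/-- Cuckoo hash table construction with load factor `α` has constant success probability:
it is bounded away from zero for all sets of objects and for every assignment of
numbers of candidate cells to them. -/
def ConstantSuccess (α : ℚ) : Prop :=
  ∃ δ : ℝ≥0∞, 0 < δ ∧ ∀ (U : Type) (X : List U), X.Nodup →
    ∀ deg : ℕ → ℕ, (∀ j, deg j = 2 ∨ deg j = 4 ∨ deg j = 8) → ∀ seed : ℕ,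
      δ ≤ hashMeasure U {h | (tryTable h X (numCells α X.length) deg seed).val.isSome}

/-- Distribute the objects to buckets. -/
def partition {U : Type} (h : Hashes U) (B : ℕ) : List U → Timed (ℕ → List U)
  | [] => do
    tick (B + 1)
    pure fun _ => []
  | x :: xs => do
    let T ← partition h B xs
    let i ← hash h x .bucket B
    pure (Function.update T i (x :: T i))

/-- What the construction knows about a bucket: number of cells, seed, for each cell whether it
is used, and for each object its class and the hash function that placed it. -/
structure BucketData (U : Type) where
  cells : ℕ
  seed : ℕ
  used : List Bool
  entries : List (U × ℕ × ℕ)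

noncomputable def buildBucket {U : Type} (P : Params) (h : Hashes U) (X : List U) :
    Timed (BucketData U) := do
  let n := X.length
  tick (n + 1)
  let m := numCells P.α n
  let rs ← classesOf P h X
  let res ← firstSuccess CuckooTable.empty
    (tryTable h X m fun j => 2 ^ rs.getD j 3)
  let T := res.2
  tick (m + n)
  let idx := (List.range n).map fun j => ((T.pos j).getD (0, 0)).2
  pure { cells := m, seed := res.1, used := (List.range m).map fun c => (T.occ c).isSome,
         entries := X.zip (rs.zip idx) }

noncomputable def buildBuckets {U : Type} (P : Params) (h : Hashes U) (T : ℕ → List U) :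
    List ℕ → Timed (List (BucketData U))
  | [] => pure []
  | i :: is => do
    let b ← buildBucket P h (T i)
    let bs ← buildBuckets P h T is
    pure (b :: bs)

/-- Exclusive prefix sums, followed by the total. -/
def prefixSums : ℕ → List ℕ → Timed (List ℕ)
  | s, [] => do
    tick 1
    pure [s]
  | s, a :: as => do
    tick 1
    let rest ← prefixSums (s + a) as
    pure (s :: rest)

/-- The key–value pairs of the objects of class `r`. -/
def classPairs {U : Type} (r : ℕ) : List (U × ℕ × ℕ) → Timed (List (U × ℕ))
  | [] => pure []
  | e :: es => do
    tick 1
    let rest ← classPairs r es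
    pure (if e.2.1 = r then (e.1, e.2.2) :: rest else rest)

/-- The SicHash data structure: number of objects `N`, number of buckets `B`, output range `M`,
offsets and seeds of the buckets, and the retrieval data structures of the three classes. -/
structure PHF where
  N : ℕ
  B : ℕ
  M : ℕ
  offsets : CodedSeq
  seeds : CodedSeq
  ret₁ : Bits
  ret₂ : Bits
  ret₃ : Bits

/-- Space consumption in bits. -/
def PHF.space (D : PHF) : ℕ :=
  D.N.size + D.B.size + D.M.size + D.offsets.space + D.seeds.space +
    D.ret₁.length + D.ret₂.length + D.ret₃.length

/-- Construction.  Also returns for each cell whether it is used. -/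
noncomputable def constructAux {U : Type} (P : Params) (R : Retrieval U) (h : Hashes U)
    (ω : R.Ω) (S : List U) : Timed (PHF × List Bool) := do
  let N := S.length
  tick (N + 1)
  let B := P.numBuckets N
  let T ← partition h B S
  let bs ← buildBuckets P h T (List.range B)
  tick (4 * B)
  let offs ← prefixSums 0 (bs.map BucketData.cells)
  let M := offs.getLastD 0
  let offsets ← eliasFano M offs
  let seeds ← golombRice P.rice (bs.map BucketData.seed)
  let entries := bs.flatMap BucketData.entries
  let used := bs.flatMap BucketData.used
  tick (N + M)
  let kv₁ ← classPairs 1 entries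
  let kv₂ ← classPairs 2 entries
  let kv₃ ← classPairs 3 entries
  let ret₁ ← R.build ω 1 kv₁
  let ret₂ ← R.build ω 2 kv₂
  let ret₃ ← R.build ω 3 kv₃
  pure ({ N := N, B := B, M := M, offsets := offsets, seeds := seeds,
          ret₁ := ret₁, ret₂ := ret₂, ret₃ := ret₃ }, used)

/-- Construction of a SicHash perfect hash function for the objects in `S`. -/
noncomputable def construct {U : Type} (P : Params) (R : Retrieval U) (h : Hashes U)
    (ω : R.Ω) (S : List U) : Timed PHF := do
  let res ← constructAux P R h ω S
  pure res.1

/-- Query, with words of `w` bits. -/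
def queryAux {U : Type} (P : Params) (R : Retrieval U) (h : Hashes U) (ω : R.Ω)
    (w : ℕ) (D : PHF) (x : U) : Timed ℕ := do
  let r ← classOf P h x
  let i ← R.query ω r (if r = 1 then D.ret₁ else if r = 2 then D.ret₂ else D.ret₃) x
  let k ← hash h x .bucket D.B
  let seed ← golombRiceGet w D.seeds k
  let o ← eliasFanoGet w D.offsets k
  let o' ← eliasFanoGet w D.offsets (k + 1)
  let c ← hash h x (.cell seed i) (o' - o)
  pure (o + c)

/-- Evaluating the perfect hash function at `x`.  Words are just long enough to address the
bits of the data structure and to hold the number of objects. -/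
def query {U : Type} (P : Params) (R : Retrieval U) (h : Hashes U) (ω : R.Ω) (D : PHF) (x : U) :
    Timed ℕ :=
  queryAux P R h ω (D.N + D.space).size D x

/-! ## Minimal perfect hashing -/

/-- The minimal variant: cells `≥ N` are re-mapped to the unused cells `< N`, through a monotone
sequence of length `M - N`. -/
structure MPHF where
  base : PHF
  holes : CodedSeq

def MPHF.space (D : MPHF) : ℕ := D.base.space + D.holes.space

/-- The images of the cells `N, N + 1, …`; `free` lists the unused cells `< N`.  Unused
cells are mapped to the next hole that is still available (`N` if there is none). -/
def remap (N : ℕ) : List Bool → List ℕ → Timed (List ℕ)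
  | [], _ => pure []
  | u :: us, free => do
    tick 1
    let rest ← remap N us (if u then free.tail else free)
    pure (free.headD N :: rest)

noncomputable def constructMinimal {U : Type} (P : Params) (R : Retrieval U) (h : Hashes U)
    (ω : R.Ω) (S : List U) : Timed MPHF := do
  let res ← constructAux P R h ω S
  let D := res.1
  let used := res.2
  tick (D.M + 1)
  let free := (List.range D.N).filter fun c => !(used.getD c false)
  let targets ← remap D.N (used.drop D.N) free
  let holes ← eliasFano D.N targets
  pure { base := D, holes := holes }

def queryMinimal {U : Type} (P : Params) (R : Retrieval U) (h : Hashes U) (ω : R.Ω)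
    (D : MPHF) (x : U) : Timed ℕ := do
  let w := (D.base.N + D.space).size
  let v ← queryAux P R h ω w D.base x
  tick 1
  if v < D.base.N then pure v else eliasFanoGet w D.holes (v - D.base.N)

end SicHash

namespace SicHash

/-! ## Values and costs of the basic operations -/

/-! Construction time and space reduce to one moment of the load of a bucket. Breadth-first
insertion fails only by exhibiting a set `F` of cells and `|F| + 1` objects all of whose candidates
lie in `F` (`insert_spec`). Hence an attempt succeeds whenever the candidates with index 0 of the n
objects are distinct, whatever the classes are. Since a load factor at most 1 gives m ≥ n cells,
distinctness has probability m(m-1)…(m-n+1)/mⁿ ≥ n!/nⁿ ≥ 3⁻ⁿ (`le_measure_distinctFirst`). Different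
seeds use independent hash values, so for a given content of the bucket at most 3ⁿ attempts are
expected (`setLIntegral_trials_le`). One attempt takes O((n+1)²) steps, which is absorbed in 2ⁿ, and
the expected cost of the bucket is O(E 6ⁿ).

The load n is binomial with parameters N and 1/B, where N ≤ bB. Therefore E 6ⁿ = (1 + 5/B)^N ≤
e^(5b) ≤ 243^b (`lintegral_bucket_pow`, `ratio_pow_le`), and summing over B ≤ N buckets gives a
linear bound for every load factor (`lintegral_work_le`). The same sum bounds the seeds, hence the
length of their Golomb–Rice code. Its finite expectation also shows that almost surely every bucket
has a working seed (`ae_allPlaceable`); for such hash functions, and with correct retrieval,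
correctness of the data structure is deterministic (`exists_layoutSpec`, `queryAux_val`).

The bound 3⁻ⁿ is not uniform in n, so constant success probability needs its own argument: for load
factor 1/18 a union bound over all pairs of k cells and k + 1 objects, using only two candidates per
object, leaves failure probability at most 1/2 (`measure_failure_le`).

Queries are constant-time because `select₁` reads a bounded number of fields, each spanning a
bounded number of words (`select_val`, `select_cost_le`). In the minimal variant, exactly N cells
are used, so used cells ≥ N and unused cells < N are equally many (`LayoutSpec.bijOn`).

Two measure-theoretic points remain. The key–value lists given to retrieval are random, but only
countably many can occur, so the guarantees hold for all of them at once (`ae_retrieval`). Time and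
space depend almost surely on finitely many hash values besides the retrieval randomness, which
makes them almost everywhere measurable even for an uncountable universe
(`aemeasurable_of_locally_constant`). -/

@[simp] theorem Timed.bind_val {α β : Type} (x : Timed α) (f : α → Timed β) :
    (x >>= f).val = (f x.val).val := rfl

@[simp] theorem Timed.bind_cost {α β : Type} (x : Timed α) (f : α → Timed β) :
    (x >>= f).cost = x.cost + (f x.val).cost := rfl

@[simp] theorem Timed.pure_val {α : Type} (a : α) : (pure a : Timed α).val = a := rfl

@[simp] theorem Timed.pure_cost {α : Type} (a : α) : (pure a : Timed α).cost = 0 := rfl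

@[simp] theorem tick_cost (k : ℕ) : (tick k).cost = k := rfl

@[simp] theorem field_cost (len v : ℕ) : (field len v).cost = len + 1 := by
  simp [field]

@[simp] theorem field_val (len v : ℕ) :
    (field len v).val = (List.range len).map fun i => v.testBit i := rfl

@[simp] theorem zeros_cost (len : ℕ) : (zeros len).cost = len + 1 := by
  simp [zeros]

@[simp] theorem zeros_val (len : ℕ) : (zeros len).val = List.replicate len false := rfl

/-! ### Concatenated blocks of bits and fixed-width fields -/

theorem cat_cost (n : ℕ) (f : ℕ → Timed Bits) :
    (cat n f).cost = ∑ i ∈ Finset.range n, ((f i).cost + 1) := by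
  induction n with
  | zero => rfl
  | succ n ih => simp [cat, Finset.sum_range_succ, ih]

theorem cat_length (n : ℕ) (f : ℕ → Timed Bits) :
    (cat n f).val.length = ∑ i ∈ Finset.range n, (f i).val.length := by
  induction n with
  | zero => rfl
  | succ n ih => simp [cat, Finset.sum_range_succ, ih]

/-- The bits `xs` occur in `v` at position `p`. -/
def OccursAt (v : Bits) (p : ℕ) (xs : Bits) : Prop :=
  ∃ l r, v = l ++ xs ++ r ∧ l.length = p

theorem OccursAt.trans {v xs ys : Bits} {p q : ℕ} (h : OccursAt v p xs) (h' : OccursAt xs q ys) :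
    OccursAt v (p + q) ys := by
  obtain ⟨l, r, rfl, rfl⟩ := h
  obtain ⟨l', r', rfl, rfl⟩ := h'
  exact ⟨l ++ l', r' ++ r, by simp⟩

theorem occursAt_left (xs ys : Bits) : OccursAt (xs ++ ys) 0 xs := ⟨[], ys, by simp⟩

theorem occursAt_right (xs ys : Bits) : OccursAt (xs ++ ys) xs.length ys := ⟨xs, [], by simp⟩

theorem cat_occursAt {n i : ℕ} (h : i < n) (f : ℕ → Timed Bits) :
    OccursAt (cat n f).val (∑ j ∈ Finset.range i, (f j).val.length) (f i).val := by
  induction n with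
  | zero => omega
  | succ n ih =>
    rcases Nat.lt_succ_iff_lt_or_eq.mp h with h | rfl
    · have := (occursAt_left (cat n f).val (f n).val).trans (ih h)
      rw [zero_add] at this
      simpa [cat] using this
    · have := occursAt_right (cat i f).val (f i).val
      rw [cat_length] at this
      simpa [cat] using this

theorem cat_occursAt_of_length {n i k : ℕ} (h : i < n) (f : ℕ → Timed Bits)
    (hf : ∀ j < i, (f j).val.length = k) : OccursAt (cat n f).val (i * k) (f i).val := by
  have := cat_occursAt h f
  rwa [Finset.sum_congr rfl fun j hj => hf j (Finset.mem_range.mp hj), Finset.sum_const,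
    Finset.card_range, smul_eq_mul] at this

@[simp] theorem readField_cost (w : ℕ) (v : Bits) (p len : ℕ) :
    (readField w v p len).cost = ((1 + len / w : ℕ) : ℕ∞) := by
  simp [readField]

theorem sum_testBit (x len : ℕ) :
    (∑ i ∈ Finset.range len, if x.testBit i then 2 ^ i else 0) = x % 2 ^ len := by
  induction len with
  | zero => simp [Nat.mod_one]
  | succ n ih =>
    rw [Finset.sum_range_succ, ih, Nat.mod_pow_succ, ← Nat.toNat_testBit]
    cases x.testBit n <;> simp

theorem readField_val_eq {w : ℕ} {v : Bits} {p len x : ℕ}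
    (h : ∀ i < len, v.getD (p + i) false = x.testBit i) :
    (readField w v p len).val = x % 2 ^ len := by
  rw [← sum_testBit]
  change (∑ i ∈ Finset.range len, if v.getD (p + i) false then 2 ^ i else 0) = _
  refine Finset.sum_congr rfl fun i hi => ?_
  simp only [h i (Finset.mem_range.mp hi)]

/-- A field keeps only the `len` low-order bits, so reading it back returns the number modulo `2 ^
len`; every use below must check that the number fits. -/
theorem readField_of_occursAt {w : ℕ} {v : Bits} {p len x : ℕ}
    (h : OccursAt v p (field len x).val) : (readField w v p len).val = x % 2 ^ len := by
  obtain ⟨l, r, rfl, rfl⟩ := h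
  refine readField_val_eq fun i hi => ?_
  simp [List.getD_eq_getElem?_getD, List.getElem?_append_right, List.getElem?_append_left, hi]

theorem testBit_readField {w : ℕ} {v : Bits} {p len i : ℕ} (hi : i < len) :
    (readField w v p len).val.testBit i = v.getD (p + i) false := by
  -- Any window of bits is the binary expansion of some number, which puts `readField_val_eq` in
  -- reach.
  have key : ∀ n, ∃ x : ℕ, ∀ i < n, v.getD (p + i) false = x.testBit i := by
    intro n
    refine ⟨Nat.ofBits fun i : Fin n => v.getD (p + i) false, fun i hi => ?_⟩
    rw [Nat.testBit_ofBits_lt _ _ hi]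
  obtain ⟨x, hx⟩ := key len
  rw [readField_val_eq hx, Nat.testBit_mod_two_pow, hx i hi]
  simp [hi]

theorem readField_lt (w : ℕ) (v : Bits) (p len : ℕ) : (readField w v p len).val < 2 ^ len := by
  have key : ∃ x : ℕ, ∀ i < len, v.getD (p + i) false = x.testBit i :=
    ⟨Nat.ofBits fun i : Fin len => v.getD (p + i) false, fun i hi => by
      rw [Nat.testBit_ofBits_lt _ _ hi]⟩
  obtain ⟨x, hx⟩ := key
  rw [readField_val_eq hx]
  exact Nat.mod_lt _ (by positivity)

/-! ## Positions of ones -/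

/-- The number of `i < n` for which `f i` holds. -/
def countBelow (f : ℕ → Bool) (n : ℕ) : ℕ := ((List.range n).filter f).length

theorem countBelow_add (f : ℕ → Bool) (a b : ℕ) :
    countBelow f (a + b) = countBelow f a + countBelow (fun i => f (a + i)) b := by
  simp [countBelow, List.range_add, List.filter_map, Function.comp_def]

theorem countBelow_mono (f : ℕ → Bool) : Monotone (countBelow f) := by
  intro a b h
  obtain ⟨c, rfl⟩ := Nat.exists_eq_add_of_le h
  rw [countBelow_add]
  omega

theorem countBelow_succ (f : ℕ → Bool) (a : ℕ) :
    countBelow f (a + 1) = countBelow f a + if f a then 1 else 0 := by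
  rw [countBelow_add]
  congr 1
  cases h : f a <;> simp [countBelow, List.filter, h]

theorem countBelow_le (f : ℕ → Bool) (n : ℕ) : countBelow f n ≤ n := by
  simpa [countBelow] using List.length_filter_le f (List.range n)

/-- Duality of rank and select: a position that satisfies `f` appears in the filtered list at the
index given by its rank. -/
theorem getElem?_filter_range {f : ℕ → Bool} {n y : ℕ} (hy : y < n) (hf : f y) :
    ((List.range n).filter f)[countBelow f y]? = some y := by
  -- Split the range into the numbers below `y`, then `y` itself, then the rest.
  obtain ⟨c, rfl⟩ := Nat.exists_eq_add_of_le (Nat.succ_le_of_lt hy)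
  rw [List.range_add, List.filter_append, List.range_succ, List.filter_append, List.append_assoc,
    List.getElem?_append_right (by simp [countBelow])]
  simp [countBelow, hf]

theorem filter_range_spec {f : ℕ → Bool} {n i y : ℕ}
    (h : ((List.range n).filter f)[i]? = some y) : y < n ∧ f y ∧ countBelow f y = i := by
  have hm := List.mem_of_getElem? h
  rw [List.mem_filter, List.mem_range] at hm
  refine ⟨hm.1, hm.2, ?_⟩
  have h' := getElem?_filter_range hm.1 hm.2
  have hn : ((List.range n).filter f).Nodup := List.nodup_range.filter _
  exact (List.getElem?_inj (List.getElem?_eq_some_iff.mp h').1 hn).mp (h'.trans h.symm)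

/-- The position of the one with number `i`, and the length of `v` if there is none. -/
def onePos (v : Bits) (i : ℕ) : ℕ := (onePositions v).getD i v.length

theorem onePos_le (v : Bits) (i : ℕ) : onePos v i ≤ v.length := by
  unfold onePos
  rw [List.getD_eq_getElem?_getD]
  cases h : (onePositions v)[i]? with
  | none => simp
  | some y => exact (filter_range_spec h).1.le

theorem onePos_spec {v : Bits} {i : ℕ} (hi : i < (onePositions v).length) :
    onePos v i < v.length ∧ v.getD (onePos v i) false = true ∧
      countBelow (fun j => v.getD j false) (onePos v i) = i := by
  have h : (onePositions v)[i]? = some (onePos v i) := by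
    unfold onePos
    rw [List.getD_eq_getElem?_getD, List.getElem?_eq_getElem hi]; simp
  exact filter_range_spec h

theorem onePos_of_le {v : Bits} {i : ℕ} (hi : (onePositions v).length ≤ i) :
    onePos v i = v.length := by
  unfold onePos
  rw [List.getD_eq_default _ _ hi]

/-- The default value `v.length` exceeds the position of every one. It serves as a sentinel that
keeps `onePos` monotone on all of ℕ, so groups that run past the last one need no special treatment.
-/
theorem onePos_strict {v : Bits} {i j : ℕ} (hij : i < j) (hi : i < (onePositions v).length) :
    onePos v i < onePos v j := by
  by_cases hj : j < (onePositions v).length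
  · by_contra! h
    have := countBelow_mono (fun j => v.getD j false) h
    rw [(onePos_spec hj).2.2, (onePos_spec hi).2.2] at this
    omega
  · rw [onePos_of_le (not_lt.mp hj)]
    exact (onePos_spec hi).1

theorem onePos_mono (v : Bits) : Monotone (onePos v) := by
  intro i j h
  rcases h.lt_or_eq with h | rfl
  · by_cases hi : i < (onePositions v).length
    · exact (onePos_strict h hi).le
    · rw [onePos_of_le (by omega : (onePositions v).length ≤ j)]
      exact onePos_le _ _
  · exact le_rfl

theorem onePositions_length_le (v : Bits) : (onePositions v).length ≤ v.length :=
  countBelow_le _ _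

theorem onePos_eq {v : Bits} {y : ℕ} (hy : v.getD y false = true) :
    onePos v (countBelow (fun j => v.getD j false) y) = y := by
  have h : y < v.length := by
    by_contra h
    rw [List.getD_eq_default _ _ (not_lt.mp h)] at hy
    cases hy
  unfold onePos
  rw [List.getD_eq_getElem?_getD, onePositions, getElem?_filter_range h hy]; rfl

end SicHash

namespace SicHash

/-! ## The `select₁` directory -/

/-- Group size. -/
def selT (v : Bits) : ℕ := v.length.size

/-- Subgroup size. -/
def selU (v : Bits) : ℕ := 2 * (selT v).size

/-- Chunk size. -/
def selC (v : Bits) : ℕ := selT v / 2 + 1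

/-- Number of subgroups of a group. -/
def selQ (v : Bits) : ℕ := selT v / selU v + 1

/-- Number of groups. -/
def selG (v : Bits) : ℕ := (onePositions v).length / selT v + 1

/-- The number of the first one of a subgroup. -/
def selSub (v : Bits) (g j : ℕ) : ℕ := min (g * selT v + j * selU v) ((g + 1) * selT v)

def topBits (v : Bits) : Timed Bits :=
  cat (selG v + 1) fun g => field (selT v) (onePos v (g * selT v))

def spreadGroup (v : Bits) (g : ℕ) : Timed Bits := do
  let len := onePos v ((g + 1) * selT v) - onePos v (g * selT v)
  if selT v * selT v ≤ len then do
    let xs ← cat (selT v) fun j => field (selT v) (onePos v (g * selT v + j))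
    let pad ← zeros (len - selT v * selT v)
    pure (xs ++ pad)
  else zeros len

def midGroup (v : Bits) (g : ℕ) : Timed Bits :=
  cat (selQ v + 1) fun j => field (selU v) (onePos v (selSub v g j) - onePos v (g * selT v))

def spreadSubgroup (v : Bits) (g j : ℕ) : Timed Bits := do
  let len' := onePos v (selSub v g (j + 1)) - onePos v (selSub v g j)
  if selU v * selU v ≤ len' then do
    let xs ← cat (selU v) fun e =>
      field (selU v) (onePos v (g * selT v + j * selU v + e) - onePos v (g * selT v))
    let pad ← zeros (len' - selU v * selU v)
    pure (xs ++ pad)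
  else zeros len'

def spreadGroup' (v : Bits) (g : ℕ) : Timed Bits := do
  let len := onePos v ((g + 1) * selT v) - onePos v (g * selT v)
  if selT v * selT v ≤ len then zeros len
  else cat (selQ v) (spreadSubgroup v g)

def popBits (c : ℕ) : Timed Bits :=
  cat (2 ^ c) fun x => do
    tick c
    field c.size (onesOfNat c x).length

def selBits (c : ℕ) : Timed Bits :=
  cat (2 ^ c) fun x => cat c fun j => do
    tick c
    field c.size ((onesOfNat c x).getD j 0)

/-- Definitional: the named pieces above are the local blocks of `buildSelect`, so that each can be
analysed separately. -/
theorem buildSelect_val (v : Bits) : (buildSelect v).val =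
    { t := selT v, u := selU v, c := selC v, top := (topBits v).val,
      spread := (zeros (onePos v 0)).val ++ (cat (selG v) (spreadGroup v)).val,
      mid := (cat (selG v) (midGroup v)).val,
      spread' := (zeros (onePos v 0)).val ++ (cat (selG v) (spreadGroup' v)).val,
      pop := (popBits (selC v)).val, sel := (selBits (selC v)).val } := rfl

theorem buildSelect_cost (v : Bits) : (buildSelect v).cost =
    ((v.length + 1 : ℕ) : ℕ∞) + ((topBits v).cost + ((zeros (onePos v 0)).cost +
      ((cat (selG v) (spreadGroup v)).cost + ((cat (selG v) (midGroup v)).cost +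
        ((zeros (onePos v 0)).cost + ((cat (selG v) (spreadGroup' v)).cost +
          ((popBits (selC v)).cost + ((selBits (selC v)).cost + 0)))))))) := rfl

theorem selT_le_selQ_mul (v : Bits) : selT v ≤ selQ v * selU v := by
  unfold selQ
  rcases Nat.eq_zero_or_pos (selU v) with h | h
  · have : selT v = 0 := by
      unfold selU at h
      have : (selT v).size = 0 := by omega
      exact Nat.size_eq_zero.mp this
    omega
  · have := Nat.div_add_mod (selT v) (selU v)
    have := Nat.mod_lt (selT v) h
    nlinarith

theorem selSub_zero (v : Bits) (g : ℕ) : selSub v g 0 = g * selT v := by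
  unfold selSub
  rw [zero_mul, add_zero, min_eq_left]
  exact Nat.mul_le_mul_right _ (Nat.le_succ g)

theorem selSub_selQ (v : Bits) (g : ℕ) : selSub v g (selQ v) = (g + 1) * selT v := by
  unfold selSub
  rw [min_eq_right]
  have := selT_le_selQ_mul v
  rw [add_mul]
  omega

theorem selSub_mono (v : Bits) (g : ℕ) : Monotone (selSub v g) := by
  intro a b h
  unfold selSub
  have := Nat.mul_le_mul_right (selU v) h
  omega

/-- A spread group holds t fields of t bits and is padded to the number of bits it spans in `v`.
Blocks in `spread` thus start exactly where their groups start in `v`, and no pointers are needed.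
-/
theorem spreadGroup_length (v : Bits) (g : ℕ) : (spreadGroup v g).val.length =
    onePos v ((g + 1) * selT v) - onePos v (g * selT v) := by
  unfold spreadGroup
  dsimp only
  split_ifs with h
  · simp [cat_length]
    omega
  · simp

theorem spreadSubgroup_length (v : Bits) (g j : ℕ) : (spreadSubgroup v g j).val.length =
    onePos v (selSub v g (j + 1)) - onePos v (selSub v g j) := by
  unfold spreadSubgroup
  dsimp only
  split_ifs with h
  · simp [cat_length]
    omega
  · simp

/-- The spans of consecutive subgroups telescope, so a subgroup starts inside its group's block at
its position relative to the group. -/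
theorem sum_spreadSubgroup_length (v : Bits) (g s : ℕ) :
    ∑ j ∈ Finset.range s, (spreadSubgroup v g j).val.length =
      onePos v (selSub v g s) - onePos v (g * selT v) := by
  have := Finset.sum_range_tsub ((onePos_mono v).comp (selSub_mono v g)) s
  simpa [spreadSubgroup_length, selSub_zero] using this

theorem spreadGroup'_length (v : Bits) (g : ℕ) : (spreadGroup' v g).val.length =
    onePos v ((g + 1) * selT v) - onePos v (g * selT v) := by
  unfold spreadGroup'
  dsimp only
  split_ifs with h
  · simp
  · rw [cat_length, sum_spreadSubgroup_length, selSub_selQ]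

theorem sum_group_lengths (v : Bits) (n : ℕ) :
    ∑ g ∈ Finset.range n, (onePos v ((g + 1) * selT v) - onePos v (g * selT v)) =
      onePos v (n * selT v) - onePos v 0 := by
  have := Finset.sum_range_tsub
    ((onePos_mono v).comp (fun a b h => Nat.mul_le_mul_right (selT v) h :
      Monotone fun g => g * selT v)) n
  simpa using this

/-- The initial zeros account for the bits before the first one and the spans of the earlier groups
telescope; together they reach the first one of group `g`. -/
theorem occursAt_group {v : Bits} {f : ℕ → Timed Bits}
    (hf : ∀ g, (f g).val.length = onePos v ((g + 1) * selT v) - onePos v (g * selT v))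
    {g : ℕ} (hg : g < selG v) :
    OccursAt ((zeros (onePos v 0)).val ++ (cat (selG v) f).val) (onePos v (g * selT v))
      (f g).val := by
  have := (occursAt_right (zeros (onePos v 0)).val (cat (selG v) f).val).trans
    (cat_occursAt hg f)
  simp only [hf, sum_group_lengths] at this
  have h := onePos_mono v (Nat.zero_le (g * selT v))
  simpa [Nat.add_sub_cancel' h] using this

theorem onePos_lt_two_pow (v : Bits) (i : ℕ) : onePos v i < 2 ^ selT v :=
  (onePos_le v i).trans_lt (Nat.lt_size_self _)

/-- Positions relative to a dense group are below t², hence fit into u bits, where u is twice the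
bit length of t. -/
theorem sq_selT_le (v : Bits) : selT v * selT v ≤ 2 ^ selU v := by
  have := (Nat.lt_size_self (selT v)).le
  calc selT v * selT v ≤ 2 ^ (selT v).size * 2 ^ (selT v).size := Nat.mul_le_mul this this
    _ = 2 ^ selU v := by rw [← pow_add, selU, two_mul]

theorem readField_top {w : ℕ} (v : Bits) {g : ℕ} (hg : g < selG v + 1) :
    (readField w (topBits v).val (g * selT v) (selT v)).val = onePos v (g * selT v) := by
  rw [readField_of_occursAt (x := onePos v (g * selT v)),
    Nat.mod_eq_of_lt (onePos_lt_two_pow v _)]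
  exact cat_occursAt_of_length hg (fun g => field (selT v) (onePos v (g * selT v)))
    (by simp)

/-- Density of the group (`h`) is what prevents overflow of the u-bit fields. -/
theorem readField_mid {w : ℕ} (v : Bits) {g j : ℕ} (hg : g < selG v) (hj : j < selQ v + 1)
    (h : onePos v ((g + 1) * selT v) - onePos v (g * selT v) < selT v * selT v) :
    (readField w (cat (selG v) (midGroup v)).val ((g * (selQ v + 1) + j) * selU v)
      (selU v)).val = onePos v (selSub v g j) - onePos v (g * selT v) := by
  rw [readField_of_occursAt (x := onePos v (selSub v g j) - onePos v (g * selT v)),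
    Nat.mod_eq_of_lt]
  · refine lt_of_lt_of_le (lt_of_le_of_lt ?_ h) (sq_selT_le v)
    exact Nat.sub_le_sub_right (onePos_mono v (min_le_right _ _)) _
  · have h1 : OccursAt (cat (selG v) (midGroup v)).val (g * ((selQ v + 1) * selU v))
        (midGroup v g).val :=
      cat_occursAt_of_length hg _ fun j _ => by simp [midGroup, cat_length]
    have h2 : OccursAt (midGroup v g).val (j * selU v)
        (field (selU v) (onePos v (selSub v g j) - onePos v (g * selT v))).val :=
      cat_occursAt_of_length hj
        (fun j => field (selU v) (onePos v (selSub v g j) - onePos v (g * selT v)))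
        (by simp)
    have := h1.trans h2
    rwa [show g * ((selQ v + 1) * selU v) + j * selU v = (g * (selQ v + 1) + j) * selU v by
      ring] at this

theorem readField_pop {w c x : ℕ} (hx : x < 2 ^ c) :
    (readField w (popBits c).val (x * c.size) c.size).val = (onesOfNat c x).length := by
  rw [readField_of_occursAt (x := (onesOfNat c x).length), Nat.mod_eq_of_lt]
  · exact (countBelow_le _ _).trans_lt (Nat.lt_size_self c)
  · exact cat_occursAt_of_length hx (fun x => do
      tick c
      field c.size (onesOfNat c x).length) (by simp)

theorem readField_sel {w c x e : ℕ} (hx : x < 2 ^ c) (he : e < c) :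
    (readField w (selBits c).val ((x * c + e) * c.size) c.size).val =
      (onesOfNat c x).getD e 0 := by
  rw [readField_of_occursAt (x := (onesOfNat c x).getD e 0), Nat.mod_eq_of_lt]
  · refine lt_of_le_of_lt ?_ (Nat.lt_size_self c)
    rw [List.getD_eq_getElem?_getD]
    cases h : (onesOfNat c x)[e]? with
    | none => simp
    | some y => exact (filter_range_spec h).1.le
  · have h1 := cat_occursAt_of_length (k := c * c.size) hx (fun x => cat c fun j => do
      tick c
      field c.size ((onesOfNat c x).getD j 0)) (by simp [cat_length])
    have h2 := cat_occursAt_of_length (k := c.size) he (fun j => do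
      tick c
      field c.size ((onesOfNat c x).getD j 0)) (by simp)
    have := h1.trans h2
    rwa [show x * (c * c.size) + e * c.size = (x * c + e) * c.size by ring] at this

/-- The invariant `he` says that `e` ones lie between `p` and the target. If the target is in the
current chunk, it is the one with index `e` there; otherwise all ones of the chunk precede the
target and are subtracted from `e`. -/
theorem scanChunks_val {w : ℕ} {I : SelectIndex} {v : Bits} (hpop : I.pop = (popBits I.c).val)
    (hsel : I.sel = (selBits I.c).val) {y : ℕ} (hy : v.getD y false = true) (k p e : ℕ)
    (hp : p ≤ y) (hk : y < p + k * I.c)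
    (he : countBelow (fun j => v.getD j false) y = countBelow (fun j => v.getD j false) p + e) :
    (scanChunks w I v k p e).val = y := by
  induction k generalizing p e with
  | zero => omega
  | succ k ih =>
    obtain ⟨d, rfl⟩ := Nat.exists_eq_add_of_le hp
    set x := (readField w v p I.c).val with hx
    have hx2 : x < 2 ^ I.c := readField_lt _ _ _ _
    have hones : onesOfNat I.c x = (List.range I.c).filter fun i => v.getD (p + i) false := by
      refine List.filter_congr fun i hi => ?_
      rw [hx, testBit_readField (List.mem_range.mp hi)]
    have hlen : (onesOfNat I.c x).length = countBelow (fun i => v.getD (p + i) false) I.c := by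
      rw [hones, countBelow]
    rw [countBelow_add, add_right_inj] at he
    simp only [scanChunks, Timed.bind_val]
    rw [← hx, hpop, readField_pop hx2]
    by_cases hd : d < I.c
    · have hlt : e < (onesOfNat I.c x).length := by
        rw [hlen, ← he]
        have := countBelow_mono (fun i => v.getD (p + i) false) (Nat.succ_le_of_lt hd)
        rw [Nat.succ_eq_add_one, countBelow_succ] at this
        simp only [hy, if_true] at this
        omega
      have hec : e < I.c := hlt.trans_le (countBelow_le _ _)
      rw [if_pos hlt, Timed.bind_val, hsel, readField_sel hx2 hec]
      have : (onesOfNat I.c x)[e]? = some d := by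
        rw [hones, ← he]
        exact getElem?_filter_range hd hy
      simp [List.getD_eq_getElem?_getD, this]
    · have hle : (onesOfNat I.c x).length ≤ e := by
        rw [hlen, ← he]
        exact countBelow_mono _ (not_lt.mp hd)
      rw [if_neg (not_lt.mpr hle)]
      refine ih _ _ (by omega) ?_ ?_
      · rw [add_mul, one_mul] at hk
        omega
      · rw [countBelow_add, countBelow_add, hlen, he]
        omega

/-- The one `i` is entry `r` of group `g`. A sparse group or sparse subgroup stores its position
explicitly; in a dense subgroup the table-driven scan finds it. -/
theorem select_val {w : ℕ} {v : Bits} {i : ℕ} (hi : i < (onePositions v).length) :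
    (select w (buildSelect v).val v i).val = onePos v i := by
  have hlen : 0 < v.length := by
    have := onePositions_length_le v
    omega
  have ht : 0 < selT v := Nat.size_pos.mpr hlen
  have hu : 0 < selU v := by
    have := Nat.size_pos.mpr ht
    unfold selU
    omega
  have hc : 0 < selC v := Nat.succ_pos _
  obtain ⟨g, hgdef⟩ : ∃ g, i / selT v = g := ⟨_, rfl⟩
  obtain ⟨r, hrdef⟩ : ∃ r, i % selT v = r := ⟨_, rfl⟩
  have hir : g * selT v + r = i := by
    rw [← hgdef, ← hrdef, mul_comm]
    exact Nat.div_add_mod _ _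
  have hr : r < selT v := hrdef ▸ Nat.mod_lt _ ht
  have hg : g < selG v := by
    rw [← hgdef]
    exact Nat.lt_succ_of_le (Nat.div_le_div_right hi.le)
  rw [buildSelect_val]
  simp only [select, Timed.bind_val]
  rw [hgdef, hrdef, readField_top v (by omega), readField_top v (by omega)]
  split_ifs with hbig
  · rw [readField_of_occursAt (x := onePos v (g * selT v + r)),
      Nat.mod_eq_of_lt (onePos_lt_two_pow v _), hir]
    refine (occursAt_group (spreadGroup_length v) hg).trans ?_
    unfold spreadGroup
    dsimp only
    rw [if_pos hbig]
    have := (occursAt_left (cat (selT v) fun j => field (selT v) (onePos v (g * selT v + j))).val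
      (zeros (onePos v ((g + 1) * selT v) - onePos v (g * selT v) - selT v * selT v)).val).trans
      (cat_occursAt_of_length (k := selT v) hr
        (fun j => field (selT v) (onePos v (g * selT v + j))) (by simp))
    rwa [zero_add] at this
  · rw [Timed.bind_val, Timed.bind_val]
    obtain ⟨s, hsdef⟩ : ∃ s, r / selU v = s := ⟨_, rfl⟩
    obtain ⟨e, hedef⟩ : ∃ e, r % selU v = e := ⟨_, rfl⟩
    have hse : s * selU v + e = r := by
      rw [← hsdef, ← hedef, mul_comm]
      exact Nat.div_add_mod _ _
    have he : e < selU v := hedef ▸ Nat.mod_lt _ hu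
    have hs : s < selQ v := by
      rw [← hsdef]
      exact Nat.lt_succ_of_le (Nat.div_le_div_right hr.le)
    -- The minimum in `selSub` is not attained by the end of the group, because `s * u ≤ r < t`.
    have hsub : selSub v g s = g * selT v + s * selU v := by
      unfold selSub
      rw [min_eq_left]
      rw [add_mul, one_mul]
      omega
    have hsub' : i < selSub v g (s + 1) := by
      unfold selSub
      rw [lt_min_iff, add_mul, add_mul, one_mul, one_mul]
      omega
    have hmono1 := onePos_mono v (show g * selT v ≤ g * selT v + s * selU v by omega)
    have hmono2 := onePos_mono v (show g * selT v + s * selU v ≤ i by omega)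
    have hmono3 := onePos_strict hsub' hi
    have hmono4 := onePos_mono v (show selSub v g (s + 1) ≤ (g + 1) * selT v from min_le_right _ _)
    rw [hsdef, hedef]
    have ha := readField_mid (w := w) v hg (show s < selQ v + 1 by omega) (by omega)
    have ha' := readField_mid (w := w) v hg (show s + 1 < selQ v + 1 by omega) (by omega)
    rw [hsub] at ha
    rw [← add_assoc] at ha'
    unfold selQ at ha ha'
    rw [ha, ha']
    split_ifs with hbig'
    · rw [Timed.bind_val, readField_of_occursAt
        (x := onePos v (g * selT v + s * selU v + e) - onePos v (g * selT v)), Timed.pure_val,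
        Nat.mod_eq_of_lt]
      · rw [add_assoc (g * selT v), hse, hir]
        omega
      · refine lt_of_lt_of_le ?_ (sq_selT_le v)
        rw [add_assoc (g * selT v), hse, hir]
        omega
      -- Nested positions: the block of the group in `spread'`, the block of the subgroup in it, and
      -- the field of the one within that block.
      · refine ((occursAt_group (spreadGroup'_length v) hg).trans
          (xs := (spreadGroup' v g).val) (ys := (spreadSubgroup v g s).val)
          (q := onePos v (g * selT v + s * selU v) - onePos v (g * selT v)) ?_).trans ?_
        · unfold spreadGroup'
          dsimp only
          rw [if_neg hbig, ← hsub, ← sum_spreadSubgroup_length]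
          exact cat_occursAt hs _
        · unfold spreadSubgroup
          dsimp only
          rw [hsub, if_pos (by omega)]
          have := (occursAt_left (cat (selU v) fun e =>
            field (selU v) (onePos v (g * selT v + s * selU v + e) - onePos v (g * selT v))).val
            (zeros (onePos v (selSub v g (s + 1)) - onePos v (g * selT v + s * selU v) -
              selU v * selU v)).val).trans
            (cat_occursAt_of_length (k := selU v) he (fun e =>
              field (selU v) (onePos v (g * selT v + s * selU v + e) - onePos v (g * selT v)))
              (by simp))
          rwa [zero_add] at this
    · refine scanChunks_val (I := (buildSelect v).val) rfl rfl (onePos_spec hi).2.1 _ _ _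
        (by omega) ?_ ?_
      -- A dense subgroup spans fewer than u² bits, and u² / c + 1 chunks of c bits cover more than
      -- that.
      · have h1 := Nat.div_add_mod (selU v * selU v) (selC v)
        have h2 := Nat.mod_lt (selU v * selU v) hc
        have h3 : selU v * selU v < (selU v * selU v / selC v + 1) * selC v := by
          rw [add_mul, one_mul, mul_comm _ (selC v)]
          omega
        change _ < _ + (selU v * selU v / selC v + 1) * selC v
        omega
      · rw [(onePos_spec hi).2.2, Nat.add_sub_cancel' hmono1,
          (onePos_spec (by omega : g * selT v + s * selU v < (onePositions v).length)).2.2]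
        omega

end SicHash

namespace SicHash

/-! ## Time and space of the `select₁` directory -/

theorem cost_bind_le {α β : Type} {x : Timed α} {f : α → Timed β} {a b : ℕ}
    (hx : x.cost ≤ a) (hf : (f x.val).cost ≤ b) : (x >>= f).cost ≤ (a + b : ℕ) := by
  rw [Timed.bind_cost]
  push_cast
  exact add_le_add hx hf

theorem cat_cost_le {n : ℕ} {f : ℕ → Timed Bits} {a : ℕ → ℕ} (h : ∀ i < n, (f i).cost ≤ a i) :
    (cat n f).cost ≤ (∑ i ∈ Finset.range n, (a i + 1) : ℕ) := by
  rw [cat_cost]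
  push_cast
  exact Finset.sum_le_sum fun i hi => add_le_add (h i (Finset.mem_range.mp hi)) le_rfl

theorem cat_cost_le_const {n a : ℕ} {f : ℕ → Timed Bits} (h : ∀ i < n, (f i).cost ≤ a) :
    (cat n f).cost ≤ (n * (a + 1) : ℕ) := by
  simpa using cat_cost_le (a := fun _ => a) h

theorem size_le (n : ℕ) : n.size ≤ n := Nat.size_le.mpr Nat.lt_two_pow_self

theorem sq_le_two_pow (s : ℕ) : s * s ≤ 2 ^ (s + 1) := by
  induction s with
  | zero => simp
  | succ s ih =>
    rcases Nat.lt_or_ge s 3 with h | h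
    · interval_cases s <;> norm_num
    · rw [pow_succ]
      nlinarith

/-- If t has s + 1 bits then 2ˢ ≤ t, while (s + 1)² ≤ 2^(s+2). This is what makes the number of
scanned chunks bounded. -/
theorem sq_size_le (t : ℕ) : t.size * t.size ≤ 4 * t := by
  rcases Nat.eq_zero_or_pos t with rfl | ht
  · simp
  · obtain ⟨s, hs⟩ := Nat.exists_eq_succ_of_ne_zero (Nat.size_pos.mpr ht).ne'
    have h1 : 2 ^ s ≤ t := Nat.lt_size.mp (by omega)
    have h2 := sq_le_two_pow (s + 1)
    rw [hs, Nat.succ_eq_add_one]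
    rw [pow_add] at h2
    omega

theorem selU_le (v : Bits) : selU v ≤ 2 * selT v :=
  Nat.mul_le_mul_left 2 (size_le _)

theorem readField_cost_le {w len k : ℕ} (v : Bits) (p : ℕ) (h : len ≤ k * w) :
    (readField w v p len).cost ≤ (1 + k : ℕ) := by
  rw [readField_cost]
  exact_mod_cast Nat.add_le_add_left (Nat.div_le_of_le_mul (by rwa [mul_comm])) 1

/-- Every field read here fits in one word, so each read takes at most two steps; a chunk needs two
reads, one comparison and possibly a third read. -/
theorem scanChunks_cost_le {w : ℕ} {I : SelectIndex} (hc : I.c ≤ w) (v : Bits) (k p e : ℕ) :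
    (scanChunks w I v k p e).cost ≤ (7 * k : ℕ) := by
  induction k generalizing p e with
  | zero => exact le_rfl
  | succ k ih =>
    have hz : I.c.size ≤ 1 * w := by
      have := size_le I.c
      omega
    have h : (scanChunks w I v (k + 1) p e).cost ≤
        ((1 + 1) + ((1 + 1) + (1 + (7 * k + 2))) : ℕ) := by
      refine cost_bind_le (readField_cost_le _ _ (by omega)) (cost_bind_le
        (readField_cost_le _ _ hz) (cost_bind_le le_rfl ?_))
      split_ifs
      · refine (cost_bind_le (b := 0) (readField_cost_le _ _ hz) le_rfl).trans ?_
        exact_mod_cast (by omega : 1 + 1 + 0 ≤ 7 * k + 2)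
      · refine (ih _ _).trans ?_
        exact_mod_cast (by omega : 7 * k ≤ 7 * k + 2)
    exact h.trans (by exact_mod_cast (by omega))

theorem select_cost_le {w : ℕ} {v : Bits} (hw : 0 < w) (hv : v.length.size ≤ w) (v' : Bits)
    (i : ℕ) : (select w (buildSelect v).val v' i).cost ≤ (300 : ℕ) := by
  have ht : selT v ≤ 1 * w := by rwa [one_mul]
  have hu : selU v ≤ 2 * w := (selU_le v).trans (by omega)
  have hc : selC v ≤ w := by
    unfold selC
    omega
  -- With u = 2·size(t), u² = 4·size(t)² ≤ 16t ≤ 32c, because c = t / 2 + 1.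
  have hk : selU v * selU v / selC v + 1 ≤ 33 := by
    have h1 := sq_size_le (selT v)
    have h2 : selU v * selU v ≤ selC v * 32 := by
      have : selU v * selU v = 4 * ((selT v).size * (selT v).size) := by
        unfold selU
        ring
      unfold selC
      omega
    have := Nat.div_le_of_le_mul h2
    omega
  have h : (select w (buildSelect v).val v' i).cost ≤
      (1 + ((1 + 1) + ((1 + 1) + ((1 + 2) + ((1 + 2) + 7 * 33)))) : ℕ) := by
    rw [buildSelect_val]
    refine cost_bind_le le_rfl (cost_bind_le (readField_cost_le _ _ ht)
      (cost_bind_le (readField_cost_le _ _ ht) ?_))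
    split_ifs
    · refine (readField_cost_le _ _ ht).trans ?_
      norm_num
    · refine cost_bind_le (readField_cost_le _ _ hu) (cost_bind_le (readField_cost_le _ _ hu) ?_)
      split_ifs
      · refine (cost_bind_le (b := 0) (readField_cost_le _ _ hu) le_rfl).trans ?_
        norm_num
      · refine (scanChunks_cost_le (by exact hc) _ _ _ _).trans ?_
        exact_mod_cast Nat.mul_le_mul_left 7 hk
  exact h.trans (by norm_num)

theorem topBits_cost_le (v : Bits) :
    (topBits v).cost ≤ ((selG v + 1) * (selT v + 2) : ℕ) :=
  cat_cost_le_const fun i _ => by simp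

theorem midGroup_cost_le (v : Bits) (g : ℕ) :
    (midGroup v g).cost ≤ ((selQ v + 1) * (selU v + 2) : ℕ) :=
  cat_cost_le_const fun i _ => by simp

/-- The u fields take u(u + 2) steps and the padding l - u² + 1; the excess 2u is at most 2u² ≤ 2l.
-/
theorem fields_cost_le (u l : ℕ) (f : ℕ → ℕ) (h : u * u ≤ l) :
    ((cat u fun e => field u (f e)) >>= fun xs => zeros (l - u * u) >>= fun pad =>
      pure (xs ++ pad) : Timed Bits).cost ≤ (3 * l + 1 : ℕ) := by
  refine (cost_bind_le (b := l - u * u + 1) (cat_cost_le_const (a := u + 1)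
    fun i _ => by simp) (by simp)).trans ?_
  have : u ≤ u * u := Nat.le_mul_self u
  exact_mod_cast (by rw [mul_add, mul_add]; omega : u * (u + 1 + 1) + (l - u * u + 1) ≤ 3 * l + 1)

theorem spreadGroup_cost_le (v : Bits) (g : ℕ) : (spreadGroup v g).cost ≤
    (3 * (onePos v ((g + 1) * selT v) - onePos v (g * selT v)) + 1 : ℕ) := by
  unfold spreadGroup
  dsimp only
  split_ifs with h
  · exact fields_cost_le _ _ (fun j => onePos v (g * selT v + j)) h
  · rw [zeros_cost]
    exact_mod_cast (by omega)

theorem spreadSubgroup_cost_le (v : Bits) (g j : ℕ) : (spreadSubgroup v g j).cost ≤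
    (3 * (onePos v (selSub v g (j + 1)) - onePos v (selSub v g j)) + 1 : ℕ) := by
  unfold spreadSubgroup
  dsimp only
  split_ifs with h
  · exact fields_cost_le _ _
      (fun e => onePos v (g * selT v + j * selU v + e) - onePos v (g * selT v)) h
  · rw [zeros_cost]
    exact_mod_cast (by omega)

theorem spreadGroup'_cost_le (v : Bits) (g : ℕ) : (spreadGroup' v g).cost ≤
    (3 * (onePos v ((g + 1) * selT v) - onePos v (g * selT v)) + 2 * selQ v + 1 : ℕ) := by
  unfold spreadGroup'
  dsimp only
  split_ifs with h
  · rw [zeros_cost]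
    exact_mod_cast (by omega)
  · refine (cat_cost_le fun j _ => spreadSubgroup_cost_le v g j).trans ?_
    have := sum_spreadSubgroup_length v g (selQ v)
    simp only [spreadSubgroup_length, selSub_selQ] at this
    rw [Finset.sum_add_distrib, Finset.sum_add_distrib, ← Finset.mul_sum, this]
    simp only [Finset.sum_const, Finset.card_range, smul_eq_mul]
    exact_mod_cast (by omega)

/-- The spans of all groups telescope to at most `v.length`; only the additive term `k` is paid once
per group. -/
theorem cat_group_cost_le {v : Bits} {f : ℕ → Timed Bits} {k : ℕ} (hf : ∀ g, (f g).cost ≤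
    (3 * (onePos v ((g + 1) * selT v) - onePos v (g * selT v)) + k : ℕ)) :
    (cat (selG v) f).cost ≤ (3 * v.length + selG v * (k + 1) : ℕ) := by
  refine (cat_cost_le fun g _ => hf g).trans ?_
  rw [Finset.sum_add_distrib, Finset.sum_add_distrib, ← Finset.mul_sum, sum_group_lengths]
  simp only [Finset.sum_const, Finset.card_range, smul_eq_mul]
  have := onePos_le v (selG v * selT v)
  exact_mod_cast (by rw [mul_add]; omega)

theorem popBits_cost_le (c : ℕ) : (popBits c).cost ≤ (2 ^ c * (2 * c + 2) : ℕ) := by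
  refine cat_cost_le_const fun i _ => (cost_bind_le (b := c.size + 1) le_rfl (by simp)).trans ?_
  have := size_le c
  exact_mod_cast (by omega)

theorem selBits_cost_le (c : ℕ) : (selBits c).cost ≤ (2 ^ c * (c * (2 * c + 2) + 1) : ℕ) := by
  refine cat_cost_le_const fun i _ => cat_cost_le_const fun j _ =>
    (cost_bind_le (b := c.size + 1) le_rfl (by simp)).trans ?_
  have := size_le c
  exact_mod_cast (by omega)

/-- The tables are indexed by patterns of about half the bit length of n, so there are only O(√n)
patterns; the factor c² costs at most another 2^(c+1). -/
theorem two_pow_selC_mul_le (v : Bits) :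
    2 ^ selC v * (selC v * selC v) ≤ 8 * (2 * v.length + 1) := by
  have h1 : 2 ^ selT v ≤ 2 * v.length + 1 := by
    rcases Nat.eq_zero_or_pos v.length with h | h
    · simp [selT, h]
    · obtain ⟨s, hs⟩ := Nat.exists_eq_succ_of_ne_zero (Nat.size_pos.mpr h).ne'
      have h1 : 2 ^ s ≤ v.length := Nat.lt_size.mp (by omega)
      rw [selT, hs, Nat.succ_eq_add_one, pow_succ]
      omega
  have h2 : 2 ^ (selT v / 2) * 2 ^ (selT v / 2) ≤ 2 ^ selT v := by
    rw [← pow_add]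
    exact Nat.pow_le_pow_right (by norm_num) (by omega)
  have h3 := sq_le_two_pow (selC v)
  unfold selC at h3 ⊢
  set s := selT v / 2
  rw [pow_add] at h3 ⊢
  rw [pow_add] at h3
  generalize (s + 1) * (s + 1) = d at *
  generalize 2 ^ s = e at *
  nlinarith

theorem selG_mul_selT_le (v : Bits) : selG v * selT v ≤ v.length + selT v := by
  unfold selG
  rw [add_mul, one_mul]
  have := Nat.div_mul_le_self (onePositions v).length (selT v)
  have := onePositions_length_le v
  omega

theorem selG_le (v : Bits) : selG v ≤ v.length + 1 :=
  Nat.succ_le_succ ((Nat.div_le_self _ _).trans (onePositions_length_le v))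

theorem selQ_mul_selU_le (v : Bits) : selQ v * selU v ≤ selT v + selU v := by
  unfold selQ
  rw [add_mul, one_mul]
  have := Nat.div_mul_le_self (selT v) (selU v)
  omega

theorem selQ_le (v : Bits) : selQ v ≤ selT v + 1 :=
  Nat.succ_le_succ (Nat.div_le_self _ _)

theorem buildSelect_cost_le (v : Bits) :
    (buildSelect v).cost ≤ (300 * (v.length + 1) : ℕ) := by
  have h1 := onePos_le v 0
  have h2 : selT v ≤ v.length := size_le _
  have h3 := selU_le v
  have h4 := selG_mul_selT_le v
  have h5 := selG_le v
  have h6 := selQ_mul_selU_le v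
  have h7 := selQ_le v
  have h8 := two_pow_selC_mul_le v
  rw [buildSelect_cost, zeros_cost]
  refine (add_le_add le_rfl (add_le_add (topBits_cost_le v) (add_le_add le_rfl
    (add_le_add (cat_group_cost_le (spreadGroup_cost_le v)) (add_le_add
      (cat_cost_le_const fun g _ => midGroup_cost_le v g) (add_le_add le_rfl (add_le_add
        (cat_group_cost_le (k := 2 * selQ v + 1) (spreadGroup'_cost_le v)) (add_le_add
          (popBits_cost_le _) (add_le_add (selBits_cost_le _) le_rfl))))))))).trans ?_
  norm_cast
  have e1 : (selG v + 1) * (selT v + 2) ≤ 6 * (v.length + 1) := by nlinarith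
  have e2 : selG v * (1 + 1) ≤ 2 * (v.length + 1) := by omega
  have e3 : (selQ v + 1) * (selU v + 2) + 1 ≤ 9 * selT v + 5 := by nlinarith
  -- A group spends O(t) bits on its subgroup starts, and there are about n / t groups.
  have e4 : selG v * ((selQ v + 1) * (selU v + 2) + 1) ≤ 23 * (v.length + 1) := by
    refine (Nat.mul_le_mul_left _ e3).trans ?_
    nlinarith
  have e5 : selG v * (2 * selQ v + 1 + 1) ≤ 8 * (v.length + 1) := by
    refine (Nat.mul_le_mul_left _ (show _ ≤ 2 * selT v + 4 by omega)).trans ?_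
    nlinarith
  have hc : 1 ≤ selC v := Nat.succ_pos _
  have hp : 2 * selC v + 2 ≤ 4 * (selC v * selC v) := by nlinarith
  have hs : selC v * (2 * selC v + 2) + 1 ≤ 5 * (selC v * selC v) := by nlinarith
  have e6 : 2 ^ selC v * (2 * selC v + 2) ≤ 64 * (v.length + 1) := by
    refine (Nat.mul_le_mul_left _ hp).trans ?_
    nlinarith
  have e7 : 2 ^ selC v * (selC v * (2 * selC v + 2) + 1) ≤ 80 * (v.length + 1) := by
    refine (Nat.mul_le_mul_left _ hs).trans ?_
    nlinarith
  omega

theorem cat_length_le_cost (n : ℕ) (f : ℕ → Timed Bits)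
    (h : ∀ i < n, ((f i).val.length : ℕ∞) ≤ (f i).cost) :
    ((cat n f).val.length : ℕ∞) ≤ (cat n f).cost := by
  rw [cat_cost, cat_length]
  push_cast
  exact Finset.sum_le_sum fun i hi => (h i (Finset.mem_range.mp hi)).trans le_self_add

theorem field_length_le_cost (len x : ℕ) :
    ((field len x).val.length : ℕ∞) ≤ (field len x).cost := by
  simp

/-- The two spread vectors are at most as long as `v` by telescoping. The other vectors are bounded
by the construction time, since every written bit costs a step. -/
theorem buildSelect_space_le (v : Bits) :
    (buildSelect v).val.space ≤ 400 * (v.length + 1) := by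
  have hg : ∀ f : ℕ → Timed Bits,
      (∀ g, (f g).val.length = onePos v ((g + 1) * selT v) - onePos v (g * selT v)) →
      (cat (selG v) f).val.length ≤ v.length := by
    intro f hf
    rw [cat_length]
    simp only [hf, sum_group_lengths]
    exact (Nat.sub_le _ _).trans (onePos_le _ _)
  have h1 := hg _ (spreadGroup_length v)
  have h2 := hg _ (spreadGroup'_length v)
  have h3 : ((topBits v).val.length + (cat (selG v) (midGroup v)).val.length +
      (popBits (selC v)).val.length + (selBits (selC v)).val.length : ℕ) ≤
      300 * (v.length + 1) := by
    have hb := buildSelect_cost_le v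
    rw [buildSelect_cost] at hb
    have ht : ((topBits v).val.length : ℕ∞) ≤ (topBits v).cost :=
      cat_length_le_cost _ _ fun i _ => field_length_le_cost _ _
    have hm : ((cat (selG v) (midGroup v)).val.length : ℕ∞) ≤
        (cat (selG v) (midGroup v)).cost :=
      cat_length_le_cost _ _ fun i _ => cat_length_le_cost _ _ fun j _ =>
        field_length_le_cost _ _
    have hp : ((popBits (selC v)).val.length : ℕ∞) ≤ (popBits (selC v)).cost :=
      cat_length_le_cost _ _ fun i _ => (field_length_le_cost _ _).trans le_add_self
    have hs : ((selBits (selC v)).val.length : ℕ∞) ≤ (selBits (selC v)).cost :=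
      cat_length_le_cost _ _ fun i _ => cat_length_le_cost _ _ fun j _ =>
        (field_length_le_cost _ _).trans le_add_self
    have : (((topBits v).val.length + (cat (selG v) (midGroup v)).val.length +
      (popBits (selC v)).val.length + (selBits (selC v)).val.length : ℕ) : ℕ∞) ≤
      (300 * (v.length + 1) : ℕ) := by
      refine le_trans ?_ hb
      push_cast
      rw [add_assoc, add_assoc]
      refine (add_le_add ht (add_le_add hm (add_le_add hp hs))).trans ?_
      refine le_trans ?_ le_add_self
      refine add_le_add le_rfl (le_trans ?_ le_add_self)
      refine le_trans ?_ le_add_self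
      refine add_le_add le_rfl (le_trans ?_ le_add_self)
      refine le_trans ?_ le_add_self
      rw [add_zero]
    exact_mod_cast this
  have h4 := onePos_le v 0
  have h5 : selT v ≤ v.length := size_le _
  have h6 := selU_le v
  have h7 : selC v ≤ selT v + 1 := Nat.succ_le_succ (Nat.div_le_self _ _)
  have h8 := size_le (selT v)
  have h9 := size_le (selU v)
  have h10 := size_le (selC v)
  rw [buildSelect_val]
  simp only [SelectIndex.space, List.length_append, zeros_val, List.length_replicate]
  omega

end SicHash

namespace SicHash

/-! ## Coded sequences -/

/-- Unary codes: every number `g` is written as `g` zeros and a one. -/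
def unary : List ℕ → Bits
  | [] => []
  | g :: gs => List.replicate g false ++ true :: unary gs

theorem unary_length (gs : List ℕ) : (unary gs).length = gs.sum + gs.length := by
  induction gs with
  | nil => rfl
  | cons g gs ih => simp [unary, ih]; omega

/-- The one that ends the code of number `i` is preceded by the zeros of the numbers up to `i` and
by `i` ones. The induction strips the first code, which consists of `g + 1` bits. -/
theorem unary_spec {gs : List ℕ} {i : ℕ} (hi : i < gs.length) :
    (unary gs).getD ((gs.take (i + 1)).sum + i) false = true ∧
      countBelow (fun j => (unary gs).getD j false) ((gs.take (i + 1)).sum + i) = i := by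
  induction gs generalizing i with
  | nil => simp at hi
  | cons g gs ih =>
    have h0 : countBelow (fun j => (unary (g :: gs)).getD j false) g = 0 := by
      unfold countBelow
      rw [List.length_eq_zero_iff, List.filter_eq_nil_iff]
      intro j hj
      rw [List.mem_range] at hj
      simp [unary, List.getD_eq_getElem?_getD, List.getElem?_append_left, hj]
    have h1 : (unary (g :: gs)).getD g false = true := by
      simp [unary, List.getD_eq_getElem?_getD]
    have hshift : ∀ j, (unary (g :: gs)).getD (g + 1 + j) false = (unary gs).getD j false := by
      intro j
      simp only [unary, List.getD_eq_getElem?_getD]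
      rw [List.getElem?_append_right (by simp; omega)]
      simp [add_assoc, add_comm 1 j]
    cases i with
    | zero => simpa using ⟨h1, h0⟩
    | succ i =>
      have := ih (by simpa using hi)
      rw [show ((g :: gs).take (i + 1 + 1)).sum + (i + 1) =
        g + 1 + ((gs.take (i + 1)).sum + i) by simp; omega, hshift, countBelow_add,
        countBelow_succ, h0, h1]
      simp only [hshift]
      refine ⟨this.1, ?_⟩
      rw [this.2]
      simp [add_comm]

theorem onePos_unary {gs : List ℕ} {i : ℕ} (hi : i < gs.length) :
    i < (onePositions (unary gs)).length ∧
      onePos (unary gs) i = (gs.take (i + 1)).sum + i := by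
  obtain ⟨h1, h2⟩ := unary_spec hi
  have h3 := onePos_eq h1
  rw [h2] at h3
  refine ⟨?_, h3⟩
  by_contra h
  rw [onePos_of_le (not_lt.mp h)] at h3
  rw [List.getD_eq_default _ _ h3.le] at h1
  cases h1

theorem select_unary {w : ℕ} {gs : List ℕ} {i : ℕ} (hi : i < gs.length) :
    (select w (buildSelect (unary gs)).val (unary gs) i).val = (gs.take (i + 1)).sum + i := by
  rw [select_val (onePos_unary hi).1, (onePos_unary hi).2]

/-- The differences of the upper parts of consecutive numbers. -/
def upperGaps (ℓ : ℕ) : ℕ → List ℕ → List ℕ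
  | _, [] => []
  | prev, a :: as => (a / 2 ^ ℓ - prev) :: upperGaps ℓ (a / 2 ^ ℓ) as

theorem upperGaps_length (ℓ prev : ℕ) (as : List ℕ) : (upperGaps ℓ prev as).length = as.length := by
  induction as generalizing prev with
  | nil => rfl
  | cons a as ih => simp [upperGaps, ih]

theorem eliasFanoUpper_val (ℓ prev : ℕ) (as : List ℕ) :
    (eliasFanoUpper ℓ prev as).val = unary (upperGaps ℓ prev as) := by
  induction as generalizing prev with
  | nil => rfl
  | cons a as ih => simp [eliasFanoUpper, upperGaps, unary, ih]

/-- The gaps telescope; monotonicity is needed because they are truncated differences. -/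
theorem sum_take_upperGaps {ℓ prev : ℕ} {as : List ℕ} (has : as.Pairwise (· ≤ ·))
    (hp : ∀ a ∈ as, prev ≤ a / 2 ^ ℓ) {i : ℕ} (hi : i < as.length) :
    ((upperGaps ℓ prev as).take (i + 1)).sum = as[i] / 2 ^ ℓ - prev := by
  induction as generalizing prev i with
  | nil => simp at hi
  | cons a as ih =>
    rw [List.pairwise_cons] at has
    cases i with
    | zero => simp [upperGaps]
    | succ i =>
      have hi' : i < as.length := by simpa using hi
      have h1 := ih has.2 (fun b hb => Nat.div_le_div_right (has.1 b hb)) hi'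
      have h2 : a / 2 ^ ℓ ≤ as[i] / 2 ^ ℓ := Nat.div_le_div_right (has.1 _ (List.getElem_mem hi'))
      have h3 := hp a (by simp)
      simp only [upperGaps, List.take_succ_cons, List.sum_cons, h1, List.getElem_cons_succ]
      omega

theorem sum_upperGaps_le {ℓ prev B : ℕ} {as : List ℕ} (has : as.Pairwise (· ≤ ·))
    (hp : ∀ a ∈ as, prev ≤ a / 2 ^ ℓ) (hB : ∀ a ∈ as, a / 2 ^ ℓ ≤ B) :
    (upperGaps ℓ prev as).sum ≤ B := by
  rcases Nat.eq_zero_or_pos as.length with h | h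
  · rw [List.length_eq_zero_iff] at h
    simp [h, upperGaps]
  · have h1 := sum_take_upperGaps has hp (show as.length - 1 < as.length by omega)
    rw [List.take_of_length_le (by rw [upperGaps_length]; omega)] at h1
    rw [h1]
    exact (Nat.sub_le _ _).trans (hB _ (List.getElem_mem _))

/-! ### Lower bits and random access to the coded sequences -/

theorem lowerBits_length (ℓ : ℕ) (as : List ℕ) :
    (lowerBits ℓ as).val.length = as.length * ℓ := by
  induction as with
  | nil => simp [lowerBits]
  | cons a as ih => simp [lowerBits, ih, add_mul, add_comm]

theorem lowerBits_cost (ℓ : ℕ) (as : List ℕ) :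
    (lowerBits ℓ as).cost = (as.length * (ℓ + 2) : ℕ) := by
  induction as with
  | nil => simp [lowerBits]
  | cons a as ih =>
    simp only [lowerBits, Timed.bind_cost, ih, field_cost, tick_cost, Timed.pure_cost]
    push_cast [List.length_cons]
    ring

theorem lowerBits_occursAt (ℓ : ℕ) {as : List ℕ} {i : ℕ} (hi : i < as.length) :
    OccursAt (lowerBits ℓ as).val (i * ℓ) (field ℓ (as[i] % 2 ^ ℓ)).val := by
  induction as generalizing i with
  | nil => simp at hi
  | cons a as ih =>
    cases i with
    | zero =>
      rw [zero_mul]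
      exact occursAt_left _ _
    | succ i =>
      have := (occursAt_right (field ℓ (a % 2 ^ ℓ)).val (lowerBits ℓ as).val).trans
        (ih (by simpa using hi))
      rwa [show (field ℓ (a % 2 ^ ℓ)).val.length + i * ℓ = (i + 1) * ℓ by simp; ring] at this

theorem readField_lowerBits {w ℓ : ℕ} {as : List ℕ} {i : ℕ} (hi : i < as.length) :
    (readField w (lowerBits ℓ as).val (i * ℓ) ℓ).val = as[i] % 2 ^ ℓ := by
  rw [readField_of_occursAt (lowerBits_occursAt ℓ hi), Nat.mod_mod]

theorem eliasFanoGet_val {w univ : ℕ} {as : List ℕ} (has : as.Pairwise (· ≤ ·)) {i : ℕ}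
    (hi : i < as.length) : (eliasFanoGet w (eliasFano univ as).val i).val = as[i] := by
  simp only [eliasFanoGet, eliasFano, Timed.bind_val, Timed.pure_val]
  rw [readField_lowerBits hi, eliasFanoUpper_val, select_unary (by rwa [upperGaps_length]),
    sum_take_upperGaps has (by simp) hi, Nat.add_sub_cancel, Nat.sub_zero]
  exact Nat.div_add_mod' _ _

theorem riceUpper_val (k : ℕ) (as : List ℕ) :
    (riceUpper k as).val = unary (as.map (· / 2 ^ k)) := by
  induction as with
  | nil => rfl
  | cons a as ih => simp [riceUpper, unary, ih]

theorem golombRiceGet_val {w k : ℕ} {as : List ℕ} {i : ℕ}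
    (hi : i < as.length) : (golombRiceGet w (golombRice k as).val i).val = as[i] := by
  simp only [golombRiceGet, golombRice, Timed.bind_val, Timed.pure_val]
  rw [riceUpper_val]
  have key : (as.map (· / 2 ^ k)).take (i + 1) =
      (as.map (· / 2 ^ k)).take i ++ [as[i] / 2 ^ k] := by
    rw [List.take_add_one, List.getElem?_map, List.getElem?_eq_getElem hi]
    rfl
  have h := Nat.div_add_mod' as[i] (2 ^ k)
  -- A quotient is the number of zeros between two consecutive ones; item 0 has no preceding one,
  -- and its code starts at position 0.
  cases i with
  | zero =>
    rw [if_pos rfl, Timed.bind_val, Timed.bind_val, Timed.pure_val, Timed.pure_val,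
      readField_lowerBits hi, select_unary (by simpa using hi), key]
    simpa using h
  | succ i =>
    rw [if_neg (Nat.succ_ne_zero i), Timed.bind_val, Timed.bind_val, Timed.bind_val,
      Timed.pure_val, Timed.pure_val, Nat.add_sub_cancel, readField_lowerBits hi,
      select_unary (by simpa using hi), select_unary (by simpa using Nat.lt_of_succ_lt hi), key,
      List.sum_append]
    simp only [List.sum_cons, List.sum_nil, add_zero]
    rwa [show ∀ s a : ℕ, s + a + (i + 1) - (s + i + 1) = a by intros; omega]

/-- The number of lower bits of an Elias–Fano coded sequence. -/
theorem eliasFano_low (univ : ℕ) (as : List ℕ) : (eliasFano univ as).val.low =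
    Nat.clog 2 ((univ + as.length - 1) / as.length) := rfl

/-! ### Time and space of the coded sequences -/

theorem clog_two_le (x : ℕ) : Nat.clog 2 x ≤ x :=
  Nat.clog_le_of_le_pow Nat.lt_two_pow_self.le

/-- The crude bound ⌈log₂ x⌉ ≤ x suffices: it makes the lower bits linear in the universe plus the
length, and both are O(N) in all uses. -/
theorem length_mul_clog_le (univ : ℕ) (as : List ℕ) :
    as.length * Nat.clog 2 ((univ + as.length - 1) / as.length) ≤ univ + as.length :=
  (Nat.mul_le_mul_left _ (clog_two_le _)).trans ((Nat.mul_div_le _ _).trans (Nat.sub_le _ _))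

theorem eliasFano_low_le (univ : ℕ) (as : List ℕ) :
    (eliasFano univ as).val.low ≤ univ + as.length :=
  (clog_two_le _).trans ((Nat.div_le_self _ _).trans (Nat.sub_le _ _))

/-- The number ℓ of lower bits satisfies 2^ℓ ≥ ⌈univ / length⌉, so every upper part is at most the
length, and the gaps telescope to the last upper part. -/
theorem eliasFano_upper_le {univ : ℕ} {as : List ℕ} (has : as.Pairwise (· ≤ ·))
    (hu : ∀ a ∈ as, a ≤ univ) :
    (upperGaps (Nat.clog 2 ((univ + as.length - 1) / as.length)) 0 as).sum ≤ as.length := by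
  refine sum_upperGaps_le has (by simp) fun a ha => ?_
  have hpos : 0 < as.length := List.length_pos_of_mem ha
  refine Nat.div_le_of_le_mul ((hu a ha).trans ?_)
  refine le_trans ?_ (Nat.mul_le_mul_right _ (Nat.le_pow_clog (by norm_num) _))
  have h1 := Nat.div_add_mod' (univ + as.length - 1) as.length
  have h2 := Nat.mod_lt (univ + as.length - 1) hpos
  omega

theorem eliasFanoUpper_cost (ℓ prev : ℕ) (as : List ℕ) : (eliasFanoUpper ℓ prev as).cost =
    ((upperGaps ℓ prev as).sum + 2 * as.length : ℕ) := by
  induction as generalizing prev with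
  | nil => simp [eliasFanoUpper, upperGaps]
  | cons a as ih =>
    simp only [eliasFanoUpper, upperGaps, Timed.bind_cost, ih, zeros_cost, tick_cost,
      Timed.pure_cost, List.sum_cons, List.length_cons]
    norm_cast
    omega

theorem eliasFano_hi_length_le {univ : ℕ} {as : List ℕ} (has : as.Pairwise (· ≤ ·))
    (hu : ∀ a ∈ as, a ≤ univ) : (eliasFano univ as).val.hi.length ≤ 2 * as.length := by
  change (eliasFanoUpper _ 0 as).val.length ≤ _
  rw [eliasFanoUpper_val, unary_length, upperGaps_length]
  have := eliasFano_upper_le has hu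
  omega

theorem eliasFano_cost (univ : ℕ) (as : List ℕ) : (eliasFano univ as).cost =
    ((as.length + 1 : ℕ) : ℕ∞) + ((eliasFanoUpper (eliasFano univ as).val.low 0 as).cost +
      ((lowerBits (eliasFano univ as).val.low as).cost +
        ((buildSelect (eliasFano univ as).val.hi).cost + 0))) := rfl

theorem eliasFano_cost_le {univ : ℕ} {as : List ℕ} (has : as.Pairwise (· ≤ ·))
    (hu : ∀ a ∈ as, a ≤ univ) :
    (eliasFano univ as).cost ≤ (1000 * (univ + as.length + 1) : ℕ) := by
  have h1 := eliasFano_upper_le has hu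
  have h2 := length_mul_clog_le univ as
  have h3 : (eliasFano univ as).val.hi.length ≤ 2 * as.length := eliasFano_hi_length_le has hu
  have hb := buildSelect_cost_le (eliasFano univ as).val.hi
  rw [eliasFano_cost, eliasFanoUpper_cost, lowerBits_cost, eliasFano_low]
  refine (add_le_add le_rfl (add_le_add le_rfl (add_le_add le_rfl
    (add_le_add hb le_rfl)))).trans ?_
  rw [mul_add]
  exact_mod_cast (by omega)

theorem eliasFano_space_le {univ : ℕ} {as : List ℕ} (has : as.Pairwise (· ≤ ·))
    (hu : ∀ a ∈ as, a ≤ univ) :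
    (eliasFano univ as).val.space ≤ 1000 * (univ + as.length + 1) := by
  have h1 := eliasFano_low_le univ as
  have h2 : (eliasFano univ as).val.lo.length ≤ univ + as.length := by
    change (lowerBits _ as).val.length ≤ _
    rw [lowerBits_length]
    exact length_mul_clog_le univ as
  have h3 : (eliasFano univ as).val.hi.length ≤ 2 * as.length := eliasFano_hi_length_le has hu
  have hb : (eliasFano univ as).val.idx.space ≤ _ :=
    buildSelect_space_le (eliasFano univ as).val.hi
  have h5 := size_le (eliasFano univ as).val.low
  unfold CodedSeq.space
  omega

theorem riceUpper_cost (k : ℕ) (as : List ℕ) : (riceUpper k as).cost =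
    ((as.map (· / 2 ^ k)).sum + 2 * as.length : ℕ) := by
  induction as with
  | nil => simp [riceUpper]
  | cons a as ih =>
    simp only [riceUpper, Timed.bind_cost, ih, zeros_cost, tick_cost, Timed.pure_cost,
      List.map_cons, List.sum_cons, List.length_cons]
    norm_cast
    omega

theorem golombRice_hi_length_le (k : ℕ) (as : List ℕ) :
    (golombRice k as).val.hi.length ≤ as.sum + as.length := by
  change (riceUpper k as).val.length ≤ _
  rw [riceUpper_val, unary_length, List.length_map]
  refine Nat.add_le_add_right ?_ _
  simpa using List.sum_le_sum (l := as) (f := (· / 2 ^ k)) (g := id) fun a _ => Nat.div_le_self _ _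

theorem golombRice_cost (k : ℕ) (as : List ℕ) : (golombRice k as).cost =
    ((1 : ℕ) : ℕ∞) + ((riceUpper k as).cost + ((lowerBits k as).cost +
      ((buildSelect (golombRice k as).val.hi).cost + 0))) := rfl

theorem golombRice_cost_le (k : ℕ) (as : List ℕ) :
    (golombRice k as).cost ≤ (310 * (k + 1) * (as.sum + as.length + 1) : ℕ) := by
  have h3 := golombRice_hi_length_le k as
  have hb := buildSelect_cost_le (golombRice k as).val.hi
  have h1 : (as.map (· / 2 ^ k)).sum ≤ as.sum := by
    simpa using List.sum_le_sum (l := as) (f := (· / 2 ^ k)) (g := id)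
      fun a _ => Nat.div_le_self _ _
  rw [golombRice_cost, riceUpper_cost, lowerBits_cost]
  refine (add_le_add le_rfl (add_le_add le_rfl (add_le_add le_rfl
    (add_le_add hb le_rfl)))).trans ?_
  have h4 : as.length * k ≤ k * (as.sum + as.length) := by
    rw [mul_comm]
    exact Nat.mul_le_mul_left k (Nat.le_add_left _ _)
  have h5 : 310 * (k + 1) * (as.sum + as.length + 1) = 310 * (as.sum + as.length + 1) +
      310 * (k * (as.sum + as.length)) + 310 * k := by ring
  rw [h5, mul_add]
  exact_mod_cast (by omega)

theorem golombRice_space_le (k : ℕ) (as : List ℕ) :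
    (golombRice k as).val.space ≤ 410 * (k + 1) * (as.sum + as.length + 1) := by
  have h1 : (golombRice k as).val.low.size ≤ k := size_le k
  have h2 : (golombRice k as).val.lo.length = as.length * k := lowerBits_length k as
  have h3 := golombRice_hi_length_le k as
  have hb : (golombRice k as).val.idx.space ≤ _ :=
    buildSelect_space_le (golombRice k as).val.hi
  have h4 : as.length * k ≤ k * (as.sum + as.length) := by
    rw [mul_comm]
    exact Nat.mul_le_mul_left k (Nat.le_add_left _ _)
  have h5 : 410 * (k + 1) * (as.sum + as.length + 1) = 410 * (as.sum + as.length + 1) +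
      410 * (k * (as.sum + as.length)) + 410 * k := by ring
  unfold CodedSeq.space
  omega

theorem eliasFanoGet_cost (w : ℕ) (D : CodedSeq) (i : ℕ) : (eliasFanoGet w D i).cost =
    (select w D.idx D.hi i).cost + ((readField w D.lo (i * D.low) D.low).cost + 0) := rfl

theorem eliasFanoGet_cost_le {w k : ℕ} {D : CodedSeq} (hD : D.idx = (buildSelect D.hi).val)
    (hw : 0 < w) (hhi : D.hi.length.size ≤ w) (hlow : D.low ≤ k * w)
    (i : ℕ) : (eliasFanoGet w D i).cost ≤ (301 + k : ℕ) := by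
  rw [eliasFanoGet_cost, hD]
  refine (add_le_add (select_cost_le hw hhi _ i)
    (add_le_add (readField_cost_le _ _ hlow) le_rfl)).trans ?_
  exact_mod_cast (by omega)

theorem golombRiceGet_cost (w : ℕ) (D : CodedSeq) (i : ℕ) : (golombRiceGet w D i).cost =
    (select w D.idx D.hi i).cost + ((if i = 0 then (pure 0 : Timed ℕ) else do
      let s' ← select w D.idx D.hi (i - 1)
      pure (s' + 1)).cost + ((readField w D.lo (i * D.low) D.low).cost + 0)) := by
  unfold golombRiceGet
  split_ifs
  · rfl
  · simp

theorem golombRiceGet_cost_le {w k : ℕ} {D : CodedSeq} (hD : D.idx = (buildSelect D.hi).val)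
    (hw : 0 < w) (hhi : D.hi.length.size ≤ w) (hlow : D.low ≤ k * w) (i : ℕ) :
    (golombRiceGet w D i).cost ≤ (601 + k : ℕ) := by
  have h : (if i = 0 then (pure 0 : Timed ℕ) else do
      let s' ← select w D.idx D.hi (i - 1)
      pure (s' + 1)).cost ≤ (300 : ℕ) := by
    split_ifs
    · exact zero_le
    · rw [hD, Timed.bind_cost, Timed.pure_cost, add_zero]
      exact select_cost_le hw hhi _ _
  rw [golombRiceGet_cost]
  refine (add_le_add (hD ▸ select_cost_le hw hhi _ i) (add_le_add h
    (add_le_add (readField_cost_le _ _ hlow) le_rfl))).trans ?_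
  exact_mod_cast (by omega)

end SicHash

namespace SicHash

/-! ## Cuckoo hashing -/

/-- The table is consistent, except that the contents of the cell `hole` are obsolete. -/
structure CuckooTable.Valid (deg : ℕ → ℕ) (cand : ℕ → ℕ → ℕ) (T : CuckooTable)
    (hole : Option ℕ) : Prop where
  placed : ∀ j c i, T.pos j = some (c, i) →
    i < deg j ∧ cand j i = c ∧ some c ≠ hole ∧ T.occ c = some j
  occupied : ∀ c j, some c ≠ hole → T.occ c = some j → ∃ i, T.pos j = some (c, i)

theorem CuckooTable.valid_empty (deg : ℕ → ℕ) (cand : ℕ → ℕ → ℕ) :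
    CuckooTable.empty.Valid deg cand none := by
  constructor <;> simp [CuckooTable.empty]

/-- Objects whose candidate cells are too few. -/
def HallViolation (m : ℕ) (deg : ℕ → ℕ) (cand : ℕ → ℕ → ℕ) (objs : Set ℕ) : Prop :=
  ∃ J F : Finset ℕ, F ⊆ Finset.range m ∧ (J : Set ℕ) ⊆ objs ∧ J.card = F.card + 1 ∧
    ∀ j ∈ J, ∀ i < deg j, cand j i ∈ F

/-- A cell is entered in `pred` before the remaining candidates are visited, so a repeated candidate
is reached only once and older entries are never overwritten. -/
theorem expand_spec (cand : ℕ → ℕ) (j : ℕ) (is : List ℕ) (pred : Pred) :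
    let r := (expand cand j is pred).val
    r.1.Nodup ∧ (∀ d ∈ r.1, pred d = none ∧ ∃ i ∈ is, cand i = d ∧ r.2 d = some (j, i)) ∧
      (∀ d, d ∉ r.1 → r.2 d = pred d) ∧ ∀ i ∈ is, (r.2 (cand i)).isSome := by
  induction is generalizing pred with
  | nil => simp [expand]
  | cons i is ih =>
    simp only [expand, Timed.bind_val]
    split_ifs with h
    · obtain ⟨h1, h2, h3, h4⟩ := ih pred
      refine ⟨h1, fun d hd => ?_, h3, fun i' hi' => ?_⟩
      · obtain ⟨h5, i', hi', h6⟩ := h2 d hd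
        exact ⟨h5, i', List.mem_cons_of_mem _ hi', h6⟩
      · rcases List.mem_cons.mp hi' with rfl | hi'
        · rw [h3]
          · exact h
          · intro hd
            rw [(h2 _ hd).1] at h
            cases h
        · exact h4 i' hi'
    · obtain ⟨h1, h2, h3, h4⟩ := ih (Function.update pred (cand i) (some (j, i)))
      have hc : cand i ∉ (expand cand j is (Function.update pred (cand i) (some (j, i)))).val.1 := by
        intro hd
        have := (h2 _ hd).1
        simp at this
      simp only [Timed.bind_val, Timed.pure_val]
      refine ⟨List.nodup_cons.mpr ⟨hc, h1⟩, fun d hd => ?_, fun d hd => ?_, fun i' hi' => ?_⟩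
      · rcases List.mem_cons.mp hd with rfl | hd
        · refine ⟨by simpa using h, i, by simp, rfl, ?_⟩
          rw [h3 _ hc]
          simp
        · obtain ⟨h5, i', hi', h6⟩ := h2 d hd
          refine ⟨?_, i', List.mem_cons_of_mem _ hi', h6⟩
          rwa [Function.update_of_ne] at h5
          rintro rfl
          exact hc hd
      · rw [List.mem_cons, not_or] at hd
        rw [h3 d hd.2, Function.update_of_ne hd.1]
      · rcases List.mem_cons.mp hi' with rfl | hi'
        · rw [h3 _ hc]
          simp
        · exact h4 i' hi'

/-- Every reached cell `d` is a candidate of the object that it was reached from, and this object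
is the new object `j₀` or is placed in a reached cell of smaller rank. -/
def GoodPred (deg : ℕ → ℕ) (cand : ℕ → ℕ → ℕ) (j₀ : ℕ) (rank : ℕ → ℕ) (T : CuckooTable)
    (pred : Pred) (d : ℕ) : Prop :=
  ∀ j i, pred d = some (j, i) → i < deg j ∧ cand j i = d ∧
    (j = j₀ ∨ ∃ c i', T.pos j = some (c, i') ∧ (pred c).isSome ∧ rank c < rank d)

/-- The invariant of breadth-first search: `E` lists the processed cells and `Q` is the queue. -/
structure BfsInv (m : ℕ) (deg : ℕ → ℕ) (cand : ℕ → ℕ → ℕ) (T : CuckooTable) (j₀ : ℕ)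
    (E Q : List ℕ) (pred : Pred) : Prop where
  nodup : (E ++ Q).Nodup
  mem_iff : ∀ c, c ∈ E ++ Q ↔ (pred c).isSome
  lt : ∀ c ∈ E ++ Q, c < m
  processed : ∀ c ∈ E, ∃ j, T.occ c = some j ∧ ∀ i < deg j, cand j i ∈ E ++ Q
  start : ∀ i < deg j₀, cand j₀ i ∈ E ++ Q
  good : ∀ d, GoodPred deg cand j₀ (E ++ Q).idxOf T pred d

theorem bfsInv_start {m : ℕ} {deg : ℕ → ℕ} {cand : ℕ → ℕ → ℕ} (hcand : ∀ j i, cand j i < m)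
    (T : CuckooTable) (j₀ : ℕ) :
    let r := (expand (cand j₀) j₀ (List.range (deg j₀)) fun _ => none).val
    BfsInv m deg cand T j₀ [] r.1 r.2 := by
  intro r
  obtain ⟨h1, h2, h3, h4⟩ := expand_spec (cand j₀) j₀ (List.range (deg j₀)) fun _ => none
  change r.1.Nodup at h1
  have hmem : ∀ c, c ∈ r.1 ↔ (r.2 c).isSome := by
    refine fun c => ⟨fun hc => ?_, fun hc => ?_⟩
    · obtain ⟨-, i, -, -, h⟩ := h2 c hc
      rw [h]; rfl
    · by_contra h
      rw [h3 c h] at hc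
      cases hc
  refine ⟨h1, hmem, fun c hc => ?_, by simp, fun i hi => ?_, fun d j i hd => ?_⟩
  · obtain ⟨-, i, -, rfl, -⟩ := h2 c hc
    exact hcand _ _
  · exact (hmem _).mpr (h4 i (List.mem_range.mpr hi))
  · obtain ⟨-, i', hi', hc, h⟩ := h2 d ((hmem d).mpr (by rw [hd]; rfl))
    have : some (j₀, i') = some (j, i) := h.symm.trans hd
    cases this
    exact ⟨List.mem_range.mp hi', hc, Or.inl rfl⟩

/-- The rank of a cell is its index in the list of processed and queued cells. Processing only
appends to this list, so old ranks are stable. -/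
theorem BfsInv.step {m : ℕ} {deg : ℕ → ℕ} {cand : ℕ → ℕ → ℕ} (hcand : ∀ j i, cand j i < m)
    {T : CuckooTable} (hT : T.Valid deg cand none) {j₀ c j : ℕ} {E Q : List ℕ} {pred : Pred}
    (h : BfsInv m deg cand T j₀ E (c :: Q) pred) (hj : T.occ c = some j) :
    let r := (expand (cand j) j (List.range (deg j)) pred).val
    BfsInv m deg cand T j₀ (E ++ [c]) (Q ++ r.1) r.2 := by
  intro r
  obtain ⟨h1, h2, h3, h4⟩ := expand_spec (cand j) j (List.range (deg j)) pred
  change r.1.Nodup at h1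
  change ∀ d ∈ r.1, _ ∧ ∃ i ∈ _, _ ∧ r.2 d = _ at h2
  change ∀ d, d ∉ r.1 → r.2 d = _ at h3
  change ∀ i ∈ _, (r.2 _).isSome at h4
  have hE : E ++ [c] ++ (Q ++ r.1) = (E ++ c :: Q) ++ r.1 := by simp
  have hmem : ∀ d, d ∈ (E ++ c :: Q) ++ r.1 ↔ (r.2 d).isSome := by
    intro d
    rw [List.mem_append, h.mem_iff]
    by_cases hd : d ∈ r.1
    · obtain ⟨-, i, -, -, h⟩ := h2 d hd
      simp [hd, h]
    · simp [hd, h3 d hd]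
  have hold : ∀ d ∈ E ++ c :: Q, d ∉ r.1 := by
    intro d hd hd'
    have := (h2 d hd').1
    rw [h.mem_iff, this] at hd
    cases hd
  refine ⟨?_, ?_, ?_, ?_, ?_, ?_⟩
  · rw [hE, List.nodup_append]
    refine ⟨h.nodup, h1, ?_⟩
    rintro a ha b hb rfl
    exact hold a ha hb
  · rwa [hE]
  · rw [hE]
    intro d hd
    rcases List.mem_append.mp hd with hd | hd
    · exact h.lt d hd
    · obtain ⟨-, i, -, rfl, -⟩ := h2 d hd
      exact hcand _ _
  · rw [hE]
    intro d hd
    rcases List.mem_append.mp hd with hd | hd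
    · obtain ⟨j', h5, h6⟩ := h.processed d hd
      exact ⟨j', h5, fun i hi => List.mem_append_left _ (h6 i hi)⟩
    · rw [List.mem_singleton] at hd
      subst hd
      exact ⟨j, hj, fun i hi => (hmem _).mpr (h4 i (List.mem_range.mpr hi))⟩
  · rw [hE]
    exact fun i hi => List.mem_append_left _ (h.start i hi)
  · rw [hE]
    intro d j' i hd
    by_cases hd' : d ∈ r.1
    · obtain ⟨-, i', hi', hc, h5⟩ := h2 d hd'
      have : some (j, i') = some (j', i) := h5.symm.trans hd
      cases this
      obtain ⟨i'', hi''⟩ := hT.occupied c j (by simp) hj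
      refine ⟨List.mem_range.mp hi', hc, Or.inr ⟨c, i'', hi'', ?_, ?_⟩⟩
      · exact (hmem c).mp (by simp)
      -- A newly reached cell is appended after the cell `c` from which it was reached.
      · have hcm : c ∈ E ++ c :: Q := by simp
        have hdm : d ∉ E ++ c :: Q := fun h => hold d h hd'
        beta_reduce
        rw [List.idxOf_append_of_mem hcm, List.idxOf_append_of_notMem hdm]
        exact (List.idxOf_lt_length_iff.mpr hcm).trans_le (Nat.le_add_right _ _)
    · have hd1 : pred d = some (j', i) := (h3 d hd').symm.trans hd
      have hdm : d ∈ E ++ c :: Q := (h.mem_iff d).mpr (by rw [hd1]; rfl)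
      obtain ⟨h5, h6, h7⟩ := h.good d j' i hd1
      refine ⟨h5, h6, h7.imp_right ?_⟩
      rintro ⟨c', i', h8, h9, h10⟩
      have hcm := (h.mem_iff c').mpr h9
      refine ⟨c', i', h8, (hmem c').mp (List.mem_append_left _ hcm), ?_⟩
      beta_reduce
      rwa [List.idxOf_append_of_mem hcm, List.idxOf_append_of_mem hdm]

theorem length_le_of_nodup_lt {l : List ℕ} {m : ℕ} (h : l.Nodup) (hl : ∀ c ∈ l, c < m) :
    l.length ≤ m := by
  rw [← List.toFinset_card_of_nodup h, ← Finset.card_range m]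
  exact Finset.card_le_card fun c hc => Finset.mem_range.mpr (hl c (List.mem_toFinset.mp hc))

/-- If the queue empties, the processed cells are all occupied and contain every candidate of their
occupants and of the new object. If an empty cell is found, the index in the search order serves as
the rank that decreases along predecessors. -/
theorem bfs_spec {m : ℕ} {deg : ℕ → ℕ} {cand : ℕ → ℕ → ℕ} (hcand : ∀ j i, cand j i < m)
    {T : CuckooTable} (hT : T.Valid deg cand none) {j₀ : ℕ} (k : ℕ) {E Q : List ℕ} {pred : Pred}
    (h : BfsInv m deg cand T j₀ E Q pred) (hk : E.length + k = m + 1) :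
    match (bfs deg cand T k Q pred).val with
    | some (c, pred') => T.occ c = none ∧ (pred' c).isSome ∧ ∃ rank : ℕ → ℕ, rank c ≤ m ∧
        ∀ d, GoodPred deg cand j₀ rank T pred' d
    | none => ∃ F : Finset ℕ, F ⊆ Finset.range m ∧
        (∀ c ∈ F, ∃ j, T.occ c = some j ∧ ∀ i < deg j, cand j i ∈ F) ∧
        ∀ i < deg j₀, cand j₀ i ∈ F := by
  induction k generalizing E Q pred with
  | zero =>
    -- The fuel cannot run out: `m + 1` processed cells would be distinct numbers below `m`.
    have := length_le_of_nodup_lt h.nodup h.lt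
    rw [List.length_append] at this
    omega
  | succ k ih =>
    cases Q with
    | nil =>
      simp only [bfs, Timed.pure_val]
      refine ⟨E.toFinset, fun c hc => ?_, fun c hc => ?_, fun i hi => ?_⟩
      · exact Finset.mem_range.mpr (h.lt c (by simpa using hc))
      · simpa using h.processed c (by simpa using hc)
      · simpa using h.start i hi
    | cons c Q =>
      simp only [bfs, Timed.bind_val]
      cases hc : T.occ c with
      | none =>
        simp only [Timed.pure_val]
        have hcm : c ∈ E ++ c :: Q := by simp
        refine ⟨hc, (h.mem_iff c).mp hcm, (E ++ c :: Q).idxOf, ?_, h.good⟩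
        exact (List.idxOf_lt_length_iff.mpr hcm).le.trans (length_le_of_nodup_lt h.nodup h.lt)
      | some j =>
        exact ih (h.step hcand hT hc) (by simp; omega)

/-- The empty cell is a hole that travels backwards along the path. Each move fills it with the
predecessor object and opens a hole of smaller rank at the object's old cell; the path ends at the
unplaced object `j₀`. Decreasing ranks bound the number of moves. -/
theorem augment_spec {deg : ℕ → ℕ} {cand : ℕ → ℕ → ℕ} {j₀ : ℕ} {rank : ℕ → ℕ} {pred : Pred}
    (k : ℕ) {c : ℕ} {T : CuckooTable} (hk : rank c < k) (hc : (pred c).isSome)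
    (hT : T.Valid deg cand (some c)) (hj₀ : T.pos j₀ = none)
    (hgood : ∀ d, rank d ≤ rank c → GoodPred deg cand j₀ rank T pred d) :
    (augment pred k c T).val.Valid deg cand none ∧
      ∀ j, ((augment pred k c T).val.pos j).isSome ↔ (T.pos j).isSome ∨ j = j₀ := by
  induction k generalizing c T with
  | zero => omega
  | succ k ih =>
    obtain ⟨⟨j, i⟩, hp⟩ := Option.isSome_iff_exists.mp hc
    obtain ⟨hi, hci, hj⟩ := hgood c le_rfl j i hp
    simp only [augment, Timed.bind_val, hp]
    have hne : ∀ j' c' i', T.pos j' = some (c', i') → c' ≠ c := fun j' c' i' h h' =>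
      (hT.placed j' c' i' h).2.2.1 (by rw [h'])
    cases hpos : T.pos j with
    | none =>
      have hjj : j = j₀ := by
        rcases hj with hj | ⟨c', i', h, -⟩
        · exact hj
        · rw [hpos] at h
          cases h
      subst hjj
      simp only [Timed.pure_val]
      refine ⟨⟨fun j' c' i' h => ?_, fun c' j' _ h => ?_⟩, fun j' => ?_⟩
      · by_cases hjj : j' = j
        · subst hjj
          simp only [Function.update_self, Option.some.injEq, Prod.mk.injEq] at h
          obtain ⟨rfl, rfl⟩ := h
          exact ⟨hi, hci, by simp, by simp⟩
        · simp only [Function.update_of_ne hjj] at h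
          obtain ⟨h1, h2, -, h4⟩ := hT.placed j' c' i' h
          exact ⟨h1, h2, by simp, by simpa [Function.update_of_ne (hne _ _ _ h)] using h4⟩
      · by_cases hcc : c' = c
        · subst hcc
          simp only [Function.update_self, Option.some.injEq] at h
          subst h
          exact ⟨i, by simp⟩
        · simp only [Function.update_of_ne hcc] at h
          obtain ⟨i', hi'⟩ := hT.occupied c' j' (by simpa using hcc) h
          refine ⟨i', ?_⟩
          simp only
          rw [Function.update_of_ne, hi']
          rintro rfl
          rw [hpos] at hi'
          cases hi'
      · by_cases hjj : j' = j <;> simp [hjj]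
    | some ci =>
      obtain ⟨c', i'⟩ := ci
      have hjj : j ≠ j₀ := by
        rintro rfl
        rw [hpos] at hj₀
        cases hj₀
      have hrank : rank c' < rank c ∧ (pred c').isSome := by
        rcases hj with hj | ⟨c'', i'', h, h', h''⟩
        · exact absurd hj hjj
        · rw [hpos] at h
          cases h
          exact ⟨h'', h'⟩
      have hcc : c' ≠ c := hne _ _ _ hpos
      set T' : CuckooTable := ⟨Function.update T.occ c (some j),
        Function.update T.pos j (some (c, i))⟩ with hT'def
      have hpos' : ∀ j', j' ≠ j → T'.pos j' = T.pos j' := fun j' h => by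
        simp [hT'def, Function.update_of_ne h]
      have hposj : T'.pos j = some (c, i) := by simp [hT'def]
      have hocc' : ∀ d, d ≠ c → T'.occ d = T.occ d := fun d h => by
        simp [hT'def, Function.update_of_ne h]
      have hoccc : T'.occ c = some j := by simp [hT'def]
      -- Object `j` now sits in `c`; its old cell `c'` still lists it and becomes the obsolete one.
      have hT' : T'.Valid deg cand (some c') := by
        refine ⟨fun j' d e h => ?_, fun d j' hd h => ?_⟩
        · by_cases h' : j' = j
          · subst h'
            rw [hposj] at h
            cases h
            exact ⟨hi, hci, by simpa using hcc.symm, hoccc⟩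
          · rw [hpos' _ h'] at h
            obtain ⟨h1, h2, h3, h4⟩ := hT.placed j' d e h
            refine ⟨h1, h2, ?_, by rwa [hocc' _ (hne _ _ _ h)]⟩
            intro h5
            cases h5
            have h6 := (hT.placed j c' i' hpos).2.2.2
            rw [h4] at h6
            cases h6
            exact h' rfl
        · by_cases h' : d = c
          · subst h'
            rw [hoccc] at h
            cases h
            exact ⟨i, hposj⟩
          · rw [hocc' _ h'] at h
            obtain ⟨e, he⟩ := hT.occupied d j' (by simpa using h') h
            refine ⟨e, ?_⟩
            rw [hpos', he]
            rintro rfl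
            rw [hpos] at he
            cases he
            exact hd rfl
      -- Only the position of `j` has changed. A predecessor object of a cell of rank at most `rank
      -- c'` sat in a cell of rank below `rank c'`, hence was not `j`, whose old cell is `c'`.
      obtain ⟨h1, h2⟩ := ih (c := c') (T := T') (by omega) hrank.2 hT'
        (by rw [hpos' _ hjj.symm, hj₀]) fun d hd j' e hp' => by
          obtain ⟨h3, h4, h5⟩ := hgood d (by omega) j' e hp'
          refine ⟨h3, h4, h5.imp_right ?_⟩
          rintro ⟨c'', i'', h6, h7, h8⟩
          refine ⟨c'', i'', ?_, h7, h8⟩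
          rw [hpos', h6]
          rintro rfl
          rw [hpos] at h6
          cases h6
          omega
      refine ⟨h1, fun j' => ?_⟩
      change ((augment pred k c' T').val.pos j').isSome ↔ _
      rw [h2]
      by_cases h' : j' = j
      · subst h'
        simp [hposj, hpos]
      · rw [hpos' _ h']

/-- A failed search yields a closed set of cells, all occupied by different objects. Together with
the new object these are one object too many for those cells. -/
theorem insert_spec {m : ℕ} {deg : ℕ → ℕ} {cand : ℕ → ℕ → ℕ} (hcand : ∀ j i, cand j i < m)
    {T : CuckooTable} (hT : T.Valid deg cand none) {j₀ : ℕ} (hj₀ : T.pos j₀ = none) :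
    match (insert m deg cand T j₀).val with
    | some T' => T'.Valid deg cand none ∧ ∀ j, (T'.pos j).isSome ↔ (T.pos j).isSome ∨ j = j₀
    | none => HallViolation m deg cand {j | (T.pos j).isSome ∨ j = j₀} := by
  have h := bfs_spec hcand hT (m + 1) (bfsInv_start hcand T j₀) (by simp)
  simp only [insert, Timed.bind_val]
  cases hb : (bfs deg cand T (m + 1)
      (expand (cand j₀) j₀ (List.range (deg j₀)) fun _ => none).val.1
      (expand (cand j₀) j₀ (List.range (deg j₀)) fun _ => none).val.2).val with
  | none =>
    rw [hb] at h
    obtain ⟨F, hF, hF1, hF2⟩ := h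
    simp only [Timed.pure_val]
    classical
    -- `f c` is the occupant of cell `c`; it is injective because an object has only one position.
    choose! f hf using hF1
    have hfpos : ∀ c ∈ F, ∃ i, T.pos (f c) = some (c, i) := fun c hc =>
      hT.occupied c (f c) (by simp) (hf c hc).1
    have hinj : Set.InjOn f F := by
      intro c hc c' hc' hcc
      obtain ⟨i, hi⟩ := hfpos c hc
      obtain ⟨i', hi'⟩ := hfpos c' hc'
      rw [hcc, hi'] at hi
      cases hi
      rfl
    have hnot : j₀ ∉ F.image f := by
      intro hmem
      obtain ⟨c, hc, hcj⟩ := Finset.mem_image.mp hmem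
      obtain ⟨i, hi⟩ := hfpos c hc
      rw [hcj, hj₀] at hi
      cases hi
    refine ⟨Insert.insert j₀ (F.image f), F, hF, ?_, ?_, ?_⟩
    · intro j hj
      rcases Finset.mem_insert.mp (Finset.mem_coe.mp hj) with rfl | hj
      · exact Or.inr rfl
      · obtain ⟨c, hc, rfl⟩ := Finset.mem_image.mp hj
        obtain ⟨i, hi⟩ := hfpos c hc
        exact Or.inl (by rw [hi]; rfl)
    · rw [Finset.card_insert_of_notMem hnot, Finset.card_image_of_injOn hinj]
    · intro j hj
      rcases Finset.mem_insert.mp hj with rfl | hj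
      · exact hF2
      · obtain ⟨c, hc, rfl⟩ := Finset.mem_image.mp hj
        exact (hf c hc).2
  | some cp =>
    obtain ⟨c, pred⟩ := cp
    rw [hb] at h
    obtain ⟨hc, hp, rank, hr, hgood⟩ := h
    simp only [Timed.bind_val, Timed.pure_val]
    refine augment_spec (rank := rank) (m + 1) (by omega) hp ⟨fun j c' i h => ?_, fun c' j _ h =>
      hT.occupied c' j (by simp) h⟩ hj₀ fun d _ => hgood d
    obtain ⟨h1, h2, -, h4⟩ := hT.placed j c' i h
    refine ⟨h1, h2, ?_, h4⟩
    intro h5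
    cases h5
    rw [hc] at h4
    cases h4

theorem insertAll_spec {m : ℕ} {deg : ℕ → ℕ} {cand : ℕ → ℕ → ℕ} (hcand : ∀ j i, cand j i < m)
    (js : List ℕ) (hjs : js.Nodup) {T : CuckooTable} (hT : T.Valid deg cand none)
    (hpos : ∀ j ∈ js, T.pos j = none) :
    match (insertAll m deg cand js T).val with
    | some T' => T'.Valid deg cand none ∧ ∀ j, (T'.pos j).isSome ↔ (T.pos j).isSome ∨ j ∈ js
    | none => HallViolation m deg cand {j | (T.pos j).isSome ∨ j ∈ js} := by
  induction js generalizing T with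
  | nil => simpa [insertAll] using hT
  | cons j js ih =>
    rw [List.nodup_cons] at hjs
    have h := insert_spec hcand hT (hpos j (by simp))
    simp only [insertAll, Timed.bind_val]
    cases hi : (insert m deg cand T j).val with
    | none =>
      rw [hi] at h
      obtain ⟨J, F, h1, h2, h3⟩ := h
      refine ⟨J, F, h1, h2.trans ?_, h3⟩
      rintro j' (h | rfl)
      · exact Or.inl h
      · exact Or.inr (by simp)
    | some T' =>
      rw [hi] at h
      have h' := ih hjs.2 h.1 fun j' hj' => by
        have := (h.2 j').not.mpr (by
          rw [hpos j' (List.mem_cons_of_mem _ hj')]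
          rintro (h | rfl)
          · cases h
          · exact hjs.1 hj')
        simpa using this
      have hset : ∀ j', (T'.pos j').isSome ∨ j' ∈ js ↔ (T.pos j').isSome ∨ j' ∈ j :: js := by
        intro j'
        rw [h.2, List.mem_cons]
        tauto
      simp only [hset] at h'
      exact h'

/-! ### Cost and success of one attempt -/

theorem expand_cost_le (cand : ℕ → ℕ) (j : ℕ) (is : List ℕ) (pred : Pred) :
    (expand cand j is pred).cost ≤ (is.length : ℕ) := by
  induction is generalizing pred with
  | nil => exact zero_le
  | cons i is ih =>
    rw [List.length_cons, add_comm]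
    simp only [expand]
    refine cost_bind_le le_rfl ?_
    split_ifs
    · exact ih _
    · simpa using ih _

theorem bfs_cost_le {D : ℕ} {deg : ℕ → ℕ} (hdeg : ∀ j, deg j ≤ D) (cand : ℕ → ℕ → ℕ)
    (T : CuckooTable) (k : ℕ) (Q : List ℕ) (pred : Pred) :
    (bfs deg cand T k Q pred).cost ≤ (k * (D + 1) : ℕ) := by
  induction k generalizing Q pred with
  | zero => exact zero_le
  | succ k ih =>
    cases Q with
    | nil => exact zero_le
    | cons c Q =>
      rw [show (k + 1) * (D + 1) = 1 + (D + k * (D + 1)) by ring]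
      simp only [bfs]
      refine cost_bind_le le_rfl ?_
      cases T.occ c with
      | none => exact zero_le
      | some j =>
        refine cost_bind_le ((expand_cost_le _ _ _ _).trans ?_) (ih _ _)
        simpa using hdeg j

theorem augment_cost_le (pred : Pred) (k c : ℕ) (T : CuckooTable) :
    (augment pred k c T).cost ≤ (k : ℕ) := by
  induction k generalizing c T with
  | zero => exact zero_le
  | succ k ih =>
    refine le_trans (b := ((1 + k : ℕ) : ℕ∞)) ?_ (by rw [add_comm])
    refine cost_bind_le le_rfl ?_
    cases pred c with
    | none => exact zero_le
    | some ji =>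
      obtain ⟨j, i⟩ := ji
      dsimp only
      cases T.pos j with
      | none => exact zero_le
      | some ci => exact ih _ _

theorem insert_cost_le {D : ℕ} {deg : ℕ → ℕ} (hdeg : ∀ j, deg j ≤ D) (m : ℕ)
    (cand : ℕ → ℕ → ℕ) (T : CuckooTable) (j : ℕ) :
    (insert m deg cand T j).cost ≤ ((m + 1) * (2 * D + 3) : ℕ) := by
  have h : (insert m deg cand T j).cost ≤
      ((m + 1) + (D + ((m + 1) * (D + 1) + (m + 1))) : ℕ) := by
    refine cost_bind_le le_rfl (cost_bind_le ((expand_cost_le _ _ _ _).trans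
      (by simpa using hdeg j)) (cost_bind_le (bfs_cost_le hdeg _ _ _ _ _) ?_))
    split
    · exact zero_le
    · exact cost_bind_le (b := 0) (augment_cost_le _ _ _ _) le_rfl
  refine h.trans ?_
  exact_mod_cast (by nlinarith)

theorem insertAll_cost_le {D : ℕ} {deg : ℕ → ℕ} (hdeg : ∀ j, deg j ≤ D) (m : ℕ)
    (cand : ℕ → ℕ → ℕ) (js : List ℕ) (T : CuckooTable) :
    (insertAll m deg cand js T).cost ≤ (js.length * ((m + 1) * (2 * D + 3)) : ℕ) := by
  induction js generalizing T with
  | nil => exact zero_le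
  | cons j js ih =>
    rw [List.length_cons, add_mul, one_mul, add_comm]
    refine cost_bind_le (insert_cost_le hdeg _ _ _ _) ?_
    split
    · exact zero_le
    · exact ih _

/-- The candidate cells of the objects of a list. -/
def candCell {U : Type} (h : Hashes U) (X : List U) (m seed : ℕ) (j i : ℕ) : ℕ :=
  match X[j]? with
  | some x => hashValue h x (.cell seed i) m
  | none => 0

theorem hashValue_lt {U : Type} (h : Hashes U) (x : U) (name : HashName) {m : ℕ} (hm : 0 < m) :
    hashValue h x name m < m := by
  cases m with
  | zero => omega
  | succ m => exact (h (x, name, m)).isLt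

theorem tryTable_spec {U : Type} (h : Hashes U) (X : List U) {m : ℕ} (hm : X.length ≤ m)
    (deg : ℕ → ℕ) (seed : ℕ) :
    match (tryTable h X m deg seed).val with
    | some T => T.Valid deg (candCell h X m seed) none ∧ ∀ j, (T.pos j).isSome ↔ j < X.length
    | none => HallViolation m deg (candCell h X m seed) {j | j < X.length} := by
  -- Without cells the candidate 0 would be out of range, but then there are no objects either.
  rcases Nat.eq_zero_or_pos m with rfl | hpos
  · have hX : X.length = 0 := by omega
    simp only [tryTable, Timed.bind_val, hX, List.range_zero, insertAll, Timed.pure_val]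
    exact ⟨CuckooTable.valid_empty _ _, by simp [CuckooTable.empty]⟩
  · have hcand : ∀ j i, candCell h X m seed j i < m := by
      intro j i
      unfold candCell
      split
      · exact hashValue_lt _ _ _ hpos
      · exact hpos
    have := insertAll_spec hcand (List.range X.length) List.nodup_range
      (CuckooTable.valid_empty deg (candCell h X m seed)) (by simp [CuckooTable.empty])
    have e : ∀ j, (CuckooTable.empty.pos j).isSome = false := fun _ => rfl
    simp only [e, Bool.false_eq_true, false_or, List.mem_range] at this
    exact this

theorem tryTable_cost_le {U : Type} (h : Hashes U) (X : List U) (m : ℕ) {D : ℕ} {deg : ℕ → ℕ}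
    (hdeg : ∀ j, deg j ≤ D) (seed : ℕ) : (tryTable h X m deg seed).cost ≤
      ((m + X.length + 1) + X.length * ((m + 1) * (2 * D + 3)) : ℕ) := by
  refine cost_bind_le le_rfl ((insertAll_cost_le hdeg _ _ _ _).trans ?_)
  rw [List.length_range]

/-- An attempt succeeds if the first candidates of the objects are distinct. -/
theorem tryTable_isSome {U : Type} (h : Hashes U) (X : List U) {m : ℕ} (hm : X.length ≤ m)
    {deg : ℕ → ℕ} (hdeg : ∀ j, 0 < deg j) {seed : ℕ}
    (hinj : ∀ i j, i < X.length → j < X.length →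
      candCell h X m seed i 0 = candCell h X m seed j 0 → i = j) :
    (tryTable h X m deg seed).val.isSome := by
  have := tryTable_spec h X hm deg seed
  cases hT : (tryTable h X m deg seed).val with
  | some T => rfl
  | none =>
    rw [hT] at this
    obtain ⟨J, F, -, h2, h3, h4⟩ := this
    -- The first candidates inject `J` into `F`, which contradicts `J.card = F.card + 1`.
    have h5 : J.card ≤ F.card := Finset.card_le_card_of_injOn
      (fun j => candCell h X m seed j 0) (fun j hj => h4 j hj 0 (hdeg j))
      fun i hi j hj hij => hinj i j (h2 hi) (h2 hj) hij
    omega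

end SicHash

namespace SicHash

/-! ## Buckets -/

theorem le_numCells {α : ℚ} (h0 : 0 < α) (h1 : α ≤ 1) (n : ℕ) : n ≤ numCells α n := by
  refine Nat.le_floor ?_
  rw [le_div_iff₀ h0]
  exact mul_le_of_le_one_right (by positivity) h1

theorem mul_numCells_le {α : ℚ} (h0 : 0 < α) (n : ℕ) : α * numCells α n ≤ n := by
  rw [mul_comm, ← le_div_iff₀ h0]
  exact Nat.floor_le (by positivity)

theorem numCells_le (α : ℚ) (n : ℕ) : numCells α n ≤ ⌈1 / α⌉₊ * n := by
  refine Nat.floor_le_of_le ?_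
  push_cast
  rw [div_eq_mul_one_div, mul_comm]
  exact mul_le_mul_of_nonneg_right (Nat.le_ceil _) (by positivity)

/-- The bucket of an object. -/
def bucketOf {U : Type} (h : Hashes U) (B : ℕ) (x : U) : ℕ := hashValue h x .bucket B

/-- The objects of a bucket. -/
def bucketList {U : Type} (h : Hashes U) (B : ℕ) (S : List U) (k : ℕ) : List U :=
  S.filter fun x => bucketOf h B x = k

theorem hash_val {U : Type} (h : Hashes U) (x : U) (name : HashName) (m : ℕ) :
    (hash h x name m).val = hashValue h x name m := rfl

@[simp] theorem hash_cost {U : Type} (h : Hashes U) (x : U) (name : HashName) (m : ℕ) :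
    (hash h x name m).cost = 1 := by
  simp [hash]

theorem partition_val {U : Type} (h : Hashes U) (B : ℕ) (S : List U) (k : ℕ) :
    (partition h B S).val k = bucketList h B S k := by
  induction S with
  | nil => rfl
  | cons x xs ih =>
    simp only [partition, Timed.bind_val, Timed.pure_val, hash_val]
    by_cases hk : k = hashValue h x .bucket B
    · subst hk
      rw [Function.update_self, ih, bucketList, bucketList,
        List.filter_cons_of_pos (by simp [bucketOf])]
    · rw [Function.update_of_ne hk, ih, bucketList, bucketList,
        List.filter_cons_of_neg (by
          rw [Bool.not_eq_true]
          exact decide_eq_false (Ne.symm hk))]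

theorem partition_cost {U : Type} (h : Hashes U) (B : ℕ) (S : List U) :
    (partition h B S).cost = (S.length + (B + 1) : ℕ) := by
  induction S with
  | nil => simp [partition]
  | cons x xs ih =>
    simp only [partition, Timed.bind_cost, Timed.pure_cost, ih, hash_cost, List.length_cons]
    norm_cast
    omega

/-- The class of an object. -/
def clsOf {U : Type} (P : Params) (h : Hashes U) (x : U) : ℕ := (classOf P h x).val

@[simp] theorem classOf_cost {U : Type} (P : Params) (h : Hashes U) (x : U) :
    (classOf P h x).cost = 1 := by
  simp [classOf]

theorem clsOf_mem {U : Type} (P : Params) (h : Hashes U) (x : U) :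
    1 ≤ clsOf P h x ∧ clsOf P h x ≤ 3 := by
  simp only [clsOf, classOf, Timed.bind_val, Timed.pure_val]
  split_ifs <;> simp

theorem classesOf_val {U : Type} (P : Params) (h : Hashes U) (X : List U) :
    (classesOf P h X).val = X.map (clsOf P h) := by
  induction X with
  | nil => rfl
  | cons x xs ih => simp [classesOf, clsOf, ih]

theorem classesOf_cost {U : Type} (P : Params) (h : Hashes U) (X : List U) :
    (classesOf P h X).cost = (X.length : ℕ) := by
  induction X with
  | nil => rfl
  | cons x xs ih => simp [classesOf, ih, add_comm]

/-- The number of candidate cells of the objects of a bucket. -/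
def bucketDeg {U : Type} (P : Params) (h : Hashes U) (X : List U) (j : ℕ) : ℕ :=
  2 ^ (X.map (clsOf P h)).getD j 3

theorem bucketDeg_le {U : Type} (P : Params) (h : Hashes U) (X : List U) (j : ℕ) :
    bucketDeg P h X j ≤ 8 := by
  refine (Nat.pow_le_pow_right (by norm_num) (?_ : _ ≤ 3)).trans (by norm_num)
  rw [List.getD_eq_getElem?_getD, List.getElem?_map]
  cases X[j]? with
  | none => simp
  | some x => exact (clsOf_mem P h x).2

/-- The attempt with a given seed to build the table of a bucket. -/
def attempt {U : Type} (P : Params) (h : Hashes U) (X : List U) (s : ℕ) :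
    Timed (Option CuckooTable) :=
  tryTable h X (numCells P.α X.length) (bucketDeg P h X) s

/-- Some attempt to build the table of the bucket is successful. -/
def Placeable {U : Type} (P : Params) (h : Hashes U) (X : List U) : Prop :=
  ∃ s, (attempt P h X s).val.isSome

/-- The result of the search for a seed. -/
noncomputable def placement {U : Type} (P : Params) (h : Hashes U) (X : List U) :
    Timed (ℕ × CuckooTable) :=
  firstSuccess CuckooTable.empty (attempt P h X)

theorem buildBucket_val {U : Type} (P : Params) (h : Hashes U) (X : List U) :
    (buildBucket P h X).val =
      { cells := numCells P.α X.length
        seed := (placement P h X).val.1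
        used := (List.range (numCells P.α X.length)).map fun c =>
          ((placement P h X).val.2.occ c).isSome
        entries := X.zip ((X.map (clsOf P h)).zip ((List.range X.length).map fun j =>
          (((placement P h X).val.2.pos j).getD (0, 0)).2)) } := by
  simp only [buildBucket, Timed.bind_val, Timed.pure_val, classesOf_val]
  rfl

theorem buildBucket_cost {U : Type} (P : Params) (h : Hashes U) (X : List U) :
    (buildBucket P h X).cost = ((X.length + 1 : ℕ) : ℕ∞) + ((X.length : ℕ) +
      ((placement P h X).cost + ((numCells P.α X.length + X.length : ℕ) + 0))) := by
  rw [← classesOf_cost P h X]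
  simp only [buildBucket, Timed.bind_cost, Timed.pure_cost, classesOf_val]
  rfl

/-- The data of a bucket describes an injective placement of its objects, where `idx x` is the
number of the hash function that places `x`. -/
structure BucketSpec {U : Type} (P : Params) (h : Hashes U) (X : List U) (D : BucketData U)
    (idx : U → ℕ) : Prop where
  entries : D.entries = X.map fun x => (x, clsOf P h x, idx x)
  idx_lt : ∀ x ∈ X, idx x < 2 ^ clsOf P h x
  inj : Set.InjOn (fun x => hashValue h x (.cell D.seed (idx x)) D.cells) {x | x ∈ X}
  used : ∀ c < D.cells, D.used.getD c false = true ↔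
    ∃ x ∈ X, hashValue h x (.cell D.seed (idx x)) D.cells = c

theorem firstSuccess_val {α : Type} {dflt : α} {f : ℕ → Timed (Option α)}
    (h : ∃ s, (f s).val.isSome) :
    (f (firstSuccess dflt f).val.1).val = some (firstSuccess dflt f).val.2 := by
  classical
  obtain ⟨a, ha⟩ := Option.isSome_iff_exists.mp (Nat.find_spec h)
  simp only [firstSuccess, dif_pos h]
  convert ha using 1
  congr 1
  rw [ha]
  rfl

/-- The successful table is consistent and places every object of the bucket. Distinctness of cells
holds because a cell stores only one object number, and numbers identify objects since `X` has no
duplicates. -/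
theorem buildBucket_spec {U : Type} {P : Params} {h : Hashes U} {X : List U} (hX : X.Nodup)
    (hs : Placeable P h X) : ∃ idx, BucketSpec P h X (buildBucket P h X).val idx := by
  classical
  have hT := tryTable_spec h X (le_numCells P.α_pos P.α_le X.length) (bucketDeg P h X)
    (placement P h X).val.1
  have hT' : (tryTable h X (numCells P.α X.length) (bucketDeg P h X)
    (placement P h X).val.1).val = some (placement P h X).val.2 := firstSuccess_val hs
  rw [hT'] at hT
  obtain ⟨hT, hpos⟩ := hT
  rw [buildBucket_val]
  generalize (placement P h X).val.1 = s at *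
  generalize (placement P h X).val.2 = T at *
  set m := numCells P.α X.length with hm
  -- The witness: look up the object under its number in the table. The default `(0, 0)` is
  -- irrelevant for the objects of `X`.
  set idx : U → ℕ := fun x => ((T.pos (X.idxOf x)).getD (0, 0)).2 with hidx
  have key : ∀ x ∈ X, T.pos (X.idxOf x) = some (hashValue h x (.cell s (idx x)) m, idx x) ∧
      idx x < 2 ^ clsOf P h x := by
    intro x hx
    have hlt := List.idxOf_lt_length_iff.mpr hx
    obtain ⟨⟨c, i⟩, hci⟩ := Option.isSome_iff_exists.mp ((hpos _).mpr hlt)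
    obtain ⟨h1, h2, -, -⟩ := hT.placed _ _ _ hci
    have hget : X[X.idxOf x]? = some x := List.getElem?_idxOf hx
    have hix : idx x = i := by simp [hidx, hci]
    have hcx : candCell h X m s (X.idxOf x) i = hashValue h x (.cell s i) m := by
      simp [candCell, hget]
    rw [hix, hci, ← h2, hcx]
    refine ⟨rfl, ?_⟩
    rwa [bucketDeg, List.getD_eq_getElem?_getD, List.getElem?_map, hget] at h1
  refine ⟨idx, ?_, fun x hx => (key x hx).2, ?_, ?_⟩
  · refine List.ext_getElem (by simp) fun j h1 h2 => ?_
    have hj : j < X.length := by simpa using h2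
    simp [hidx, hX.idxOf_getElem]
  · intro x hx y hy hxy
    have h1 := (hT.placed _ _ _ (key x hx).1).2.2.2
    have h2 := (hT.placed _ _ _ (key y hy).1).2.2.2
    dsimp only at hxy
    rw [hxy, h2] at h1
    exact ((List.idxOf_inj hy).mp (Option.some.inj h1)).symm
  · intro c hc
    change c < m at hc
    dsimp only
    rw [List.getD_eq_getElem?_getD, List.getElem?_map, List.getElem?_range hc]
    simp only [Option.map_some, Option.getD_some]
    refine ⟨fun hocc => ?_, ?_⟩
    · obtain ⟨j, hj⟩ := Option.isSome_iff_exists.mp hocc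
      obtain ⟨i, hi⟩ := hT.occupied c j (by simp) hj
      have hlt : j < X.length := (hpos j).mp (by rw [hi]; rfl)
      refine ⟨X[j], List.getElem_mem hlt, ?_⟩
      have h3 := (key X[j] (List.getElem_mem hlt)).1
      rw [hX.idxOf_getElem, hi] at h3
      exact (congrArg Prod.fst (Option.some.inj h3)).symm
    · rintro ⟨x, hx, rfl⟩
      rw [(hT.placed _ _ _ (key x hx).1).2.2.2]
      rfl

theorem buildBuckets_val {U : Type} (P : Params) (h : Hashes U) (T : ℕ → List U) (l : List ℕ) :
    (buildBuckets P h T l).val = l.map fun k => (buildBucket P h (T k)).val := by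
  induction l with
  | nil => rfl
  | cons k l ih => simp [buildBuckets, ih]

theorem buildBuckets_cost {U : Type} (P : Params) (h : Hashes U) (T : ℕ → List U) (n : ℕ) :
    (buildBuckets P h T (List.range n)).cost =
      ∑ k ∈ Finset.range n, (buildBucket P h (T k)).cost := by
  have : ∀ l, (buildBuckets P h T l).cost = (l.map fun k => (buildBucket P h (T k)).cost).sum := by
    intro l
    induction l with
    | nil => rfl
    | cons k l ih => simp [buildBuckets, ih]
  rw [this]
  clear this
  induction n with
  | zero => rfl
  | succ n ih => simp [List.range_succ, Finset.sum_range_succ, ih]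

theorem prefixSums_cost (s : ℕ) (as : List ℕ) :
    (prefixSums s as).cost = (as.length + 1 : ℕ) := by
  induction as generalizing s with
  | nil => simp [prefixSums]
  | cons a as ih =>
    simp only [prefixSums, Timed.bind_cost, tick_cost, ih, Timed.pure_cost, List.length_cons]
    norm_cast
    omega

theorem prefixSums_length (s : ℕ) (as : List ℕ) :
    (prefixSums s as).val.length = as.length + 1 := by
  induction as generalizing s with
  | nil => rfl
  | cons a as ih => simp [prefixSums, ih]

theorem prefixSums_getElem (s : ℕ) (as : List ℕ) {k : ℕ} (hk : k < as.length + 1) :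
    (prefixSums s as).val[k]'(by rwa [prefixSums_length]) = s + (as.take k).sum := by
  induction as generalizing s k with
  | nil =>
    obtain rfl : k = 0 := by simpa using hk
    simp [prefixSums]
  | cons a as ih =>
    cases k with
    | zero => simp [prefixSums]
    | succ k =>
      have := ih (s + a) (k := k) (by simpa using hk)
      simp [prefixSums, this, add_assoc]

theorem classPairs_val {U : Type} (r : ℕ) (es : List (U × ℕ × ℕ)) : (classPairs r es).val =
    (es.filter fun e => e.2.1 = r).map fun e => (e.1, e.2.2) := by
  induction es with
  | nil => rfl
  | cons e es ih =>
    simp only [classPairs, Timed.bind_val, Timed.pure_val, ih]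
    split_ifs with h <;> simp [h]

theorem classPairs_cost {U : Type} (r : ℕ) (es : List (U × ℕ × ℕ)) :
    (classPairs r es).cost = (es.length : ℕ) := by
  induction es with
  | nil => rfl
  | cons e es ih => simp [classPairs, ih, add_comm]

end SicHash

namespace SicHash

/-! ## The constructed data structure -/

section Construct

variable {U : Type} (P : Params) (h : Hashes U) (S : List U)

/-- The objects of bucket `k`. -/
def bucketObjs (k : ℕ) : List U := bucketList h (P.numBuckets S.length) S k

/-- The data of bucket `k`. -/
noncomputable def bucketData (k : ℕ) : BucketData U := (buildBucket P h (bucketObjs P h S k)).val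

/-- The number of cells of bucket `k`. -/
def bucketCells (k : ℕ) : ℕ := numCells P.α (bucketObjs P h S k).length

/-- The offset of bucket `k`. -/
def offset (k : ℕ) : ℕ := ∑ j ∈ Finset.range k, bucketCells P h S j

def offsetList : List ℕ := (List.range (P.numBuckets S.length + 1)).map (offset P h S)

noncomputable def seedList : List ℕ :=
  (List.range (P.numBuckets S.length)).map fun k => (bucketData P h S k).seed

noncomputable def allEntries : List (U × ℕ × ℕ) :=
  (List.range (P.numBuckets S.length)).flatMap fun k => (bucketData P h S k).entries

noncomputable def usedCells : List Bool :=
  (List.range (P.numBuckets S.length)).flatMap fun k => (bucketData P h S k).used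

/-- The key–value pairs of class `r`. -/
noncomputable def keyValues (r : ℕ) : List (U × ℕ) :=
  ((allEntries P h S).filter fun e => e.2.1 = r).map fun e => (e.1, e.2.2)

/-- The total number of cells. -/
def totalCells : ℕ := offset P h S (P.numBuckets S.length)

end Construct

theorem prefixSums_val {U : Type} (P : Params) (h : Hashes U) (S : List U) :
    (prefixSums 0 ((List.range (P.numBuckets S.length)).map (bucketCells P h S))).val =
      offsetList P h S := by
  refine List.ext_getElem (by simp [prefixSums_length, offsetList]) fun k h1 h2 => ?_
  have hk : k ≤ P.numBuckets S.length := by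
    simp [offsetList] at h2
    omega
  rw [prefixSums_getElem _ _ (by simpa using hk)]
  simp only [offsetList, List.getElem_map, List.getElem_range, zero_add]
  rw [← List.map_take, List.take_range, min_eq_left hk, offset]
  clear h1 h2 hk
  induction k with
  | zero => rfl
  | succ n ih => simp [List.range_succ, Finset.sum_range_succ, ih]

theorem offsetList_getLastD {U : Type} (P : Params) (h : Hashes U) (S : List U) :
    (offsetList P h S).getLastD 0 = totalCells P h S := by
  simp [offsetList, List.range_succ, totalCells]

theorem buildBuckets_eq {U : Type} (P : Params) (h : Hashes U) (S : List U) :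
    (buildBuckets P h (partition h (P.numBuckets S.length) S).val
      (List.range (P.numBuckets S.length))).val =
      (List.range (P.numBuckets S.length)).map (bucketData P h S) := by
  rw [buildBuckets_val]
  refine List.map_congr_left fun k _ => ?_
  rw [partition_val]
  rfl

theorem constructAux_val {U : Type} (P : Params) (R : Retrieval U) (h : Hashes U) (ω : R.Ω)
    (S : List U) : (constructAux P R h ω S).val =
    ({ N := S.length
       B := P.numBuckets S.length
       M := totalCells P h S
       offsets := (eliasFano (totalCells P h S) (offsetList P h S)).val
       seeds := (golombRice P.rice (seedList P h S)).val
       ret₁ := (R.build ω 1 (keyValues P h S 1)).val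
       ret₂ := (R.build ω 2 (keyValues P h S 2)).val
       ret₃ := (R.build ω 3 (keyValues P h S 3)).val }, usedCells P h S) := by
  have hcells : ((List.range (P.numBuckets S.length)).map (bucketData P h S)).map
      BucketData.cells = (List.range (P.numBuckets S.length)).map (bucketCells P h S) := by
    rw [List.map_map]
    rfl
  simp only [constructAux, Timed.bind_val, Timed.pure_val, buildBuckets_eq, hcells,
    prefixSums_val, offsetList_getLastD, classPairs_val, List.flatMap_map, List.map_map]
  rfl

theorem constructAux_cost {U : Type} (P : Params) (R : Retrieval U) (h : Hashes U) (ω : R.Ω)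
    (S : List U) : (constructAux P R h ω S).cost =
    ((S.length + 1 : ℕ) : ℕ∞) + ((partition h (P.numBuckets S.length) S).cost +
      (∑ k ∈ Finset.range (P.numBuckets S.length), (buildBucket P h (bucketObjs P h S k)).cost +
        ((4 * P.numBuckets S.length : ℕ) + (((P.numBuckets S.length + 1 : ℕ) : ℕ∞) +
          ((eliasFano (totalCells P h S) (offsetList P h S)).cost +
            ((golombRice P.rice (seedList P h S)).cost +
              ((S.length + totalCells P h S : ℕ) + ((allEntries P h S).length +
                ((allEntries P h S).length + ((allEntries P h S).length +
                  ((R.build ω 1 (keyValues P h S 1)).cost +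
                    ((R.build ω 2 (keyValues P h S 2)).cost +
                      ((R.build ω 3 (keyValues P h S 3)).cost + 0))))))))))))) := by
  have hcells : ((List.range (P.numBuckets S.length)).map (bucketData P h S)).map
      BucketData.cells = (List.range (P.numBuckets S.length)).map (bucketCells P h S) := by
    rw [List.map_map]
    rfl
  simp only [constructAux, Timed.bind_cost, Timed.pure_cost,
    buildBuckets_eq, hcells, prefixSums_val, prefixSums_cost, offsetList_getLastD,
    classPairs_val, classPairs_cost, List.flatMap_map, List.map_map, tick_cost,
    List.length_map, List.length_range, buildBuckets_cost, partition_val]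
  rfl

section Layout

variable {U : Type} (P : Params) (h : Hashes U) (S : List U)

theorem offset_mono : Monotone (offset P h S) :=
  monotone_nat_of_le_succ fun k => by
    rw [offset, offset, Finset.sum_range_succ]
    exact Nat.le_add_right _ _

theorem offset_succ (k : ℕ) : offset P h S (k + 1) = offset P h S k + bucketCells P h S k :=
  Finset.sum_range_succ _ _

theorem offset_add_lt {k c B : ℕ} (hk : k < B) (hc : c < bucketCells P h S k) :
    offset P h S k + c < offset P h S B := by
  have h1 := offset_succ P h S k
  have h2 := offset_mono P h S (Nat.succ_le_of_lt hk)
  rw [Nat.succ_eq_add_one] at h2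
  omega

theorem exists_offset_add {B v : ℕ} (hv : v < offset P h S B) :
    ∃ k < B, ∃ c < bucketCells P h S k, v = offset P h S k + c := by
  induction B with
  | zero => simp [offset] at hv
  | succ B ih =>
    by_cases hB : v < offset P h S B
    · obtain ⟨k, hk, hc⟩ := ih hB
      exact ⟨k, by omega, hc⟩
    · rw [offset_succ] at hv
      exact ⟨B, by omega, v - offset P h S B, by omega, by omega⟩

/-- The cells of the buckets form consecutive disjoint intervals. -/
theorem offset_add_inj {k c k' c' : ℕ} (hc : c < bucketCells P h S k)
    (hc' : c' < bucketCells P h S k') (heq : offset P h S k + c = offset P h S k' + c') :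
    k = k' ∧ c = c' := by
  rcases lt_trichotomy k k' with hk | rfl | hk
  · have h1 := offset_add_lt P h S hk hc
    omega
  · exact ⟨rfl, by omega⟩
  · have h1 := offset_add_lt P h S hk hc'
    omega

theorem bucketData_used_length (k : ℕ) :
    (bucketData P h S k).used.length = bucketCells P h S k := by
  simp [bucketData, buildBucket_val, bucketCells]

theorem usedCells_length : (usedCells P h S).length = totalCells P h S := by
  rw [usedCells, totalCells, List.length_flatMap, offset]
  simp only [bucketData_used_length]
  generalize P.numBuckets S.length = B
  induction B with
  | zero => rfl
  | succ n ih => simp [List.range_succ, Finset.sum_range_succ, ih]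

theorem usedCells_getD {k c : ℕ} (hk : k < P.numBuckets S.length)
    (hc : c < bucketCells P h S k) :
    (usedCells P h S).getD (offset P h S k + c) false =
      (bucketData P h S k).used.getD c false := by
  have hlen : ∀ n, ((List.range n).flatMap fun k => (bucketData P h S k).used).length =
      offset P h S n := by
    intro n
    rw [List.length_flatMap, offset]
    simp only [bucketData_used_length]
    induction n with
    | zero => rfl
    | succ n ih => simp [List.range_succ, Finset.sum_range_succ, ih]
  obtain ⟨d, hd⟩ := Nat.exists_eq_add_of_le (Nat.succ_le_of_lt hk)
  rw [usedCells, hd, List.range_add, List.flatMap_append, Nat.succ_eq_add_one, List.range_succ,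
    List.flatMap_append, List.append_assoc, List.getD_eq_getElem?_getD,
    List.getElem?_append_right (by rw [hlen]; omega), hlen, Nat.add_sub_cancel_left,
    List.flatMap_cons, List.flatMap_nil, List.append_nil,
    List.getElem?_append_left (by rwa [bucketData_used_length]), List.getD_eq_getElem?_getD]

/-- Each object is counted in exactly one of the buckets. -/
theorem sum_bucketObjs_length (hB : ∀ x ∈ S, bucketOf h (P.numBuckets S.length) x <
    P.numBuckets S.length) :
    ∑ k ∈ Finset.range (P.numBuckets S.length), (bucketObjs P h S k).length = S.length := by
  unfold bucketObjs bucketList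
  simp only [← List.countP_eq_length_filter]
  generalize P.numBuckets S.length = B at hB
  induction S with
  | nil => simp
  | cons x xs ih =>
    simp only [List.countP_cons, Finset.sum_add_distrib,
      ih fun y hy => hB y (List.mem_cons_of_mem _ hy), List.length_cons, decide_eq_true_eq]
    simp [hB x (by simp)]

theorem Params.numBuckets_pos {N : ℕ} (hN : 0 < N) : 0 < P.numBuckets N :=
  Nat.div_pos (by omega) P.b_pos

theorem Params.numBuckets_le (N : ℕ) : P.numBuckets N ≤ N := by
  have hb := P.b_pos
  rcases Nat.eq_zero_or_pos N with rfl | hN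
  · exact (Nat.div_eq_of_lt (by omega)).le
  · refine Nat.div_le_of_le_mul ?_
    have : N + P.b ≤ P.b * N + 1 := by nlinarith
    omega

/-- The mean load N / B is at most b; this is the only way in which the bucket size enters the
expectation bounds. -/
theorem Params.le_mul_numBuckets (N : ℕ) : N ≤ P.b * P.numBuckets N := by
  have hb := P.b_pos
  have h1 := Nat.div_add_mod (N + P.b - 1) P.b
  have h2 := Nat.mod_lt (N + P.b - 1) hb
  unfold Params.numBuckets
  omega

variable {S}

theorem bucketOf_lt (hne : S ≠ []) (x : U) :
    bucketOf h (P.numBuckets S.length) x < P.numBuckets S.length :=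
  hashValue_lt _ _ _ (P.numBuckets_pos (List.length_pos_iff.mpr hne))

theorem mul_totalCells_le (hne : S ≠ []) : P.α * totalCells P h S ≤ S.length := by
  rw [← sum_bucketObjs_length P h S fun x _ => bucketOf_lt P h hne x, totalCells, offset]
  push_cast
  rw [Finset.mul_sum]
  exact Finset.sum_le_sum fun k _ => mul_numCells_le P.α_pos _

theorem totalCells_le (hne : S ≠ []) : totalCells P h S ≤ ⌈1 / P.α⌉₊ * S.length := by
  conv_rhs => rw [← sum_bucketObjs_length P h S fun x _ => bucketOf_lt P h hne x]
  rw [totalCells, offset, Finset.mul_sum]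
  exact Finset.sum_le_sum fun k _ => numCells_le P.α _

theorem allEntries_length (hne : S ≠ []) : (allEntries P h S).length = S.length := by
  rw [allEntries, List.length_flatMap]
  have : ∀ k, (bucketData P h S k).entries.length = (bucketObjs P h S k).length := by
    simp [bucketData, buildBucket_val]
  simp only [this]
  conv_rhs => rw [← sum_bucketObjs_length P h S fun x _ => bucketOf_lt P h hne x]
  generalize P.numBuckets S.length = B
  induction B with
  | zero => rfl
  | succ n ih => simp [List.range_succ, Finset.sum_range_succ, ih]

/-- All buckets can be placed. -/
def AllPlaceable (S : List U) : Prop :=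
  ∀ k < P.numBuckets S.length, Placeable P h (bucketObjs P h S k)

/-- The cell of an object, if `idx x` is the number of the hash function that places `x`. -/
noncomputable def cellOf (S : List U) (idx : U → ℕ) (x : U) : ℕ :=
  offset P h S (bucketOf h (P.numBuckets S.length) x) +
    hashValue h x (.cell (bucketData P h S (bucketOf h (P.numBuckets S.length) x)).seed (idx x))
      (bucketCells P h S (bucketOf h (P.numBuckets S.length) x))

structure LayoutSpec (S : List U) (idx : U → ℕ) : Prop where
  entries : allEntries P h S = (List.range (P.numBuckets S.length)).flatMap fun k =>
    (bucketObjs P h S k).map fun x => (x, clsOf P h x, idx x)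
  idx_lt : ∀ x ∈ S, idx x < 2 ^ clsOf P h x
  inj : Set.InjOn (cellOf P h S idx) {x | x ∈ S}
  lt : ∀ x ∈ S, cellOf P h S idx x < totalCells P h S
  used : ∀ v < totalCells P h S, (usedCells P h S).getD v false = true ↔
    ∃ x ∈ S, cellOf P h S idx x = v

theorem mem_bucketObjs {k : ℕ} {x : U} :
    x ∈ bucketObjs P h S k ↔ x ∈ S ∧ bucketOf h (P.numBuckets S.length) x = k := by
  simp [bucketObjs, bucketList]

/-- The placements of the buckets are glued together by their disjoint offset intervals: two objects
with the same global cell share a bucket, where the placement is injective. -/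
theorem exists_layoutSpec (hS : S.Nodup) (hne : S ≠ []) (hp : AllPlaceable P h S) :
    ∃ idx, LayoutSpec P h S idx := by
  -- The bound on `k` is moved behind the existential quantifier so that `choose` yields a total
  -- function of `k`.
  have hspec : ∀ k, ∃ idx, k < P.numBuckets S.length →
      BucketSpec P h (bucketObjs P h S k) (bucketData P h S k) idx := by
    intro k
    by_cases hk : k < P.numBuckets S.length
    · obtain ⟨idx, hidx⟩ := buildBucket_spec (hS.filter _) (hp k hk)
      exact ⟨idx, fun _ => hidx⟩
    · exact ⟨fun _ => 0, fun h => absurd h hk⟩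
  choose idx hidx using hspec
  have hcells : ∀ k, (bucketData P h S k).cells = bucketCells P h S k := fun k => by
    simp [bucketData, buildBucket_val, bucketCells]
  have hlt := bucketOf_lt P h hne
  -- The bucket of `x` is nonempty and has at least as many cells as objects, so its range is
  -- positive.
  have hcell : ∀ x ∈ S, ∀ s i, hashValue h x (.cell s i)
      (bucketCells P h S (bucketOf h (P.numBuckets S.length) x)) <
        bucketCells P h S (bucketOf h (P.numBuckets S.length) x) := by
    intro x hx s i
    refine hashValue_lt _ _ _ (lt_of_lt_of_le ?_ (le_numCells P.α_pos P.α_le _))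
    exact List.length_pos_of_mem ((mem_bucketObjs P h).mpr ⟨hx, rfl⟩)
  refine ⟨fun x => idx (bucketOf h (P.numBuckets S.length) x) x, ?_, ?_, ?_, ?_, ?_⟩
  · unfold allEntries
    rw [List.flatMap_def, List.flatMap_def]
    congr 1
    refine List.map_congr_left fun k hk => ?_
    rw [(hidx k (List.mem_range.mp hk)).entries]
    refine List.map_congr_left fun x hx => ?_
    rw [((mem_bucketObjs P h).mp hx).2]
  · intro x hx
    exact (hidx _ (hlt x)).idx_lt x ((mem_bucketObjs P h).mpr ⟨hx, rfl⟩)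
  · intro x hx y hy hxy
    obtain ⟨h1, h2⟩ := offset_add_inj P h S
      (hcell x hx _ _)
      (hcell y hy _ _) hxy
    refine (hidx _ (hlt x)).inj ((mem_bucketObjs P h).mpr ⟨hx, rfl⟩)
      ((mem_bucketObjs P h).mpr ⟨hy, h1.symm⟩) ?_
    simp only [hcells]
    rw [← h1] at h2
    beta_reduce at h2
    rw [← h1] at h2
    exact h2
  · intro x hx
    exact offset_add_lt P h S (hlt x) (hcell x hx _ _)
  · intro v hv
    obtain ⟨k, hk, c, hc, rfl⟩ := exists_offset_add P h S hv
    rw [usedCells_getD P h S hk hc, (hidx k hk).used c (by rwa [hcells])]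
    constructor
    · rintro ⟨x, hx, rfl⟩
      obtain ⟨hx1, hx2⟩ := (mem_bucketObjs P h).mp hx
      exact ⟨x, hx1, by simp only [cellOf, hx2, hcells]⟩
    · rintro ⟨x, hx, hxv⟩
      obtain ⟨h1, h2⟩ := offset_add_inj P h S
        (hcell x hx _ _) hc hxv
      subst h1
      refine ⟨x, (mem_bucketObjs P h).mpr ⟨hx, rfl⟩, ?_⟩
      rw [hcells]
      exact h2

variable {P h}

theorem LayoutSpec.mem_entries {idx : U → ℕ} (hl : LayoutSpec P h S idx) (hne : S ≠ [])
    {e : U × ℕ × ℕ} :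
    e ∈ allEntries P h S ↔ e.1 ∈ S ∧ e = (e.1, clsOf P h e.1, idx e.1) := by
  rw [hl.entries, List.mem_flatMap]
  constructor
  · rintro ⟨k, -, he⟩
    obtain ⟨x, hx, rfl⟩ := List.mem_map.mp he
    exact ⟨((mem_bucketObjs P h).mp hx).1, rfl⟩
  · rintro ⟨h1, h2⟩
    rw [h2]
    refine ⟨_, List.mem_range.mpr (bucketOf_lt P h hne e.1), List.mem_map.mpr ⟨e.1, ?_, rfl⟩⟩
    exact (mem_bucketObjs P h).mpr ⟨h1, rfl⟩

theorem LayoutSpec.nodup_keys {idx : U → ℕ} (hl : LayoutSpec P h S idx) (hS : S.Nodup) (r : ℕ) :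
    ((keyValues P h S r).map Prod.fst).Nodup := by
  have h1 : ((allEntries P h S).map Prod.fst).Nodup := by
    rw [hl.entries, List.map_flatMap, List.nodup_flatMap]
    refine ⟨fun k _ => ?_, ?_⟩
    · rw [List.map_map]
      exact (List.map_id' _).symm ▸ hS.filter _
    · refine List.nodup_range.imp fun {k k'} hkk x hx hx' => hkk ?_
      simp only [List.map_map, Function.comp_def, List.map_id', mem_bucketObjs] at hx hx'
      exact hx.2.symm.trans hx'.2
  refine h1.sublist ?_
  rw [keyValues, List.map_map]
  exact List.filter_sublist.map _

theorem LayoutSpec.mem_keyValues {idx : U → ℕ} (hl : LayoutSpec P h S idx) (hne : S ≠ [])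
    {r : ℕ} {e : U × ℕ} :
    e ∈ keyValues P h S r ↔ e.1 ∈ S ∧ clsOf P h e.1 = r ∧ e.2 = idx e.1 := by
  simp only [keyValues, List.mem_map, List.mem_filter, hl.mem_entries hne, decide_eq_true_eq]
  constructor
  · rintro ⟨⟨x, r', i⟩, ⟨⟨h1, h2⟩, h3⟩, rfl⟩
    simp only [Prod.mk.injEq, true_and] at h2
    exact ⟨h1, h2.1.symm.trans h3, h2.2⟩
  · rintro ⟨h1, h2, h3⟩
    refine ⟨(e.1, r, e.2), ⟨⟨h1, ?_⟩, rfl⟩, rfl⟩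
    rw [h2, ← h3]

theorem keyValues_length_le (hne : S ≠ []) (r : ℕ) : (keyValues P h S r).length ≤ S.length := by
  rw [← allEntries_length P h hne, keyValues, List.length_map]
  exact List.length_filter_le _ _

theorem offsetList_pairwise : (offsetList P h S).Pairwise (· ≤ ·) := by
  rw [offsetList, List.pairwise_map]
  exact List.pairwise_lt_range.imp fun h' => offset_mono P h S h'.le

theorem le_of_mem_offsetList {a : ℕ} (ha : a ∈ offsetList P h S) : a ≤ totalCells P h S := by
  obtain ⟨k, hk, rfl⟩ := List.mem_map.mp ha
  exact offset_mono P h S (by simpa [Nat.lt_succ_iff] using hk)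

theorem eliasFanoGet_offset {w k : ℕ} (hk : k ≤ P.numBuckets S.length) :
    (eliasFanoGet w (eliasFano (totalCells P h S) (offsetList P h S)).val k).val =
      offset P h S k := by
  rw [eliasFanoGet_val offsetList_pairwise (by simpa [offsetList, Nat.lt_succ_iff] using hk)]
  simp [offsetList]

theorem golombRiceGet_seed {w k : ℕ} (hk : k < P.numBuckets S.length) :
    (golombRiceGet w (golombRice P.rice (seedList P h S)).val k).val =
      (bucketData P h S k).seed := by
  rw [golombRiceGet_val (by simpa [seedList] using hk)]
  simp [seedList]

/-- The retrieval data structures answer correctly. -/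
def RetrievalCorrect (R : Retrieval U) (ω : R.Ω) (kv : ℕ → List (U × ℕ)) : Prop :=
  ∀ r, 1 ≤ r → r ≤ 3 → ∀ e ∈ kv r, (R.query ω r (R.build ω r (kv r)).val e.1).val = e.2

theorem queryAux_val_eq (R : Retrieval U) (ω : R.Ω) (w : ℕ) (D : PHF) (x : U) :
    (queryAux P R h ω w D x).val = (eliasFanoGet w D.offsets (bucketOf h D.B x)).val +
      hashValue h x (.cell (golombRiceGet w D.seeds (bucketOf h D.B x)).val
        (R.query ω (clsOf P h x) (if clsOf P h x = 1 then D.ret₁ else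
          if clsOf P h x = 2 then D.ret₂ else D.ret₃) x).val)
        ((eliasFanoGet w D.offsets (bucketOf h D.B x + 1)).val -
          (eliasFanoGet w D.offsets (bucketOf h D.B x)).val) := rfl

/-- The decoded seed, the retrieved index and the difference of the two decoded offsets are exactly
the arguments with which the table placed `x`. -/
theorem queryAux_val {idx : U → ℕ} (hl : LayoutSpec P h S idx) (hne : S ≠ []) {R : Retrieval U}
    {ω : R.Ω} (hR : RetrievalCorrect R ω (keyValues P h S)) (w : ℕ) {x : U} (hx : x ∈ S) :
    (queryAux P R h ω w (constructAux P R h ω S).val.1 x).val = cellOf P h S idx x := by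
  have hB := bucketOf_lt P h hne x
  have hr := clsOf_mem P h x
  have hi := hR _ hr.1 hr.2 (x, idx x) ((hl.mem_keyValues hne).mpr ⟨hx, rfl, rfl⟩)
  dsimp only at hi
  have hret : (R.query ω (clsOf P h x) (if clsOf P h x = 1 then
      (R.build ω 1 (keyValues P h S 1)).val else if clsOf P h x = 2 then
      (R.build ω 2 (keyValues P h S 2)).val else (R.build ω 3 (keyValues P h S 3)).val) x).val =
      idx x := by
    rw [← hi]
    obtain h1 | h2 | h3 : clsOf P h x = 1 ∨ clsOf P h x = 2 ∨ clsOf P h x = 3 := by omega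
    · simp [h1]
    · simp [h2]
    · simp [h3]
  rw [constructAux_val, queryAux_val_eq]
  dsimp only
  rw [hret, golombRiceGet_seed hB, eliasFanoGet_offset hB.le, eliasFanoGet_offset hB, offset_succ,
    Nat.add_sub_cancel_left, cellOf]

end Layout

end SicHash

namespace SicHash

/-! ## The minimal variant -/

theorem countBelow_add_not (f : ℕ → Bool) (n : ℕ) :
    countBelow f n + countBelow (fun i => !f i) n = n := by
  induction n with
  | zero => rfl
  | succ n ih =>
    rw [countBelow_succ, countBelow_succ]
    cases f n <;> simp <;> omega

theorem remap_length (N : ℕ) (us : List Bool) (free : List ℕ) :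
    (remap N us free).val.length = us.length := by
  induction us generalizing free with
  | nil => rfl
  | cons u us ih => simp [remap, ih]

theorem remap_cost (N : ℕ) (us : List Bool) (free : List ℕ) :
    (remap N us free).cost = (us.length : ℕ) := by
  induction us generalizing free with
  | nil => rfl
  | cons u us ih => simp [remap, ih, add_comm]

/-- Only used cells consume a hole, so a cell receives the hole whose number is the count of used
cells before it. -/
theorem remap_getElem (N : ℕ) (us : List Bool) (free : List ℕ) {i : ℕ} (hi : i < us.length) :
    (remap N us free).val[i]'(by rwa [remap_length]) =
      free.getD (countBelow (fun j => us.getD j false) i) N := by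
  induction us generalizing free i with
  | nil => simp at hi
  | cons u us ih =>
    cases i with
    | zero => cases free <;> simp [remap, countBelow]
    | succ i =>
      have h1 := ih (if u then free.tail else free) (i := i) (by simpa using hi)
      have h2 : countBelow (fun j => (u :: us).getD j false) (i + 1) =
          (if u then 1 else 0) + countBelow (fun j => us.getD j false) i := by
        rw [add_comm i 1, countBelow_add, countBelow_succ]
        simp [countBelow, add_comm 1]
      rw [h2]
      simp only [remap, Timed.bind_val, Timed.pure_val, List.getElem_cons_succ]
      rw [h1]
      cases u <;> cases free <;> simp [add_comm 1]

/-- The unused cells `< N`. -/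
def freeCells (N : ℕ) (used : List Bool) : List ℕ :=
  (List.range N).filter fun c => !(used.getD c false)

/-- The images of the cells `≥ N`. -/
def targetList (N : ℕ) (used : List Bool) : List ℕ :=
  (remap N (used.drop N) (freeCells N used)).val

theorem targetList_length (N : ℕ) (used : List Bool) :
    (targetList N used).length = used.length - N := by
  rw [targetList, remap_length, List.length_drop]

/-- The default `N` lies above every free cell. Entries for cells after the last hole is consumed
therefore keep the sequence monotone and within the universe of the code. -/
theorem freeCells_getD_le {N : ℕ} (used : List Bool) {i j : ℕ} (hij : i ≤ j) :
    (freeCells N used).getD i N ≤ (freeCells N used).getD j N := by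
  have hs : (freeCells N used).Pairwise (· < ·) := List.pairwise_lt_range.filter _
  have hlt : ∀ a ∈ freeCells N used, a < N := fun a ha =>
    List.mem_range.mp (List.mem_filter.mp ha).1
  by_cases hj : j < (freeCells N used).length
  · rw [List.getD_eq_getElem _ _ hj, List.getD_eq_getElem _ _ (hij.trans_lt hj)]
    rcases hij.lt_or_eq with h | rfl
    · exact (List.pairwise_iff_getElem.mp hs _ _ _ hj h).le
    · exact le_rfl
  · rw [List.getD_eq_default _ _ (not_lt.mp hj)]
    by_cases hi : i < (freeCells N used).length
    · rw [List.getD_eq_getElem _ _ hi]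
      exact (hlt _ (List.getElem_mem hi)).le
    · rw [List.getD_eq_default _ _ (not_lt.mp hi)]

theorem targetList_getElem {N : ℕ} {used : List Bool} {i : ℕ} (hi : N + i < used.length) :
    (targetList N used)[i]'(by rw [targetList_length]; omega) =
      (freeCells N used).getD (countBelow (fun j => used.getD (N + j) false) i) N := by
  have := remap_getElem N (used.drop N) (freeCells N used) (i := i)
    (by rw [List.length_drop]; omega)
  simpa [targetList, List.getD_eq_getElem?_getD] using this

theorem targetList_pairwise (N : ℕ) (used : List Bool) :
    (targetList N used).Pairwise (· ≤ ·) := by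
  rw [List.pairwise_iff_getElem]
  intro i j hi hj hij
  rw [targetList_length] at hi hj
  rw [targetList_getElem (by omega), targetList_getElem (by omega)]
  exact freeCells_getD_le _ (countBelow_mono _ hij.le)

theorem le_of_mem_targetList {N : ℕ} {used : List Bool} {a : ℕ} (ha : a ∈ targetList N used) :
    a ≤ N := by
  obtain ⟨i, hi, rfl⟩ := List.getElem_of_mem ha
  rw [targetList_length] at hi
  rw [targetList_getElem (by omega), List.getD_eq_getElem?_getD]
  cases hf : (freeCells N used)[countBelow (fun j => used.getD (N + j) false) i]? with
  | none => simp
  | some y => exact (filter_range_spec hf).1.le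

variable {U : Type} {P : Params} {h : Hashes U} {S : List U}

theorem constructMinimal_val (P : Params) (R : Retrieval U) (h : Hashes U) (ω : R.Ω)
    (S : List U) : (constructMinimal P R h ω S).val =
      { base := (constructAux P R h ω S).val.1
        holes := (eliasFano S.length (targetList S.length (usedCells P h S))).val } := by
  have h1 : (constructAux P R h ω S).val.1.N = S.length := by rw [constructAux_val]
  have h2 : (constructAux P R h ω S).val.2 = usedCells P h S := by rw [constructAux_val]
  simp only [constructMinimal, Timed.bind_val, Timed.pure_val, h1, h2]
  rfl

theorem constructMinimal_cost (P : Params) (R : Retrieval U) (h : Hashes U) (ω : R.Ω)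
    (S : List U) : (constructMinimal P R h ω S).cost = (constructAux P R h ω S).cost +
      ((totalCells P h S + 1 : ℕ) + ((totalCells P h S - S.length : ℕ) +
        (eliasFano S.length (targetList S.length (usedCells P h S))).cost)) := by
  have h1 : (constructAux P R h ω S).val.1.N = S.length := by rw [constructAux_val]
  have h2 : (constructAux P R h ω S).val.2 = usedCells P h S := by rw [constructAux_val]
  have h3 : (constructAux P R h ω S).val.1.M = totalCells P h S := by rw [constructAux_val]
  simp only [constructMinimal, Timed.bind_cost, Timed.pure_cost, h1, h2, h3, tick_cost, remap_cost,
    List.length_drop, usedCells_length, add_zero]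
  rfl

/-- The value of the minimal perfect hash function for an object in cell `v`. -/
def minimalCell (N : ℕ) (used : List Bool) (v : ℕ) : ℕ :=
  if v < N then v
  else (freeCells N used).getD (countBelow (fun j => used.getD (N + j) false) (v - N)) N

theorem queryMinimal_val {idx : U → ℕ} (hl : LayoutSpec P h S idx) (hne : S ≠ [])
    {R : Retrieval U} {ω : R.Ω} (hR : RetrievalCorrect R ω (keyValues P h S)) {x : U}
    (hx : x ∈ S) : (queryMinimal P R h ω (constructMinimal P R h ω S).val x).val =
      minimalCell S.length (usedCells P h S) (cellOf P h S idx x) := by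
  have h1 : (constructAux P R h ω S).val.1.N = S.length := by rw [constructAux_val]
  have hlt := hl.lt x hx
  rw [constructMinimal_val]
  simp only [queryMinimal, Timed.bind_val, queryAux_val hl hne hR _ hx, h1, minimalCell]
  split_ifs with hv
  · rfl
  · rw [eliasFanoGet_val (targetList_pairwise _ _)
      (by rw [targetList_length, usedCells_length]; omega), targetList_getElem
      (by rw [usedCells_length]; omega)]

/-- The placement is a bijection from the objects onto the used cells. -/
theorem LayoutSpec.countBelow_used {idx : U → ℕ} (hl : LayoutSpec P h S idx) (hS : S.Nodup) :
    countBelow (fun j => (usedCells P h S).getD j false) (totalCells P h S) = S.length := by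
  classical
  have h1 : ((List.range (totalCells P h S)).filter fun j =>
      (usedCells P h S).getD j false).toFinset = S.toFinset.image (cellOf P h S idx) := by
    ext v
    simp only [List.mem_toFinset, List.mem_filter, List.mem_range, Finset.mem_image]
    constructor
    · rintro ⟨h1, h2⟩
      exact (hl.used v h1).mp h2
    · rintro ⟨x, hx, rfl⟩
      exact ⟨hl.lt x hx, (hl.used _ (hl.lt x hx)).mpr ⟨x, hx, rfl⟩⟩
  rw [countBelow, ← List.toFinset_card_of_nodup (List.nodup_range.filter _), h1,
    Finset.card_image_of_injOn, List.toFinset_card_of_nodup hS]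
  intro x hx y hy hxy
  exact hl.inj (by simpa using hx) (by simpa using hy) hxy

/-- Since N cells are used in total, as many used cells lie at or above N as unused ones below N.
The cell of `x` is itself used, so strictly fewer used cells precede it in the upper part. -/
theorem LayoutSpec.minimalCell_lt {idx : U → ℕ} (hl : LayoutSpec P h S idx) (hS : S.Nodup)
    {x : U} (hx : x ∈ S) (hv : S.length ≤ cellOf P h S idx x) :
    countBelow (fun j => (usedCells P h S).getD (S.length + j) false)
      (cellOf P h S idx x - S.length) < (freeCells S.length (usedCells P h S)).length := by
  have h1 := hl.countBelow_used hS
  have h2 := countBelow_mono (fun j => (usedCells P h S).getD j false)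
    (Nat.succ_le_of_lt (hl.lt x hx))
  have h3 := (hl.used _ (hl.lt x hx)).mpr ⟨x, hx, rfl⟩
  rw [Nat.succ_eq_add_one, countBelow_succ, h1, h3, if_pos rfl] at h2
  have h4 := countBelow_add (fun j => (usedCells P h S).getD j false) S.length
    (cellOf P h S idx x - S.length)
  rw [Nat.add_sub_cancel' hv] at h4
  have h5 := countBelow_add_not (fun j => (usedCells P h S).getD j false) S.length
  have h6 : (freeCells S.length (usedCells P h S)).length =
    countBelow (fun j => !(usedCells P h S).getD j false) S.length := rfl
  omega

theorem LayoutSpec.bijOn {idx : U → ℕ} (hl : LayoutSpec P h S idx) (hS : S.Nodup) :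
    Set.BijOn (fun x => minimalCell S.length (usedCells P h S) (cellOf P h S idx x))
      {x | x ∈ S} (Set.Iio S.length) := by
  classical
  set N := S.length with hN
  set used := usedCells P h S with hused
  have hfree : ∀ x ∈ S, N ≤ cellOf P h S idx x →
      ∃ hlt : countBelow (fun j => used.getD (N + j) false) (cellOf P h S idx x - N) <
        (freeCells N used).length, minimalCell N used (cellOf P h S idx x) =
          (freeCells N used)[countBelow (fun j => used.getD (N + j) false)
            (cellOf P h S idx x - N)] := by
    intro x hx hv
    refine ⟨hl.minimalCell_lt hS hx hv, ?_⟩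
    rw [minimalCell, if_neg (not_lt.mpr hv), List.getD_eq_getElem]
  have hmem : ∀ x ∈ S, N ≤ cellOf P h S idx x →
      minimalCell N used (cellOf P h S idx x) ∈ freeCells N used := by
    intro x hx hv
    obtain ⟨hlt, heq⟩ := hfree x hx hv
    rw [heq]
    exact List.getElem_mem hlt
  have hmaps : Set.MapsTo (fun x => minimalCell N used (cellOf P h S idx x)) {x | x ∈ S}
      (Set.Iio N) := by
    intro x hx
    rcases lt_or_ge (cellOf P h S idx x) N with hv | hv
    · simp [minimalCell, hv]
    · exact List.mem_range.mp (List.mem_filter.mp (hmem x hx hv)).1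
  -- Unmoved objects occupy used cells, whereas moved ones go to unused cells.
  have hmixed : ∀ x ∈ S, ∀ y ∈ S, cellOf P h S idx x < N → N ≤ cellOf P h S idx y →
      minimalCell N used (cellOf P h S idx x) ≠ minimalCell N used (cellOf P h S idx y) := by
    intro x hx y hy hvx hvy heq
    have h1 := (List.mem_filter.mp (hmem y hy hvy)).2
    rw [← heq, minimalCell, if_pos hvx, (hl.used _ (hl.lt x hx)).mpr ⟨x, hx, rfl⟩] at h1
    cases h1
  have hstrict : ∀ x ∈ S, ∀ y ∈ S, N ≤ cellOf P h S idx x → cellOf P h S idx x <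
      cellOf P h S idx y → minimalCell N used (cellOf P h S idx x) ≠
        minimalCell N used (cellOf P h S idx y) := by
    intro x hx y hy hvx hxy heq
    obtain ⟨h1, h2⟩ := hfree x hx hvx
    obtain ⟨h3, h4⟩ := hfree y hy (hvx.trans hxy.le)
    have hnd : (freeCells N used).Nodup := List.nodup_range.filter _
    rw [h2, h4, hnd.getElem_inj_iff] at heq
    -- The smaller cell is used, so the count strictly increases after it and the two objects
    -- receive different holes.
    have h5 := countBelow_mono (fun j => used.getD (N + j) false)
      (show cellOf P h S idx x - N + 1 ≤ cellOf P h S idx y - N by omega)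
    rw [countBelow_succ, Nat.add_sub_cancel' hvx,
      (hl.used _ (hl.lt x hx)).mpr ⟨x, hx, rfl⟩, if_pos rfl] at h5
    omega
  have hinj : Set.InjOn (fun x => minimalCell N used (cellOf P h S idx x)) {x | x ∈ S} := by
    intro x hx y hy hxy
    rcases lt_or_ge (cellOf P h S idx x) N with hvx | hvx
    · rcases lt_or_ge (cellOf P h S idx y) N with hvy | hvy
      · refine hl.inj hx hy ?_
        simpa [minimalCell, hvx, hvy] using hxy
      · exact absurd hxy (hmixed x hx y hy hvx hvy)
    · rcases lt_or_ge (cellOf P h S idx y) N with hvy | hvy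
      · exact absurd hxy.symm (hmixed y hy x hx hvy hvx)
      · rcases lt_trichotomy (cellOf P h S idx x) (cellOf P h S idx y) with hlt | heq | hlt
        · exact absurd hxy (hstrict x hx y hy hvx hlt)
        · exact hl.inj hx hy heq
        · exact absurd hxy.symm (hstrict y hy x hx hvy hlt)
  refine ⟨hmaps, hinj, ?_⟩
  -- Surjectivity follows from injectivity, both sides having N elements.
  have := Finset.surjOn_of_injOn_of_card_le (s := S.toFinset) (t := Finset.range N)
    (fun x => minimalCell N used (cellOf P h S idx x))
    (fun x hx => by simpa using hmaps (by simpa using hx))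
    (fun x hx y hy hxy => hinj (by simpa using hx) (by simpa using hy) hxy)
    (by rw [List.toFinset_card_of_nodup hS, Finset.card_range])
  simpa using this

/-! ## Query time -/

/-- The logarithm of a number at most K·N is at most K plus the bit length of N, so a lower field
spans at most K + 1 words. -/
theorem eliasFano_low_le_mul {univ N K w : ℕ} {as : List ℕ} (hw : 0 < w) (hN : N.size ≤ w)
    (hle : univ + as.length ≤ K * N) : (eliasFano univ as).val.low ≤ (K + 1) * w := by
  rw [eliasFano_low]
  refine Nat.clog_le_of_le_pow (((Nat.div_le_self _ _).trans (Nat.sub_le _ _)).trans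
    (hle.trans ?_))
  calc K * N ≤ 2 ^ K * 2 ^ N.size :=
        Nat.mul_le_mul Nat.lt_two_pow_self.le (Nat.lt_size_self N).le
    _ = 2 ^ (K + N.size) := (pow_add _ _ _).symm
    _ ≤ 2 ^ ((K + 1) * w) := Nat.pow_le_pow_right (by norm_num) (by nlinarith)

/-- The queries of the retrieval data structures take at most `c` steps. -/
def RetrievalFast (R : Retrieval U) (ω : R.Ω) (kv : ℕ → List (U × ℕ)) (c : ℕ) : Prop :=
  ∀ r, 1 ≤ r → r ≤ 3 → ∀ x, (R.query ω r (R.build ω r (kv r)).val x).cost ≤ c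

/-- A bound on the number of cells per object. -/
noncomputable def Params.expansion (P : Params) : ℕ := ⌈1 / P.α⌉₊

noncomputable def Params.queryBound (P : Params) (c : ℕ) : ℕ :=
  1300 + c + P.rice + 3 * P.expansion

theorem offsets_length_le (hne : S ≠ []) :
    totalCells P h S + (offsetList P h S).length ≤ (P.expansion + 2) * S.length := by
  have h1 : totalCells P h S ≤ P.expansion * S.length := totalCells_le P h hne
  have h2 := P.numBuckets_le S.length
  have h3 := List.length_pos_iff.mpr hne
  simp only [offsetList, List.length_map, List.length_range]
  rw [add_mul]
  omega

theorem queryAux_cost_eq (R : Retrieval U) (ω : R.Ω) (w : ℕ) (D : PHF) (x : U) :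
    (queryAux P R h ω w D x).cost = 1 + ((R.query ω (clsOf P h x) (if clsOf P h x = 1 then D.ret₁
      else if clsOf P h x = 2 then D.ret₂ else D.ret₃) x).cost + (1 +
        ((golombRiceGet w D.seeds (bucketOf h D.B x)).cost +
          ((eliasFanoGet w D.offsets (bucketOf h D.B x)).cost +
            ((eliasFanoGet w D.offsets (bucketOf h D.B x + 1)).cost + (1 + 0)))))) := by
  simp only [queryAux, Timed.bind_cost, classOf_cost, hash_cost, Timed.pure_cost]
  rfl

theorem eliasFano_idx (univ : ℕ) (as : List ℕ) : (eliasFano univ as).val.idx =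
    (buildSelect (eliasFano univ as).val.hi).val := rfl

theorem golombRice_idx (k : ℕ) (as : List ℕ) : (golombRice k as).val.idx =
    (buildSelect (golombRice k as).val.hi).val := rfl

/-- Any sufficiently long word is allowed, because the minimal variant queries the same structure
with words sized for the larger data structure. The constant 1206 collects one seed access, two
offset accesses and three hash evaluations. -/
theorem queryAux_cost_le {R : Retrieval U} {ω : R.Ω} {c : ℕ} (hne : S ≠ [])
    (hR : RetrievalFast R ω (keyValues P h S) c) {w : ℕ} {D : PHF}
    (hD : D = (constructAux P R h ω S).val.1) (hw : (D.N + D.space).size ≤ w) (x : U) :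
    (queryAux P R h ω w D x).cost ≤ (1206 + c + P.rice + 2 * (P.expansion + 3) : ℕ) := by
  have hN : S.length.size ≤ w := by
    refine le_trans (Nat.size_le_size ?_) hw
    rw [hD, constructAux_val]
    exact Nat.le_add_right _ _
  have hw0 : 0 < w := (Nat.size_pos.mpr (List.length_pos_iff.mpr hne)).trans_le hN
  have hoff : D.offsets.hi.length.size ≤ w := by
    refine le_trans (Nat.size_le_size ?_) hw
    unfold PHF.space CodedSeq.space
    omega
  have hseed : D.seeds.hi.length.size ≤ w := by
    refine le_trans (Nat.size_le_size ?_) hw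
    unfold PHF.space CodedSeq.space
    omega
  have hlow : D.offsets.low ≤ (P.expansion + 3) * w := by
    rw [hD, constructAux_val]
    exact eliasFano_low_le_mul hw0 hN (offsets_length_le hne)
  have hlow' : D.seeds.low ≤ P.rice * w := by
    rw [hD, constructAux_val]
    exact Nat.le_mul_of_pos_right _ hw0
  have hidx : D.offsets.idx = (buildSelect D.offsets.hi).val := by
    rw [hD, constructAux_val]
    exact eliasFano_idx _ _
  have hidx' : D.seeds.idx = (buildSelect D.seeds.hi).val := by
    rw [hD, constructAux_val]
    exact golombRice_idx _ _
  have hq : (R.query ω (clsOf P h x) (if clsOf P h x = 1 then D.ret₁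
      else if clsOf P h x = 2 then D.ret₂ else D.ret₃) x).cost ≤ c := by
    have hr := clsOf_mem P h x
    have := hR _ hr.1 hr.2 x
    rw [hD, constructAux_val]
    obtain h1 | h2 | h3 : clsOf P h x = 1 ∨ clsOf P h x = 2 ∨ clsOf P h x = 3 := by omega
    · simpa [h1] using this
    · simpa [h2] using this
    · simpa [h3] using this
  rw [queryAux_cost_eq]
  refine (add_le_add le_rfl (add_le_add hq (add_le_add le_rfl (add_le_add
    (golombRiceGet_cost_le hidx' hw0 hseed hlow' _) (add_le_add
      (eliasFanoGet_cost_le hidx hw0 hoff hlow _) (add_le_add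
        (eliasFanoGet_cost_le hidx hw0 hoff hlow _) le_rfl)))))).trans ?_
  exact_mod_cast (by omega)

theorem query_cost_le {R : Retrieval U} {ω : R.Ω} {c : ℕ} (hne : S ≠ [])
    (hR : RetrievalFast R ω (keyValues P h S) c) (x : U) :
    (query P R h ω (construct P R h ω S).val x).cost ≤ (P.queryBound c : ℕ) := by
  refine (queryAux_cost_le hne hR rfl le_rfl x).trans ?_
  unfold Params.queryBound
  exact_mod_cast (by omega)

theorem queryMinimal_cost_le {R : Retrieval U} {ω : R.Ω} {c : ℕ} (hne : S ≠ [])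
    (hR : RetrievalFast R ω (keyValues P h S) c) (x : U) :
    (queryMinimal P R h ω (constructMinimal P R h ω S).val x).cost ≤
      (P.queryBound c + 400 + P.expansion : ℕ) := by
  have h1 : (constructAux P R h ω S).val.1.N = S.length := by rw [constructAux_val]
  rw [constructMinimal_val]
  set D : MPHF := { base := (constructAux P R h ω S).val.1
                    holes := (eliasFano S.length
                      (targetList S.length (usedCells P h S))).val } with hD
  have hw : (D.base.N + D.base.space).size ≤ (D.base.N + D.space).size :=
    Nat.size_le_size (by unfold MPHF.space; omega)
  have hN : S.length.size ≤ (D.base.N + D.space).size :=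
    Nat.size_le_size (by rw [← h1]; exact Nat.le_add_right _ _)
  have hw0 := (Nat.size_pos.mpr (List.length_pos_iff.mpr hne)).trans_le hN
  have hhi : D.holes.hi.length.size ≤ (D.base.N + D.space).size :=
    Nat.size_le_size (by unfold MPHF.space CodedSeq.space; omega)
  have hlow : D.holes.low ≤ (P.expansion + 1 + 1) * (D.base.N + D.space).size := by
    refine eliasFano_low_le_mul hw0 hN ?_
    have h2 : totalCells P h S ≤ P.expansion * S.length := totalCells_le P h hne
    rw [targetList_length, usedCells_length, add_mul]
    omega
  have : (queryMinimal P R h ω D x).cost ≤ ((1206 + c + P.rice + 2 * (P.expansion + 3)) +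
      (1 + (301 + (P.expansion + 1 + 1))) : ℕ) := by
    refine cost_bind_le (queryAux_cost_le hne hR rfl hw x) (cost_bind_le le_rfl ?_)
    split_ifs
    · exact zero_le
    · exact eliasFanoGet_cost_le (eliasFano_idx _ _) hw0 hhi hlow _
  refine this.trans ?_
  unfold Params.queryBound
  exact_mod_cast (by omega)

end SicHash

namespace SicHash

/-! ## Construction time and space in terms of the number of attempts -/

variable {U : Type}

/-- With seed `s`, the first candidate cells of the objects are distinct. -/
def DistinctFirst (h : Hashes U) (X : List U) (m s : ℕ) : Prop :=
  (X.map fun x => hashValue h x (.cell s 0) m).Nodup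

open Classical in
/-- The number of attempts until the first candidate cells are distinct. -/
noncomputable def trials (h : Hashes U) (X : List U) (m : ℕ) : ℝ≥0∞ :=
  ∑' s, if ∀ s' < s, ¬ DistinctFirst h X m s' then 1 else 0

theorem attempt_isSome {P : Params} {h : Hashes U} {X : List U} {s : ℕ}
    (hd : DistinctFirst h X (numCells P.α X.length) s) : (attempt P h X s).val.isSome := by
  refine tryTable_isSome h X (le_numCells P.α_pos P.α_le _) (fun j => by
    unfold bucketDeg; positivity) fun i j hi hj hij => ?_
  have h1 : ∀ i (hi : i < X.length), candCell h X (numCells P.α X.length) s i 0 =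
      (X.map fun x => hashValue h x (.cell s 0) (numCells P.α X.length))[i]'(by simpa using hi) := by
    intro i hi
    simp [candCell, hi]
  rw [h1 i hi, h1 j hj] at hij
  exact (List.Nodup.getElem_inj_iff hd).mp hij

theorem one_le_trials (h : Hashes U) (X : List U) (m : ℕ) : 1 ≤ trials h X m := by
  classical
  refine le_trans ?_ (ENNReal.le_tsum 0)
  simp

-- Each of the first `n + 1` summands of `trials` is one: a failed attempt cannot have had distinct
-- first candidates.
open Classical in
theorem le_trials {P : Params} {h : Hashes U} {X : List U} {n : ℕ}
    (hn : ∀ s < n, ¬ (attempt P h X s).val.isSome) :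
    ((n + 1 : ℕ) : ℝ≥0∞) ≤ trials h X (numCells P.α X.length) := by
  refine le_trans ?_ (ENNReal.sum_le_tsum (Finset.range (n + 1)))
  rw [Finset.sum_congr rfl fun s hs => if_pos ?_]
  · simp
  · intro s' hs' hd
    rw [Finset.mem_range] at hs
    exact hn s' (by omega) (attempt_isSome hd)

/-- A bucket that can never be placed contributes infinity, so the bounds below hold for all
realizations without assuming success. -/
theorem trials_eq_top {P : Params} {h : Hashes U} {X : List U} (hX : ¬ Placeable P h X) :
    trials h X (numCells P.α X.length) = ⊤ := by
  refine ENNReal.eq_top_of_forall_nnreal_le fun r => ?_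
  obtain ⟨n, hn⟩ := exists_nat_gt r
  refine le_trans ?_ (le_trials (n := n) fun s _ hs => hX ⟨s, hs⟩)
  exact_mod_cast hn.le.trans (by exact_mod_cast Nat.le_succ n)

theorem placement_seed_le (P : Params) (h : Hashes U) (X : List U) :
    (((placement P h X).val.1 : ℕ) : ℝ≥0∞) ≤ trials h X (numCells P.α X.length) := by
  classical
  by_cases hX : Placeable P h X
  · refine le_trans ?_ (le_trials (P := P) (n := Nat.find hX) fun s hs => Nat.find_min hX hs)
    have : (placement P h X).val.1 = Nat.find hX := by
      have hX' : ∃ s, (attempt P h X s).val.isSome := hX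
      simp only [placement, firstSuccess, dif_pos hX']
    rw [this]
    exact_mod_cast Nat.le_succ _
  · rw [trials_eq_top hX]
    exact le_top

theorem toENNReal_sum {ι : Type*} (s : Finset ι) (f : ι → ℕ∞) :
    ((∑ i ∈ s, f i : ℕ∞) : ℝ≥0∞) = ∑ i ∈ s, (f i : ℝ≥0∞) := by
  classical
  induction s using Finset.induction_on with
  | empty => simp
  | insert a s ha ih => rw [Finset.sum_insert ha, Finset.sum_insert ha, ENat.toENNReal_add, ih]

theorem placement_cost_le (P : Params) (h : Hashes U) (X : List U) :
    ((placement P h X).cost : ℝ≥0∞) ≤ ((numCells P.α X.length + X.length + 2 + X.length *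
      ((numCells P.α X.length + 1) * 19) : ℕ) : ℝ≥0∞) * trials h X (numCells P.α X.length) := by
  classical
  by_cases hX : Placeable P h X
  · refine le_trans ?_ (mul_le_mul_right (le_trials (P := P) (n := Nat.find hX) fun s hs =>
      Nat.find_min hX hs) _)
    have hX' : ∃ s, (attempt P h X s).val.isSome := hX
    have h1 : (placement P h X).cost =
        ∑ s ∈ Finset.range (Nat.find hX + 1), ((attempt P h X s).cost + 1) := by
      simp only [placement, firstSuccess, dif_pos hX']
    rw [h1, toENNReal_sum]
    refine (Finset.sum_le_card_nsmul _ _ _ fun s _ => ?_).trans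
      (by rw [Finset.card_range, nsmul_eq_mul, mul_comm])
    have h2 := tryTable_cost_le h X (numCells P.α X.length) (bucketDeg_le P h X) s
    have h3 : (attempt P h X s).cost + 1 ≤ ((numCells P.α X.length + X.length + 2 + X.length *
      ((numCells P.α X.length + 1) * 19) : ℕ) : ℕ∞) := by
      refine (add_le_add h2 le_rfl).trans ?_
      rw [show 2 * 8 + 3 = 19 by norm_num]
      exact_mod_cast (by omega)
    exact_mod_cast ENat.toENNReal_mono h3
  · rw [trials_eq_top hX, ENNReal.mul_top]
    · exact le_top
    · norm_num

/-- One attempt is quadratic in the size of the bucket. Replacing the polynomial by 2ⁿ is wasteful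
but leaves a single exponential moment to estimate. -/
theorem buildBucket_cost_le (P : Params) (h : Hashes U) (X : List U) :
    ((buildBucket P h X).cost : ℝ≥0∞) ≤ ((100 * (P.expansion + 1) : ℕ) : ℝ≥0∞) *
      (2 ^ X.length * trials h X (numCells P.α X.length)) := by
  have hm : numCells P.α X.length ≤ P.expansion * X.length := numCells_le _ _
  have hp := placement_cost_le P h X
  have ht := one_le_trials h X (numCells P.α X.length)
  have h1 : (buildBucket P h X).cost =
      ((3 * X.length + 1 + numCells P.α X.length : ℕ) : ℕ∞) + (placement P h X).cost := by
    rw [buildBucket_cost]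
    push_cast
    ring
  rw [h1, ENat.toENNReal_add, ENat.toENNReal_coe]
  generalize numCells P.α X.length = m at *
  generalize trials h X m = t at *
  calc ((3 * X.length + 1 + m : ℕ) : ℝ≥0∞) + ((placement P h X).cost : ℝ≥0∞)
      ≤ ((3 * X.length + 1 + m : ℕ) : ℝ≥0∞) * t +
        ((m + X.length + 2 + X.length * ((m + 1) * 19) : ℕ) : ℝ≥0∞) * t :=
        add_le_add (le_mul_of_one_le_right zero_le ht) hp
    _ = ((3 * X.length + 1 + m + (m + X.length + 2 + X.length * ((m + 1) * 19)) : ℕ) :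
          ℝ≥0∞) * t := by
        rw [← add_mul]
        push_cast
        ring
    _ ≤ ((100 * (P.expansion + 1) * 2 ^ X.length : ℕ) : ℝ≥0∞) * t := by
        refine mul_le_mul_left ?_ _
        have h2 : (X.length + 1) * (X.length + 1) ≤ 4 * 2 ^ X.length := by
          have := sq_le_two_pow (X.length + 1)
          rw [pow_add, pow_add] at this
          omega
        have h3 : X.length * m ≤ P.expansion * (X.length * X.length) := by nlinarith
        have h4 : 3 * X.length + 1 + m + (m + X.length + 2 + X.length * ((m + 1) * 19)) ≤
            100 * (P.expansion + 1) * 2 ^ X.length := by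
          have h5 := Nat.mul_le_mul_left P.expansion h2
          generalize 2 ^ X.length = e at *
          nlinarith
        exact_mod_cast h4
    _ = _ := by
        push_cast
        ring

/-- The expected amount of this quantity governs construction time and space. -/
noncomputable def work (P : Params) (h : Hashes U) (S : List U) : ℝ≥0∞ :=
  ∑ k ∈ Finset.range (P.numBuckets S.length),
    2 ^ (bucketObjs P h S k).length * trials h (bucketObjs P h S k) (bucketCells P h S k)

theorem sum_buildBucket_cost_le (P : Params) (h : Hashes U) (S : List U) :
    ((∑ k ∈ Finset.range (P.numBuckets S.length), (buildBucket P h (bucketObjs P h S k)).cost :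
      ℕ∞) : ℝ≥0∞) ≤ ((100 * (P.expansion + 1) : ℕ) : ℝ≥0∞) * work P h S := by
  rw [toENNReal_sum, work, Finset.mul_sum]
  exact Finset.sum_le_sum fun k _ => buildBucket_cost_le P h _

theorem seedList_sum_le (P : Params) (h : Hashes U) (S : List U) :
    (((seedList P h S).sum : ℕ) : ℝ≥0∞) ≤ work P h S := by
  have h1 : (seedList P h S).sum =
      ∑ k ∈ Finset.range (P.numBuckets S.length), (bucketData P h S k).seed := by
    rw [seedList]
    generalize P.numBuckets S.length = B
    induction B with
    | zero => rfl
    | succ n ih => simp [List.range_succ, Finset.sum_range_succ, ih]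
  rw [h1, work]
  push_cast
  refine Finset.sum_le_sum fun k _ => ?_
  have h2 : (bucketData P h S k).seed = (placement P h (bucketObjs P h S k)).val.1 := by
    rw [bucketData, buildBucket_val]
  rw [h2]
  exact (placement_seed_le P h _).trans (le_mul_of_one_le_left zero_le
    (one_le_pow_of_one_le' (by norm_num) _))

variable {P : Params} {h : Hashes U} {S : List U}

noncomputable def Params.workBound (P : Params) : ℕ := 10000 * (P.expansion + 1) * (P.rice + 1)

theorem mul_add_work_le {n₀ n₁ n₂ s : ℕ} {w b : ℝ≥0∞} (hs : (s : ℝ≥0∞) ≤ w)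
    (hb : b ≤ (n₂ : ℝ≥0∞) * w) {N K : ℕ} (h₀ : n₀ ≤ K * N) (h₁ : n₁ + n₂ ≤ K) :
    ((n₀ + n₁ * s : ℕ) : ℝ≥0∞) + b ≤ (K : ℝ≥0∞) * (N + w) := by
  have h1 : (n₀ : ℝ≥0∞) ≤ (K : ℝ≥0∞) * N := by exact_mod_cast h₀
  have h2 : (n₁ : ℝ≥0∞) + n₂ ≤ K := by exact_mod_cast h₁
  push_cast
  calc (n₀ : ℝ≥0∞) + n₁ * s + b ≤ K * N + n₁ * w + n₂ * w := by gcongr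
    _ = K * N + (n₁ + n₂) * w := by ring
    _ ≤ K * N + K * w := by gcongr
    _ = _ := by ring

/-- The cost of building the three retrieval data structures. -/
noncomputable def retrievalCost (P : Params) (h : Hashes U) (S : List U) (R : Retrieval U)
    (ω : R.Ω) : ℕ∞ :=
  (R.build ω 1 (keyValues P h S 1)).cost + (R.build ω 2 (keyValues P h S 2)).cost +
    (R.build ω 3 (keyValues P h S 3)).cost

/-- The size of the three retrieval data structures. -/
noncomputable def retrievalSpace (P : Params) (h : Hashes U) (S : List U) (R : Retrieval U)
    (ω : R.Ω) : ℕ :=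
  (R.build ω 1 (keyValues P h S 1)).val.length + (R.build ω 2 (keyValues P h S 2)).val.length +
    (R.build ω 3 (keyValues P h S 3)).val.length

theorem constructAux_cost_le (hne : S ≠ []) (R : Retrieval U) (ω : R.Ω) :
    (constructAux P R h ω S).cost ≤ (((6000 * (P.expansion + 1) + 620 * (P.rice + 1)) * S.length +
      310 * (P.rice + 1) * (seedList P h S).sum : ℕ) : ℕ∞) +
      ∑ k ∈ Finset.range (P.numBuckets S.length), (buildBucket P h (bucketObjs P h S k)).cost +
        retrievalCost P h S R ω := by
  have hN := List.length_pos_iff.mpr hne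
  have hB := P.numBuckets_le S.length
  have h1 := offsets_length_le (P := P) (h := h) hne
  have hM : totalCells P h S ≤ P.expansion * S.length := totalCells_le P h hne
  have hoff := eliasFano_cost_le (univ := totalCells P h S) (offsetList_pairwise (P := P) (h := h)
    (S := S)) fun a ha => le_of_mem_offsetList ha
  have hseed := golombRice_cost_le P.rice (seedList P h S)
  have hlen : (seedList P h S).length = P.numBuckets S.length := by simp [seedList]
  rw [hlen] at hseed
  rw [constructAux_cost, partition_cost, allEntries_length P h hne]
  -- The bucket and retrieval costs may be infinite; they stay opaque so that only the
  -- natural-number part is compared.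
  generalize ∑ k ∈ Finset.range (P.numBuckets S.length),
    (buildBucket P h (bucketObjs P h S k)).cost = b
  unfold retrievalCost
  refine (add_le_add le_rfl (add_le_add le_rfl (add_le_add le_rfl (add_le_add le_rfl
    (add_le_add le_rfl (add_le_add hoff (add_le_add hseed le_rfl))))))).trans ?_
  generalize (R.build ω 1 (keyValues P h S 1)).cost = b₁
  generalize (R.build ω 2 (keyValues P h S 2)).cost = b₂
  generalize (R.build ω 3 (keyValues P h S 3)).cost = b₃
  set N := S.length
  set B := P.numBuckets N
  set M := totalCells P h S
  set l := (offsetList P h S).length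
  set s := (seedList P h S).sum
  have h2 : (N + 1) + (N + (B + 1)) + 4 * B + (B + 1) + 1000 * (M + l + 1) +
      310 * (P.rice + 1) * (s + B + 1) + (N + M) + N + N + N ≤
      (6000 * (P.expansion + 1) + 620 * (P.rice + 1)) * N + 310 * (P.rice + 1) * s := by
    have h3 : 310 * (P.rice + 1) * (s + B + 1) ≤ 310 * (P.rice + 1) * s +
        620 * (P.rice + 1) * N := by nlinarith
    have h4 : 6000 * (P.expansion + 1) * N = 6000 * (P.expansion * N) + 6000 * N := by ring
    rw [add_mul] at h1 ⊢
    omega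
  have h3 := add_le_add (Nat.cast_le (α := ℕ∞).mpr h2) (le_refl (b + (b₁ + b₂ + b₃)))
  calc _ = _ := ?_
    _ ≤ _ := h3
    _ = _ := by rw [← add_assoc]
  push_cast
  ring

theorem constructAux_space_le (hne : S ≠ []) (R : Retrieval U) (ω : R.Ω) :
    (constructAux P R h ω S).val.1.space ≤
      (6000 * (P.expansion + 1) + 820 * (P.rice + 1)) * S.length +
        410 * (P.rice + 1) * (seedList P h S).sum + retrievalSpace P h S R ω := by
  have hN := List.length_pos_iff.mpr hne
  have hB := P.numBuckets_le S.length
  have h1 := offsets_length_le (P := P) (h := h) hne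
  have hM : totalCells P h S ≤ P.expansion * S.length := totalCells_le P h hne
  have hoff := eliasFano_space_le (univ := totalCells P h S) (offsetList_pairwise (P := P) (h := h)
    (S := S)) fun a ha => le_of_mem_offsetList ha
  have hseed := golombRice_space_le P.rice (seedList P h S)
  have hlen : (seedList P h S).length = P.numBuckets S.length := by simp [seedList]
  rw [hlen] at hseed
  rw [constructAux_val]
  unfold PHF.space retrievalSpace
  dsimp only
  have h5 := size_le S.length
  have h6 := size_le (P.numBuckets S.length)
  have h7 := size_le (totalCells P h S)
  have h3 : 410 * (P.rice + 1) * ((seedList P h S).sum + P.numBuckets S.length + 1) ≤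
      410 * (P.rice + 1) * (seedList P h S).sum + 820 * (P.rice + 1) * S.length := by nlinarith
  have h4 : 6000 * (P.expansion + 1) * S.length =
    6000 * (P.expansion * S.length) + 6000 * S.length := by ring
  rw [add_mul] at h1 ⊢
  omega

theorem holes_length_le (hne : S ≠ []) : S.length +
    (targetList S.length (usedCells P h S)).length ≤ (P.expansion + 1) * S.length := by
  have hM : totalCells P h S ≤ P.expansion * S.length := totalCells_le P h hne
  rw [targetList_length, usedCells_length, add_mul]
  omega

theorem constructMinimal_cost_le (hne : S ≠ []) (R : Retrieval U) (ω : R.Ω) :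
    ((constructMinimal P R h ω S).cost : ℝ≥0∞) ≤ (P.workBound : ℝ≥0∞) *
      (S.length + work P h S) + (retrievalCost P h S R ω : ℝ≥0∞) := by
  have hN := List.length_pos_iff.mpr hne
  have h1 := constructAux_cost_le (P := P) (h := h) hne R ω
  have h2 := eliasFano_cost_le (univ := S.length) (targetList_pairwise S.length (usedCells P h S))
    fun a ha => le_of_mem_targetList ha
  have h3 := holes_length_le (P := P) (h := h) hne
  have hM : totalCells P h S ≤ P.expansion * S.length := totalCells_le P h hne
  have h4 : (constructMinimal P R h ω S).cost ≤
      (((9000 * (P.expansion + 1) + 620 * (P.rice + 1)) * S.length +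
        310 * (P.rice + 1) * (seedList P h S).sum : ℕ) : ℕ∞) +
      ∑ k ∈ Finset.range (P.numBuckets S.length), (buildBucket P h (bucketObjs P h S k)).cost +
        retrievalCost P h S R ω := by
    rw [constructMinimal_cost]
    refine (add_le_add h1 (add_le_add le_rfl (add_le_add le_rfl h2))).trans ?_
    generalize ∑ k ∈ Finset.range (P.numBuckets S.length),
      (buildBucket P h (bucketObjs P h S k)).cost = b
    generalize retrievalCost P h S R ω = r
    have h5 : (6000 * (P.expansion + 1) + 620 * (P.rice + 1)) * S.length +
        310 * (P.rice + 1) * (seedList P h S).sum + (totalCells P h S + 1) +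
        (totalCells P h S - S.length) + 1000 * (S.length +
          (targetList S.length (usedCells P h S)).length + 1) ≤
        (9000 * (P.expansion + 1) + 620 * (P.rice + 1)) * S.length +
          310 * (P.rice + 1) * (seedList P h S).sum := by
      have h6 : ∀ c : ℕ, (c * (P.expansion + 1) + 620 * (P.rice + 1)) * S.length =
        c * (P.expansion * S.length) + c * S.length + 620 * (P.rice + 1) * S.length := by
        intro c
        ring
      rw [add_mul] at h3
      rw [h6, h6]
      omega
    have h6 := add_le_add (Nat.cast_le (α := ℕ∞).mpr h5) (le_refl (b + r))
    calc _ = _ := ?_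
      _ ≤ _ := h6
      _ = _ := by rw [← add_assoc]
    push_cast
    ring
  refine (ENat.toENNReal_mono h4).trans ?_
  rw [ENat.toENNReal_add, ENat.toENNReal_add, ENat.toENNReal_coe]
  refine add_le_add (mul_add_work_le (seedList_sum_le P h S) (sum_buildBucket_cost_le P h S) ?_ ?_)
    le_rfl
  · exact Nat.mul_le_mul_right _ (by unfold Params.workBound; nlinarith)
  · unfold Params.workBound
    nlinarith

/-- The construction is an initial segment of the minimal one, so its bound is inherited. -/
theorem construct_cost_le (hne : S ≠ []) (R : Retrieval U) (ω : R.Ω) :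
    ((construct P R h ω S).cost : ℝ≥0∞) ≤ (P.workBound : ℝ≥0∞) *
      (S.length + work P h S) + (retrievalCost P h S R ω : ℝ≥0∞) := by
  refine le_trans (ENat.toENNReal_mono ?_) (constructMinimal_cost_le hne R ω)
  rw [constructMinimal_cost]
  change (constructAux P R h ω S).cost + 0 ≤ _
  exact add_le_add le_rfl zero_le

theorem constructMinimal_space_le (hne : S ≠ []) (R : Retrieval U) (ω : R.Ω) :
    ((constructMinimal P R h ω S).val.space : ℝ≥0∞) ≤ (P.workBound : ℝ≥0∞) *
      (S.length + work P h S) + (retrievalSpace P h S R ω : ℝ≥0∞) := by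
  have hN := List.length_pos_iff.mpr hne
  have h1 := constructAux_space_le (P := P) (h := h) hne R ω
  have h2 := eliasFano_space_le (univ := S.length)
    (targetList_pairwise S.length (usedCells P h S)) fun a ha => le_of_mem_targetList ha
  have h3 := holes_length_le (P := P) (h := h) hne
  have h4 : (constructMinimal P R h ω S).val.space ≤
      (9000 * (P.expansion + 1) + 820 * (P.rice + 1)) * S.length +
        410 * (P.rice + 1) * (seedList P h S).sum + retrievalSpace P h S R ω := by
    rw [constructMinimal_val]
    unfold MPHF.space
    dsimp only
    have h6 : ∀ c : ℕ, (c * (P.expansion + 1) + 820 * (P.rice + 1)) * S.length =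
        c * (P.expansion * S.length) + c * S.length + 820 * (P.rice + 1) * S.length := by
      intro c
      ring
    rw [add_mul] at h3
    rw [h6] at h1 ⊢
    omega
  refine (Nat.cast_le.mpr h4).trans ?_
  rw [Nat.cast_add (R := ℝ≥0∞)]
  refine add_le_add ?_ le_rfl
  have h5 := mul_add_work_le (b := 0) (n₂ := 0)
    (n₀ := (9000 * (P.expansion + 1) + 820 * (P.rice + 1)) * S.length)
    (n₁ := 410 * (P.rice + 1)) (N := S.length) (K := P.workBound) (seedList_sum_le P h S) zero_le
    (Nat.mul_le_mul_right _ (by unfold Params.workBound; nlinarith))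
    (by unfold Params.workBound; nlinarith)
  rwa [add_zero] at h5

theorem construct_space_le (hne : S ≠ []) (R : Retrieval U) (ω : R.Ω) :
    ((construct P R h ω S).val.space : ℝ≥0∞) ≤ (P.workBound : ℝ≥0∞) *
      (S.length + work P h S) + (retrievalSpace P h S R ω : ℝ≥0∞) := by
  refine le_trans (Nat.cast_le.mpr ?_) (constructMinimal_space_le hne R ω)
  rw [constructMinimal_val]
  exact Nat.le_add_right _ _

end SicHash

namespace SicHash

/-! ## Fully random hash functions -/

variable {U : Type}

instance (U : Type) : IsProbabilityMeasure (hashMeasure U) := by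
  unfold hashMeasure
  infer_instance

theorem uniform_singleton {m : ℕ} (v : Fin (m + 1)) :
    (PMF.uniformOfFintype (Fin (m + 1))).toMeasure {v} = ((m : ℝ≥0∞) + 1)⁻¹ := by
  rw [PMF.toMeasure_uniformOfFintype_apply _ (measurableSet_singleton v)]
  simp

/-- Finitely many hash values with the same range are jointly uniformly distributed. -/
theorem hashMeasure_uniform {ι : Type} [Fintype ι] (x : ι → U) (name : ι → HashName) (m : ℕ)
    (hinj : Function.Injective fun j => (x j, name j)) (V : Finset (ι → Fin (m + 1))) :
    hashMeasure U {h | (fun j => h (x j, name j, m)) ∈ V} =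
      V.card * (((m : ℝ≥0∞) + 1)⁻¹) ^ Fintype.card ι := by
  have hinj' : Function.Injective fun j => ((x j, name j, m) : U × HashName × ℕ) := by
    intro i j hij
    simp only [Prod.mk.injEq] at hij
    exact hinj (Prod.ext hij.1 hij.2.1)
  have h1 : (hashMeasure U).map (fun h j => h (x j, name j, m)) =
      Measure.infinitePi fun _ : ι => (PMF.uniformOfFintype (Fin (m + 1))).toMeasure :=
    Measure.map_infinitePi_infinitePi_of_inj hinj'
  have h2 : Measurable fun (h : Hashes U) (j : ι) => h (x j, name j, m) := by fun_prop
  have h3 : {h : Hashes U | (fun j => h (x j, name j, m)) ∈ V} =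
    (fun (h : Hashes U) (j : ι) => h (x j, name j, m)) ⁻¹' (V : Set (ι → Fin (m + 1))) := rfl
  rw [h3, ← Measure.map_apply h2 V.measurableSet, h1, ← sum_measure_singleton]
  simp only [Measure.infinitePi_singleton_of_fintype, uniform_singleton]
  simp

/-- The event `A` depends only on the hash values with indices in `J`. -/
def DependsOnValues (J : Finset (U × HashName × ℕ)) (A : Set (Hashes U)) : Prop :=
  ∀ h h' : Hashes U, (∀ i ∈ J, h i = h' i) → h ∈ A → h' ∈ A

theorem DependsOnValues.eq_preimage {J : Finset (U × HashName × ℕ)} {A : Set (Hashes U)}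
    (hA : DependsOnValues J A) : ∃ V : Set (∀ i : J, Fin (i.1.2.2 + 1)),
      A = (fun (h : Hashes U) (i : J) => h i) ⁻¹' V := by
  refine ⟨(fun (h : Hashes U) (i : J) => h i) '' A, ?_⟩
  ext h
  refine ⟨fun hh => ⟨h, hh, rfl⟩, ?_⟩
  rintro ⟨h', hh', heq⟩
  exact hA h' h (fun i hi => congrFun heq ⟨i, hi⟩) hh'

/-- Such an event is a preimage under finitely many coordinates with finite ranges, so every base is
measurable, whatever the universe. -/
theorem DependsOnValues.measurableSet {J : Finset (U × HashName × ℕ)} {A : Set (Hashes U)}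
    (hA : DependsOnValues J A) : MeasurableSet A := by
  obtain ⟨V, rfl⟩ := hA.eq_preimage
  exact (by fun_prop : Measurable fun (h : Hashes U) (i : J) => h i) V.toFinite.measurableSet

theorem DependsOnValues.mono {J J' : Finset (U × HashName × ℕ)} {A : Set (Hashes U)}
    (hA : DependsOnValues J A) (hJ : J ⊆ J') : DependsOnValues J' A :=
  fun h h' hh => hA h h' fun i hi => hh i (hJ hi)

theorem DependsOnValues.inter {J : Finset (U × HashName × ℕ)} {A A' : Set (Hashes U)}
    (hA : DependsOnValues J A) (hA' : DependsOnValues J A') : DependsOnValues J (A ∩ A') :=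
  fun h h' hh hmem => ⟨hA h h' hh hmem.1, hA' h h' hh hmem.2⟩

theorem DependsOnValues.compl {J : Finset (U × HashName × ℕ)} {A : Set (Hashes U)}
    (hA : DependsOnValues J A) : DependsOnValues J Aᶜ :=
  fun h h' hh hmem hmem' => hmem (hA h' h (fun i hi => (hh i hi).symm) hmem')

theorem DependsOnValues.measure_inter {J J' : Finset (U × HashName × ℕ)} {A A' : Set (Hashes U)}
    (hA : DependsOnValues J A) (hA' : DependsOnValues J' A') (hJ : Disjoint J J') :
    hashMeasure U (A ∩ A') = hashMeasure U A * hashMeasure U A' := by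
  obtain ⟨V, rfl⟩ := hA.eq_preimage
  obtain ⟨V', rfl⟩ := hA'.eq_preimage
  have h1 : ProbabilityTheory.iIndepFun (fun (i : U × HashName × ℕ) (h : Hashes U) => h i)
      (hashMeasure U) :=
    ProbabilityTheory.iIndepFun_infinitePi (X := fun _ v => v) fun _ => measurable_id
  have h2 := h1.indepFun_finset J J' hJ fun i => by fun_prop
  exact h2.measure_inter_preimage_eq_mul _ _ V.toFinite.measurableSet V'.toFinite.measurableSet

/-! ## The probability of distinct first candidates -/

/-- The term nⁿ / n! of the exponential series is at most eⁿ. -/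
theorem pow_self_le (n : ℕ) : n ^ n ≤ 3 ^ n * n.factorial := by
  have h1 := Real.pow_div_factorial_le_exp (x := n) (by positivity) n
  have h2 : Real.exp n ≤ 3 ^ n := by
    rw [← Real.exp_one_pow]
    exact pow_le_pow_left₀ (Real.exp_pos _).le Real.exp_one_lt_three.le n
  rw [div_le_iff₀ (by positivity)] at h1
  have h3 : (n : ℝ) ^ n ≤ 3 ^ n * n.factorial :=
    h1.trans (mul_le_mul_of_nonneg_right h2 (by positivity))
  exact_mod_cast h3

/-- Extra cells only help: the factors satisfy m(n - i) ≤ n(m - i) for n ≤ m, which reduces the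
claim to m = n. -/
theorem pow_le_descFactorial {n m : ℕ} (hn : n ≤ m) : m ^ n ≤ 3 ^ n * m.descFactorial n := by
  have h1 : m ^ n * n.factorial ≤ n ^ n * m.descFactorial n := by
    rw [← Nat.descFactorial_self, Nat.descFactorial_eq_prod_range, Nat.descFactorial_eq_prod_range]
    have hc : ∀ c : ℕ, c ^ n = ∏ _i ∈ Finset.range n, c := by simp
    rw [hc m, hc n, ← Finset.prod_mul_distrib, ← Finset.prod_mul_distrib]
    refine Finset.prod_le_prod' fun i hi => ?_
    rw [Nat.mul_sub, Nat.mul_sub, mul_comm n m]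
    exact Nat.sub_le_sub_left (Nat.mul_le_mul_right i hn) _
  have h2 := Nat.mul_le_mul_right (m.descFactorial n) (pow_self_le n)
  refine Nat.le_of_mul_le_mul_right ?_ n.factorial_pos
  calc m ^ n * n.factorial ≤ n ^ n * m.descFactorial n := h1
    _ ≤ 3 ^ n * n.factorial * m.descFactorial n := h2
    _ = _ := by ring

/-- Among the mⁿ equally likely choices, the injective ones are counted by the descending factorial.
-/
theorem le_measure_distinctFirst {X : List U} (hX : X.Nodup) {m : ℕ} (hm : X.length ≤ m) (s : ℕ) :
    ((3 : ℝ≥0∞) ^ X.length)⁻¹ ≤ hashMeasure U {h | DistinctFirst h X m s} := by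
  classical
  cases m with
  | zero =>
    have : X = [] := List.length_eq_zero_iff.mp (by omega)
    subst this
    simp [DistinctFirst]
  | succ m =>
    have h1 : {h : Hashes U | DistinctFirst h X (m + 1) s} =
        {h : Hashes U | (fun j : Fin X.length => h (X[j], .cell s 0, m)) ∈
          Finset.univ.filter fun v : Fin X.length → Fin (m + 1) => Function.Injective v} := by
      ext h
      simp only [DistinctFirst, Set.mem_ofPred_eq, Finset.mem_filter, Finset.mem_univ, true_and]
      rw [List.nodup_iff_injective_get]
      constructor
      · intro hinj i j hij
        have := @hinj ⟨i, by simp⟩ ⟨j, by simp⟩ (by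
          simpa [hashValue] using congrArg Fin.val hij)
        simpa [Fin.ext_iff] using this
      · intro hinj i j hij
        have := @hinj ⟨i, by simpa using i.2⟩ ⟨j, by simpa using j.2⟩ (by
          rw [List.get_eq_getElem, List.get_eq_getElem, List.getElem_map, List.getElem_map] at hij
          exact Fin.ext hij)
        simpa [Fin.ext_iff] using this
    have hcard : (Finset.univ.filter fun v : Fin X.length → Fin (m + 1) =>
        Function.Injective v).card = (m + 1).descFactorial X.length := by
      rw [← Fintype.card_subtype, Fintype.card_congr
        (Equiv.subtypeInjectiveEquivEmbedding (Fin X.length) (Fin (m + 1))),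
        Fintype.card_embedding_eq, Fintype.card_fin, Fintype.card_fin]
    rw [h1, hashMeasure_uniform (fun j : Fin X.length => X[j]) (fun _ => .cell s 0) m
      (fun i j hij => by
        have : X[i] = X[j] := (Prod.mk.inj hij).1
        exact Fin.ext ((List.Nodup.getElem_inj_iff hX).mp this)), hcard, Fintype.card_fin]
    have h2 := pow_le_descFactorial hm
    have h3 : ((m : ℝ≥0∞) + 1) ^ X.length ≤ 3 ^ X.length * ((m + 1).descFactorial X.length : ℕ) := by
      exact_mod_cast h2
    have h4 : ((m : ℝ≥0∞) + 1) ^ X.length ≠ ⊤ := by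
      exact ENNReal.pow_ne_top (by finiteness)
    have h5 : ((m : ℝ≥0∞) + 1) ^ X.length ≠ 0 := by positivity
    rw [ENNReal.inv_le_iff_le_mul (by simp) (by simp), ← ENNReal.inv_pow, ← mul_assoc,
      ← div_eq_mul_inv, ENNReal.le_div_iff_mul_le (Or.inl h5) (Or.inl h4), one_mul]
    exact h3

end SicHash

namespace SicHash

/-! ## The expected number of attempts -/

variable {U : Type}

theorem hashValue_congr {h h' : Hashes U} {x : U} {name : HashName} {m : ℕ}
    (hh : h (x, name, m - 1) = h' (x, name, m - 1)) :
    hashValue h x name m = hashValue h' x name m := by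
  cases m with
  | zero => rfl
  | succ m => exact congrArg Fin.val hh

open Classical in
/-- The indices of the hash values with a given name and range. -/
noncomputable def valueIndices (X : List U) (name : HashName) (m : ℕ) :
    Finset (U × HashName × ℕ) :=
  X.toFinset.image fun x => (x, name, m - 1)

theorem mem_valueIndices {X : List U} {name : HashName} {m : ℕ} {x : U} (hx : x ∈ X) :
    (x, name, m - 1) ∈ valueIndices X name m := by
  classical
  exact Finset.mem_image_of_mem (fun x => (x, name, m - 1)) (List.mem_toFinset.mpr hx)

theorem name_of_mem_valueIndices {X : List U} {name : HashName} {m : ℕ} {i : U × HashName × ℕ}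
    (hi : i ∈ valueIndices X name m) : i.2.1 = name := by
  classical
  obtain ⟨x, -, rfl⟩ := Finset.mem_image.mp hi
  rfl

theorem dependsOn_distinctFirst (X : List U) (m s : ℕ) :
    DependsOnValues (valueIndices X (.cell s 0) m) {h | DistinctFirst h X m s} := by
  intro h h' hh hd
  have : (X.map fun x => hashValue h x (.cell s 0) m) =
      X.map fun x => hashValue h' x (.cell s 0) m :=
    List.map_congr_left fun x hx => hashValue_congr (hh _ (mem_valueIndices hx))
  simp only [Set.mem_ofPred_eq, DistinctFirst] at hd ⊢
  rwa [← this]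

theorem dependsOn_bucketList (B : ℕ) (S : List U) (k : ℕ) (A : List U) :
    DependsOnValues (valueIndices S .bucket B) {h | bucketList h B S k = A} := by
  intro h h' hh hd
  have : bucketList h B S k = bucketList h' B S k :=
    List.filter_congr fun x hx => by
      unfold bucketOf
      rw [hashValue_congr (hh _ (mem_valueIndices hx))]
  simp only [Set.mem_ofPred_eq] at hd ⊢
  rwa [← this]

/-- The attempts before number `s` do not have distinct first candidates. -/
def NoDistinctBefore (X : List U) (m s : ℕ) : Set (Hashes U) :=
  {h | ∀ s' < s, ¬ DistinctFirst h X m s'}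

theorem noDistinctBefore_succ (X : List U) (m s : ℕ) : NoDistinctBefore X m (s + 1) =
    NoDistinctBefore X m s ∩ {h | DistinctFirst h X m s}ᶜ := by
  ext h
  simp only [NoDistinctBefore, Set.mem_ofPred_eq, Set.mem_inter_iff, Set.mem_compl_iff,
    Nat.lt_succ_iff_lt_or_eq]
  constructor
  · exact fun hh => ⟨fun s' hs' => hh s' (Or.inl hs'), hh s (Or.inr rfl)⟩
  · rintro ⟨h1, h2⟩ s' (hs' | rfl)
    · exact h1 s' hs'
    · exact h2

open Classical in
theorem exists_dependsOn_noDistinctBefore (X : List U) (m s : ℕ) :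
    ∃ J : Finset (U × HashName × ℕ), (∀ i ∈ J, ∃ s' < s, i.2.1 = .cell s' 0) ∧
      DependsOnValues J (NoDistinctBefore X m s) := by
  refine ⟨(Finset.range s).biUnion fun s' => valueIndices X (.cell s' 0) m, ?_, ?_⟩
  · intro i hi
    obtain ⟨s', hs', hi⟩ := Finset.mem_biUnion.mp hi
    exact ⟨s', Finset.mem_range.mp hs', name_of_mem_valueIndices hi⟩
  · intro h h' hh hd s' hs' hd'
    refine hd s' hs' (dependsOn_distinctFirst X m s' h' h (fun i hi => (hh i ?_).symm) hd')
    exact Finset.mem_biUnion.mpr ⟨s', Finset.mem_range.mpr hs', hi⟩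

theorem trials_eq_tsum (h : Hashes U) (X : List U) (m : ℕ) :
    trials h X m = ∑' s, (NoDistinctBefore X m s).indicator 1 h := by
  classical
  unfold trials NoDistinctBefore
  congr 1
  funext s
  simp [Set.indicator_apply]

theorem measurableSet_noDistinctBefore (X : List U) (m s : ℕ) :
    MeasurableSet (NoDistinctBefore X m s) := by
  obtain ⟨J, -, hJ⟩ := exists_dependsOn_noDistinctBefore X m s
  exact hJ.measurableSet

theorem measurable_trials (X : List U) (m : ℕ) :
    Measurable fun h : Hashes U => trials h X m := by
  simp only [trials_eq_tsum]
  exact Measurable.tsum fun s =>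
    measurable_one.indicator (measurableSet_noDistinctBefore X m s)

/-- Failures decay geometrically, also within an event `G` that inspects no cell hash values. Each
seed is independent of the earlier ones and of `G`, so every step multiplies by the failure
probability. Taking for `G` the content of a bucket replaces conditioning. -/
theorem measure_noDistinctBefore_le {X : List U} (hX : X.Nodup) {m : ℕ} (hm : X.length ≤ m)
    {J : Finset (U × HashName × ℕ)} (hJ : ∀ i ∈ J, ∀ s j, i.2.1 ≠ .cell s j)
    {G : Set (Hashes U)} (hG : DependsOnValues J G) (s : ℕ) :
    hashMeasure U (G ∩ NoDistinctBefore X m s) ≤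
      hashMeasure U G * (1 - ((3 : ℝ≥0∞) ^ X.length)⁻¹) ^ s := by
  classical
  induction s with
  | zero => simpa using measure_mono Set.inter_subset_left
  | succ s ih =>
    obtain ⟨J', hJ', hd⟩ := exists_dependsOn_noDistinctBefore X m s
    have h1 : DependsOnValues (J ∪ J') (G ∩ NoDistinctBefore X m s) :=
      (hG.mono Finset.subset_union_left).inter (hd.mono Finset.subset_union_right)
    have hdisj : Disjoint (J ∪ J') (valueIndices X (.cell s 0) m) := by
      rw [Finset.disjoint_left]
      intro i hi hi'
      have hname := name_of_mem_valueIndices hi'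
      rcases Finset.mem_union.mp hi with hi | hi
      · exact hJ i hi _ _ hname
      · obtain ⟨s', hs', h2⟩ := hJ' i hi
        rw [hname] at h2
        cases h2
        omega
    rw [noDistinctBefore_succ, ← Set.inter_assoc,
      h1.measure_inter (dependsOn_distinctFirst X m s).compl hdisj, pow_succ, ← mul_assoc]
    refine mul_le_mul' ih ?_
    rw [prob_compl_eq_one_sub (dependsOn_distinctFirst X m s).measurableSet]
    exact tsub_le_tsub_left (le_measure_distinctFirst hX hm s) _

/-- The expectation is the sum of the tail probabilities, a geometric series with success
probability 3⁻ⁿ. -/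
theorem setLIntegral_trials_le {X : List U} (hX : X.Nodup) {m : ℕ} (hm : X.length ≤ m)
    {J : Finset (U × HashName × ℕ)} (hJ : ∀ i ∈ J, ∀ s j, i.2.1 ≠ .cell s j)
    {G : Set (Hashes U)} (hG : DependsOnValues J G) :
    ∫⁻ h in G, trials h X m ∂hashMeasure U ≤ 3 ^ X.length * hashMeasure U G := by
  simp only [trials_eq_tsum]
  rw [lintegral_tsum fun s =>
    (measurable_one.indicator (measurableSet_noDistinctBefore X m s)).aemeasurable]
  have h1 : ∀ s, ∫⁻ h in G, (NoDistinctBefore X m s).indicator 1 h ∂hashMeasure U ≤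
      hashMeasure U G * (1 - ((3 : ℝ≥0∞) ^ X.length)⁻¹) ^ s := by
    intro s
    rw [lintegral_indicator_one (measurableSet_noDistinctBefore X m s),
      Measure.restrict_apply (measurableSet_noDistinctBefore X m s), Set.inter_comm]
    exact measure_noDistinctBefore_le hX hm hJ hG s
  refine (ENNReal.tsum_le_tsum h1).trans ?_
  rw [ENNReal.tsum_mul_left, ENNReal.tsum_geometric, ENNReal.sub_sub_cancel (by simp), inv_inv,
    mul_comm]
  rw [ENNReal.inv_le_one]
  exact one_le_pow₀ (by norm_num)

/-! ### The exponential moment of the load of a bucket -/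

theorem lintegral_bucket_pow (S : List U) (hS : S.Nodup) {B k : ℕ} (hk : k < B) :
    ∫⁻ h, 6 ^ (bucketList h B S k).length ∂hashMeasure U =
      (((B : ℝ≥0∞) + 5) / B) ^ S.length := by
  classical
  obtain ⟨m, rfl⟩ := Nat.exists_eq_add_of_lt (Nat.zero_lt_of_lt hk)
  rw [zero_add] at hk ⊢
  -- Each object contributes an independent factor: 6 if it falls into bucket `k` and 1 otherwise,
  -- with mean (B + 5) / B.
  set φ : Fin (m + 1) → ℝ≥0∞ := fun v => if v.val = k then 6 else 1 with hφ
  have h1 : ∀ h : Hashes U, (6 : ℝ≥0∞) ^ (bucketList h (m + 1) S k).length =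
      ∏ x ∈ S.toFinset, φ (h (x, .bucket, m)) := by
    intro h
    rw [List.prod_toFinset _ hS]
    clear hS
    induction S with
    | nil => simp [bucketList]
    | cons x xs ih =>
      rw [List.map_cons, List.prod_cons, ← ih]
      have hb : bucketOf h (m + 1) x = (h (x, .bucket, m)).val := rfl
      by_cases hx : (h (x, .bucket, m)).val = k
      · simp only [bucketList, hφ, if_pos hx]
        rw [List.filter_cons_of_pos (by simpa [hb] using hx), List.length_cons, pow_succ']
      · simp only [bucketList, hφ, if_neg hx, one_mul]
        rw [List.filter_cons_of_neg (by simpa [hb] using hx)]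
  have hind : ProbabilityTheory.iIndepFun (fun (x : U) (h : Hashes U) => φ (h (x, .bucket, m)))
      (hashMeasure U) := by
    have h2 : ProbabilityTheory.iIndepFun (fun (i : U × HashName × ℕ) (h : Hashes U) => h i)
        (hashMeasure U) :=
      ProbabilityTheory.iIndepFun_infinitePi (X := fun _ v => v) fun _ => measurable_id
    have h3 := h2.precomp (g := fun x : U => ((x, .bucket, m) : U × HashName × ℕ))
      fun x y hxy => (Prod.mk.inj hxy).1
    exact h3.comp (fun _ => φ) fun _ => measurable_of_finite _
  have hφm : Measurable φ := measurable_of_finite _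
  simp only [h1]
  rw [ProbabilityTheory.lintegral_prod_eq_prod_lintegral_of_indepFun _ _ hind
    fun x => hφm.comp (measurable_pi_apply _)]
  have h4 : ∀ x : U, ∫⁻ h, φ (h (x, .bucket, m)) ∂hashMeasure U =
      (((m + 1 : ℕ) : ℝ≥0∞) + 5) / ((m + 1 : ℕ) : ℝ≥0∞) := by
    intro x
    have h5 := Measure.infinitePi_map_eval (fun i : U × HashName × ℕ =>
      (PMF.uniformOfFintype (Fin (i.2.2 + 1))).toMeasure) (x, .bucket, m)
    have h6 : ∫⁻ h, φ (h (x, .bucket, m)) ∂hashMeasure U =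
        ∫⁻ v, φ v ∂(PMF.uniformOfFintype (Fin (m + 1))).toMeasure := by
      have h7 : (hashMeasure U).map (fun h => h (x, .bucket, m)) =
        (PMF.uniformOfFintype (Fin (m + 1))).toMeasure := h5
      rw [← h7]
      exact (lintegral_map hφm (measurable_pi_apply ((x, .bucket, m) : U × HashName × ℕ))).symm
    rw [h6, lintegral_fintype]
    simp only [uniform_singleton]
    rw [← Finset.sum_mul, div_eq_mul_inv]
    have h8 : ∑ v, φ v = ((m + 1 : ℕ) : ℝ≥0∞) + 5 := by
      have h9 : ∀ v, φ v = 1 + if v = ⟨k, hk⟩ then 5 else 0 := by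
        intro v
        simp only [hφ, Fin.ext_iff]
        split_ifs
        · norm_num
        · simp
      simp only [h9, Finset.sum_add_distrib]
      simp
    rw [h8]
    push_cast
    rfl
  rw [Finset.prod_congr rfl fun x _ => h4 x, Finset.prod_const, List.toFinset_card_of_nodup hS]

theorem add_five_pow_le (B : ℕ) : (B + 5) ^ B ≤ 243 * B ^ B := by
  rcases Nat.eq_zero_or_pos B with rfl | hB
  · norm_num
  · have hB' : (0 : ℝ) < B := by exact_mod_cast hB
    -- From 1 + x ≤ eˣ the power is at most e⁵ < 3⁵ = 243.
    have h1 : ((B : ℝ) + 5) / B ≤ Real.exp (5 / B) := by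
      rw [add_div, div_self hB'.ne', add_comm]
      exact Real.add_one_le_exp _
    have h2 : (((B : ℝ) + 5) / B) ^ B ≤ 243 := by
      calc (((B : ℝ) + 5) / B) ^ B ≤ Real.exp (5 / B) ^ B :=
            pow_le_pow_left₀ (by positivity) h1 _
        _ = Real.exp 1 ^ 5 := by
            rw [← Real.exp_nat_mul, ← Real.exp_nat_mul]
            congr 1
            push_cast
            field_simp
        _ ≤ 3 ^ 5 := pow_le_pow_left₀ (Real.exp_pos _).le Real.exp_one_lt_three.le 5
        _ = 243 := by norm_num
    rw [div_pow, div_le_iff₀ (by positivity)] at h2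
    exact_mod_cast h2

theorem ratio_pow_le {b B N : ℕ} (hB : 0 < B) (hN : N ≤ b * B) :
    (((B : ℝ≥0∞) + 5) / B) ^ N ≤ 243 ^ b := by
  have hB0 : (B : ℝ≥0∞) ≠ 0 := by exact_mod_cast hB.ne'
  have h1 : 1 ≤ ((B : ℝ≥0∞) + 5) / B := by
    rw [ENNReal.le_div_iff_mul_le (Or.inl hB0) (Or.inl (by finiteness)), one_mul]
    exact le_self_add
  have h2 : (((B : ℝ≥0∞) + 5) / B) ^ B ≤ 243 := by
    rw [div_eq_mul_inv, mul_pow, ← ENNReal.inv_pow, ← div_eq_mul_inv,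
      ENNReal.div_le_iff (pow_ne_zero _ hB0) (by finiteness)]
    exact_mod_cast add_five_pow_le B
  calc (((B : ℝ≥0∞) + 5) / B) ^ N ≤ (((B : ℝ≥0∞) + 5) / B) ^ (B * b) :=
        pow_le_pow_right₀ h1 (by rwa [mul_comm])
    _ = ((((B : ℝ≥0∞) + 5) / B) ^ B) ^ b := pow_mul _ _ _
    _ ≤ 243 ^ b := pow_le_pow_left' h2 b

-- The content of a bucket is one of finitely many sublists of `S`, so a quantity that depends on it
-- splits into a finite sum over fixed contents.
open Classical in
theorem eq_sum_indicator_bucket (B : ℕ) (S : List U) (k : ℕ) (f : List U → Hashes U → ℝ≥0∞)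
    (h : Hashes U) : f (bucketList h B S k) h =
      ∑ A ∈ S.sublists.toFinset, {h | bucketList h B S k = A}.indicator (f A) h := by
  rw [Finset.sum_eq_single (bucketList h B S k)]
  · exact (Set.indicator_of_mem (s := {h' | bucketList h' B S k = bucketList h B S k}) rfl _).symm
  · intro A _ hA
    exact Set.indicator_of_notMem (s := {h' | bucketList h' B S k = A})
      (fun hmem => hA (Eq.symm hmem)) _
  · intro hA
    exact absurd (List.mem_toFinset.mpr (List.mem_sublists.mpr List.filter_sublist)) hA

/-- The contribution of a bucket to `work`. -/
noncomputable def bucketWork (P : Params) (B : ℕ) (S : List U) (k : ℕ) (h : Hashes U) : ℝ≥0∞ :=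
  2 ^ (bucketList h B S k).length *
    trials h (bucketList h B S k) (numCells P.α (bucketList h B S k).length)

theorem measurable_bucketWork (P : Params) (B : ℕ) (S : List U) (k : ℕ) :
    Measurable (bucketWork P B S k) := by
  classical
  have h1 : bucketWork P B S k = fun h => ∑ A ∈ S.sublists.toFinset,
      {h | bucketList h B S k = A}.indicator
        (fun h => 2 ^ A.length * trials h A (numCells P.α A.length)) h :=
    funext fun h => eq_sum_indicator_bucket B S k
      (fun A h => 2 ^ A.length * trials h A (numCells P.α A.length)) h
  rw [h1]
  exact Finset.measurable_sum _ fun A _ =>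
    ((measurable_trials _ _).const_mul _).indicator (dependsOn_bucketList B S k A).measurableSet

/-- For a fixed content of size n, the weight 2ⁿ times at most 3ⁿ expected trials is 6ⁿ; summing
over contents gives the exponential moment. -/
theorem lintegral_bucketWork_le (P : Params) {B : ℕ} {S : List U} (hS : S.Nodup) {k : ℕ}
    (hk : k < B) (hN : S.length ≤ P.b * B) :
    ∫⁻ h, bucketWork P B S k h ∂hashMeasure U ≤ 243 ^ P.b := by
  classical
  refine le_trans ?_ (ratio_pow_le (Nat.zero_lt_of_lt hk) hN)
  rw [← lintegral_bucket_pow S hS hk]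
  have h1 := fun h => eq_sum_indicator_bucket B S k
    (fun A h => 2 ^ A.length * trials h A (numCells P.α A.length)) h
  have h2 := fun h : Hashes U => eq_sum_indicator_bucket B S k (fun A _ => 6 ^ A.length) h
  simp only [bucketWork]
  rw [lintegral_congr h1, lintegral_congr h2, lintegral_finsetSum, lintegral_finsetSum]
  · refine Finset.sum_le_sum fun A hA => ?_
    have hA' : A.Nodup := hS.sublist (List.mem_sublists.mp (List.mem_toFinset.mp hA))
    have hG := dependsOn_bucketList B S k A
    rw [lintegral_indicator hG.measurableSet, lintegral_indicator hG.measurableSet,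
      lintegral_const_mul _ (measurable_trials _ _), setLIntegral_const]
    have h3 := setLIntegral_trials_le hA' (le_numCells P.α_pos P.α_le A.length)
      (fun i hi s j => by rw [name_of_mem_valueIndices hi]; exact fun h => by cases h) hG
    calc _ ≤ (2 : ℝ≥0∞) ^ A.length * (3 ^ A.length *
          hashMeasure U {h | bucketList h B S k = A}) := mul_le_mul_right h3 _
      _ = _ := by
        rw [← mul_assoc, ← mul_pow]
        norm_num
  · exact fun A _ => measurable_const.indicator (dependsOn_bucketList B S k A).measurableSet
  · exact fun A _ =>
      ((measurable_trials _ _).const_mul _).indicator (dependsOn_bucketList B S k A).measurableSet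

theorem work_eq (P : Params) (h : Hashes U) (S : List U) : work P h S =
    ∑ k ∈ Finset.range (P.numBuckets S.length), bucketWork P (P.numBuckets S.length) S k h := rfl

theorem measurable_work (P : Params) (S : List U) : Measurable fun h => work P h S := by
  simp only [work_eq]
  exact Finset.measurable_sum _ fun k _ => measurable_bucketWork _ _ _ _

theorem lintegral_work_le (P : Params) {S : List U} (hS : S.Nodup) :
    ∫⁻ h, work P h S ∂hashMeasure U ≤ 243 ^ P.b * S.length := by
  simp only [work_eq]
  rw [lintegral_finsetSum _ fun k _ => measurable_bucketWork _ _ _ _]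
  refine (Finset.sum_le_card_nsmul _ _ _ fun k hk => lintegral_bucketWork_le P hS
    (Finset.mem_range.mp hk) (P.le_mul_numBuckets _)).trans ?_
  rw [Finset.card_range, nsmul_eq_mul, mul_comm]
  exact mul_le_mul_right (by exact_mod_cast P.numBuckets_le _) _

/-- A quantity with finite expectation is almost surely finite, but an unplaceable bucket would make
`work` infinite. -/
theorem ae_allPlaceable (P : Params) {S : List U} (hS : S.Nodup) :
    ∀ᵐ h ∂hashMeasure U, AllPlaceable P h S := by
  have h1 := ae_lt_top (measurable_work P S)
    (ne_top_of_le_ne_top (by finiteness) (lintegral_work_le P hS))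
  filter_upwards [h1] with h hh k hk
  by_contra hp
  have h2 := trials_eq_top hp
  have h3 : work P h S = ⊤ := by
    rw [work_eq, ENNReal.sum_eq_top]
    refine ⟨k, Finset.mem_range.mpr hk, ?_⟩
    have : bucketWork P (P.numBuckets S.length) S k h = 2 ^ (bucketObjs P h S k).length *
      trials h (bucketObjs P h S k) (numCells P.α (bucketObjs P h S k).length) := rfl
    rw [this, h2, ENNReal.mul_top]
    positivity
  exact hh.ne h3

end SicHash

namespace SicHash

/-! ## The construction inspects finitely many hash values -/

theorem expand_congr {cand cand' : ℕ → ℕ} (j : ℕ) {is : List ℕ}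
    (hc : ∀ i ∈ is, cand i = cand' i) (pred : Pred) :
    expand cand j is pred = expand cand' j is pred := by
  induction is generalizing pred with
  | nil => rfl
  | cons i is ih =>
    have ih' := ih fun i' hi' => hc i' (List.mem_cons_of_mem _ hi')
    simp only [expand, hc i List.mem_cons_self, ih']

theorem bfs_congr {deg : ℕ → ℕ} {cand cand' : ℕ → ℕ → ℕ}
    (hc : ∀ j, ∀ i < deg j, cand j i = cand' j i) (T : CuckooTable) (k : ℕ) (queue : List ℕ)
    (pred : Pred) : bfs deg cand T k queue pred = bfs deg cand' T k queue pred := by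
  induction k generalizing queue pred with
  | zero => rfl
  | succ k ih =>
    cases queue with
    | nil => rfl
    | cons c queue =>
      simp only [bfs]
      cases T.occ c with
      | none => rfl
      | some j =>
        simp only [ih, expand_congr j (fun i hi => hc j i (List.mem_range.mp hi))]

theorem insert_congr {deg : ℕ → ℕ} {cand cand' : ℕ → ℕ → ℕ}
    (hc : ∀ j, ∀ i < deg j, cand j i = cand' j i) (m : ℕ) (T : CuckooTable) (j : ℕ) :
    insert m deg cand T j = insert m deg cand' T j := by
  simp only [insert, bfs_congr hc, expand_congr j (fun i hi => hc j i (List.mem_range.mp hi))]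

theorem insertAll_congr {deg : ℕ → ℕ} {cand cand' : ℕ → ℕ → ℕ}
    (hc : ∀ j, ∀ i < deg j, cand j i = cand' j i) (m : ℕ) (l : List ℕ) (T : CuckooTable) :
    insertAll m deg cand l T = insertAll m deg cand' l T := by
  induction l generalizing T with
  | nil => rfl
  | cons j js ih => simp only [insertAll, insert_congr hc, ih]

/-- The search never looks beyond a seed that is known to succeed. -/
theorem firstSuccess_congr {α : Type} (dflt : α) {f g : ℕ → Timed (Option α)} {s : ℕ}
    (hs : (f s).val.isSome) (hfg : ∀ s' ≤ s, f s' = g s') :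
    firstSuccess dflt f = firstSuccess dflt g := by
  classical
  have hf : ∃ s, (f s).val.isSome := ⟨s, hs⟩
  have hg : ∃ s, (g s).val.isSome := ⟨s, by rwa [← hfg s le_rfl]⟩
  have hle : Nat.find hf ≤ s := Nat.find_le hs
  have heq : Nat.find hg = Nat.find hf := by
    rw [Nat.find_eq_iff]
    refine ⟨by rw [← hfg _ hle]; exact Nat.find_spec hf, fun n hn => ?_⟩
    rw [← hfg _ (hn.le.trans hle)]
    exact Nat.find_min hf hn
  unfold firstSuccess
  rw [dif_pos hf, dif_pos hg, heq, hfg _ hle]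
  congr 1
  refine Finset.sum_congr rfl fun s' hs' => ?_
  rw [hfg s' ((Nat.lt_succ_iff.mp (Finset.mem_range.mp hs')).trans hle)]

section Congr

variable {U : Type} {h h' : Hashes U}

theorem tryTable_congr {X : List U} {m : ℕ} {deg : ℕ → ℕ} {s : ℕ}
    (hh : ∀ x ∈ X, ∀ i, (∃ j, i < deg j) →
      hashValue h x (.cell s i) m = hashValue h' x (.cell s i) m) :
    tryTable h X m deg s = tryTable h' X m deg s := by
  unfold tryTable
  congr 1
  funext _
  refine insertAll_congr (fun j i hi => ?_) _ _ _
  cases hx : X[j]? with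
  | none => rfl
  | some x => exact hh x (List.mem_of_getElem? hx) i ⟨j, hi⟩

theorem classesOf_congr (P : Params) {X : List U} (hh : ∀ x ∈ X,
    hashValue h x .cls (P.p₁.den * P.p₂.den) = hashValue h' x .cls (P.p₁.den * P.p₂.den)) :
    classesOf P h X = classesOf P h' X := by
  induction X with
  | nil => rfl
  | cons x xs ih =>
    simp only [classesOf, ih fun y hy => hh y (List.mem_cons_of_mem _ hy), classOf, hash,
      hh x List.mem_cons_self]

theorem buildBucket_congr (P : Params) {X : List U} {K s : ℕ}
    (hq : P.p₁.den * P.p₂.den ≤ K) (hm : numCells P.α X.length ≤ K) (h8 : 8 ≤ K) (hs : s < K)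
    (hsome : (attempt P h X s).val.isSome)
    (hcls : ∀ x ∈ X, ∀ m ≤ K, hashValue h x .cls m = hashValue h' x .cls m)
    (hcell : ∀ x ∈ X, ∀ s < K, ∀ i < K, ∀ m ≤ K,
      hashValue h x (.cell s i) m = hashValue h' x (.cell s i) m) :
    buildBucket P h X = buildBucket P h' X := by
  have h1 : classesOf P h X = classesOf P h' X := classesOf_congr P fun x hx => hcls x hx _ hq
  have hdeg : bucketDeg P h X = bucketDeg P h' X := by
    unfold bucketDeg
    rw [← classesOf_val, ← classesOf_val, h1]
  have h2 : ∀ s' ≤ s, attempt P h X s' = attempt P h' X s' := by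
    intro s' hs'
    unfold attempt
    rw [hdeg]
    refine tryTable_congr fun x hx i ⟨j, hi⟩ => ?_
    exact hcell x hx s' (by omega) i (hi.trans_le ((bucketDeg_le P h' X j).trans h8)) _ hm
  have h3 : placement P h X = placement P h' X := firstSuccess_congr _ hsome h2
  have h4 : ∀ h : Hashes U, firstSuccess CuckooTable.empty
      (tryTable h X (numCells P.α X.length) fun j => 2 ^ (classesOf P h X).val.getD j 3) =
      placement P h X := by
    intro h
    rw [classesOf_val]
    rfl
  unfold buildBucket
  simp only [bind, Timed.bind]
  rw [h4, h4, h1, h3]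

/-- The two realizations lead to the same buckets, with the same data. -/
structure SameBuckets (P : Params) (S : List U) (h h' : Hashes U) : Prop where
  objs : bucketObjs P h S = bucketObjs P h' S
  build : ∀ k < P.numBuckets S.length,
    buildBucket P h (bucketObjs P h S k) = buildBucket P h' (bucketObjs P h S k)

namespace SameBuckets

variable {P : Params} {S : List U}

theorem data (hs : SameBuckets P S h h') {k : ℕ} (hk : k < P.numBuckets S.length) :
    bucketData P h S k = bucketData P h' S k := by
  rw [bucketData, bucketData, ← hs.objs, hs.build k hk]

theorem keyValues (hs : SameBuckets P S h h') (r : ℕ) :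
    keyValues P h S r = keyValues P h' S r := by
  have : allEntries P h S = allEntries P h' S :=
    List.flatMap_congr fun k hk => by rw [hs.data (List.mem_range.mp hk)]
  rw [SicHash.keyValues, SicHash.keyValues, this]

theorem constructAux (hs : SameBuckets P S h h') (R : Retrieval U) (ω : R.Ω) :
    constructAux P R h ω S = constructAux P R h' ω S := by
  have h1 : (partition h (P.numBuckets S.length) S).val =
      (partition h' (P.numBuckets S.length) S).val := by
    funext k
    rw [partition_val, partition_val]
    exact congrFun hs.objs k
  have h2 : partition h (P.numBuckets S.length) S = partition h' (P.numBuckets S.length) S := by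
    have h3 : (partition h (P.numBuckets S.length) S).cost =
        (partition h' (P.numBuckets S.length) S).cost := by rw [partition_cost, partition_cost]
    exact congrArg₂ Timed.mk h1 h3
  have h4 : ∀ l : List ℕ, (∀ k ∈ l, k < P.numBuckets S.length) →
      buildBuckets P h (partition h' (P.numBuckets S.length) S).val l =
        buildBuckets P h' (partition h' (P.numBuckets S.length) S).val l := by
    intro l hl
    induction l with
    | nil => rfl
    | cons k l ih =>
      have h5 : buildBucket P h ((partition h' (P.numBuckets S.length) S).val k) =
          buildBucket P h' ((partition h' (P.numBuckets S.length) S).val k) := by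
        rw [← h1, partition_val]
        exact hs.build k (hl k List.mem_cons_self)
      rw [buildBuckets, buildBuckets, h5, ih fun k' hk' => hl k' (List.mem_cons_of_mem _ hk')]
  unfold SicHash.constructAux
  simp only [bind, Timed.bind]
  rw [h2, h4 _ fun k hk => List.mem_range.mp hk]

theorem construct (hs : SameBuckets P S h h') (R : Retrieval U) (ω : R.Ω) :
    construct P R h ω S = construct P R h' ω S := by
  rw [SicHash.construct, SicHash.construct, hs.constructAux]

theorem constructMinimal (hs : SameBuckets P S h h') (R : Retrieval U) (ω : R.Ω) :
    constructMinimal P R h ω S = constructMinimal P R h' ω S := by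
  rw [SicHash.constructMinimal, SicHash.constructMinimal, hs.constructAux]

end SameBuckets

open Classical in
/-- The indices of the hash values of objects in `S` with parameters below `K`. -/
noncomputable def indicesBelow (S : List U) (K : ℕ) : Finset (U × HashName × ℕ) :=
  S.toFinset ×ˢ (({.bucket, .cls} ∪ (Finset.range K ×ˢ Finset.range K).image fun p =>
    HashName.cell p.1 p.2) ×ˢ Finset.range K)

/-- Once every bucket has a working seed, the search stops by then, and only finitely many hash
values are inspected. -/
theorem exists_sameBuckets {P : Params} {S : List U} (hp : AllPlaceable P h S) :
    ∃ K, ∀ h', (∀ i ∈ indicesBelow S K, h i = h' i) → SameBuckets P S h h' := by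
  classical
  have hch : ∀ k, ∃ s, k < P.numBuckets S.length →
      (attempt P h (bucketObjs P h S k) s).val.isSome := by
    intro k
    by_cases hk : k < P.numBuckets S.length
    · obtain ⟨s, hs⟩ := hp k hk
      exact ⟨s, fun _ => hs⟩
    · exact ⟨0, fun hk' => absurd hk' hk⟩
  choose seed hseed using hch
  set B := P.numBuckets S.length with hB
  -- `K` dominates all candidate indices, the bucket and class ranges, all table sizes and the
  -- chosen successful seeds.
  set K := 8 + B + P.p₁.den * P.p₂.den + ∑ k ∈ Finset.range B, (bucketCells P h S k + seed k) + 1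
    with hK
  refine ⟨K, fun h' hh => ?_⟩
  have hval : ∀ x ∈ S, ∀ name, (name = .bucket ∨ name = .cls ∨
      ∃ s < K, ∃ i < K, name = .cell s i) → ∀ m ≤ K, hashValue h x name m = hashValue h' x name m := by
    intro x hx name hname m hm
    refine hashValue_congr (hh _ ?_)
    simp only [indicesBelow, Finset.mem_product, List.mem_toFinset, Finset.mem_union,
      Finset.mem_insert, Finset.mem_singleton, Finset.mem_image, Finset.mem_range, Prod.exists]
    refine ⟨hx, ?_, by omega⟩
    rcases hname with rfl | rfl | ⟨s, hs, i, hi, rfl⟩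
    · exact Or.inl (Or.inl rfl)
    · exact Or.inl (Or.inr rfl)
    · exact Or.inr ⟨s, i, ⟨hs, hi⟩, rfl⟩
  constructor
  · funext k
    refine List.filter_congr fun x hx => ?_
    unfold bucketOf
    rw [hval x hx _ (Or.inl rfl) _ (by omega)]
  · intro k hk
    have hsub : ∀ x ∈ bucketObjs P h S k, x ∈ S := fun x hx => List.mem_of_mem_filter hx
    have hle := Finset.single_le_sum (f := fun k => bucketCells P h S k + seed k)
      (fun _ _ => Nat.zero_le _) (Finset.mem_range.mpr hk)
    have hle' : bucketCells P h S k + seed k ≤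
      ∑ k ∈ Finset.range B, (bucketCells P h S k + seed k) := hle
    have hc : bucketCells P h S k = numCells P.α (bucketObjs P h S k).length := rfl
    exact buildBucket_congr P (K := K) (by omega) (by omega) (by omega) (by omega) (hseed k hk)
      (fun x hx m hm => hval x (hsub x hx) _ (Or.inr (Or.inl rfl)) m hm)
      (fun x hx s hs i hi m hm => hval x (hsub x hx) _ (Or.inr (Or.inr ⟨s, hs, i, hi, rfl⟩)) m hm)

end Congr
end SicHash

namespace SicHash

/-! ## Measurability -/

section Measurability

variable {U : Type}

/-- There are only countably many cylinders over the finite index sets of `S`. On each cylinder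
where `f` is constant in the hash functions, `f` is a measurable function of ω alone, and these
cylinders cover almost everything. -/
theorem aemeasurable_of_locally_constant {Ω : Type} [MeasurableSpace Ω] (μ : Measure Ω) [SFinite μ]
    (S : List U) {f : Hashes U × Ω → ℝ≥0∞} (hω : ∀ h, Measurable fun ω => f (h, ω))
    (hloc : ∀ᵐ h ∂hashMeasure U, ∃ K, ∀ h', (∀ i ∈ indicesBelow S K, h i = h' i) →
      ∀ ω, f (h', ω) = f (h, ω)) :
    AEMeasurable f ((hashMeasure U).prod μ) := by
  classical
  let ι := Σ K, (i : indicesBelow S K) → Fin (i.1.2.2 + 1)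
  let C : ι → Set (Hashes U) := fun p => {h | ∀ i : indicesBelow S p.1, h i = p.2 i}
  have hC : ∀ p, MeasurableSet (C p) := fun p => by
    refine DependsOnValues.measurableSet (J := indicesBelow S p.1) fun h h' hh hmem i => ?_
    rw [← hh i i.2]
    exact hmem i
  -- Cylinders on which `f` still varies with the hash functions are discarded.
  let s : ι → Set (Hashes U × Ω) := fun p =>
    if ∃ h ∈ C p, ∀ h' ∈ C p, ∀ ω, f (h', ω) = f (h, ω) then C p ×ˢ Set.univ else ∅
  have hs : ∀ p, AEMeasurable f (((hashMeasure U).prod μ).restrict (s p)) := by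
    intro p
    by_cases hp : ∃ h ∈ C p, ∀ h' ∈ C p, ∀ ω, f (h', ω) = f (h, ω)
    · simp only [s, if_pos hp]
      obtain ⟨h, -, hh⟩ := hp
      refine ⟨fun q => f (h, q.2), (hω h).comp measurable_snd, ?_⟩
      filter_upwards [ae_restrict_mem ((hC p).prod MeasurableSet.univ)] with q hq
      exact hh q.1 hq.1 q.2
    · simp [s, if_neg hp]
  have hcover : ∀ᵐ q ∂(hashMeasure U).prod μ, q ∈ ⋃ p, s p := by
    have h1 : ∀ᵐ q ∂(hashMeasure U).prod μ, ∃ K, ∀ h', (∀ i ∈ indicesBelow S K, q.1 i = h' i) →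
      ∀ ω, f (h', ω) = f (q.1, ω) := Measure.quasiMeasurePreserving_fst.ae hloc
    filter_upwards [h1] with q ⟨K, hK⟩
    refine Set.mem_iUnion.mpr ⟨⟨K, fun i => q.1 i⟩, ?_⟩
    have hmem : q.1 ∈ C ⟨K, fun i => q.1 i⟩ := fun i => rfl
    have hex : ∃ h ∈ C ⟨K, fun i => q.1 i⟩, ∀ h' ∈ C ⟨K, fun i => q.1 i⟩, ∀ ω,
        f (h', ω) = f (h, ω) :=
      ⟨q.1, hmem, fun h' hh' => hK h' fun i hi => (hh' ⟨i, hi⟩).symm⟩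
    simp only [s, if_pos hex]
    exact ⟨hmem, Set.mem_univ _⟩
  have h2 := AEMeasurable.iUnion hs
  rwa [Measure.restrict_eq_self_of_ae_mem hcover] at h2

theorem aemeasurable_of_sameBuckets (P : Params) {Ω : Type} [MeasurableSpace Ω] (μ : Measure Ω)
    [SFinite μ] {S : List U} (hS : S.Nodup) {f : Hashes U × Ω → ℝ≥0∞}
    (hω : ∀ h, Measurable fun ω => f (h, ω))
    (hf : ∀ h h', SameBuckets P S h h' → ∀ ω, f (h', ω) = f (h, ω)) :
    AEMeasurable f ((hashMeasure U).prod μ) := by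
  refine aemeasurable_of_locally_constant μ S hω ?_
  filter_upwards [ae_allPlaceable P hS] with h hh
  obtain ⟨K, hK⟩ := exists_sameBuckets hh
  exact ⟨K, fun h' hh' => hf h h' (hK h' hh')⟩

variable {R : Retrieval U} {c : ℕ}

theorem measurable_constructAux_cost (hR : R.IsLinear c) (P : Params) (h : Hashes U) (S : List U) :
    Measurable fun ω => ((constructAux P R h ω S).cost : ℝ≥0∞) := by
  have h1 := fun r => hR.measurable_cost r (keyValues P h S r)
  simp only [constructAux_cost, ENat.toENNReal_add]
  fun_prop

theorem measurable_constructAux_space (hR : R.IsLinear c) (P : Params) (h : Hashes U)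
    (S : List U) : Measurable fun ω => ((constructAux P R h ω S).val.1.space : ℝ≥0∞) := by
  have h1 : ∀ r, Measurable fun ω =>
      ((R.build ω r (keyValues P h S r)).val.length : ℝ≥0∞) := fun r =>
    (measurable_of_countable fun n : ℕ => (n : ℝ≥0∞)).comp
      (hR.measurable_length r (keyValues P h S r))
  simp only [constructAux_val, PHF.space, Nat.cast_add]
  fun_prop

theorem aemeasurable_construct_cost (hR : R.IsLinear c) (P : Params) {S : List U} (hS : S.Nodup) :
    AEMeasurable (fun ω : Hashes U × R.Ω => ((construct P R ω.1 ω.2 S).cost : ℝ≥0∞))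
      ((hashMeasure U).prod R.μ) := by
  refine aemeasurable_of_sameBuckets P R.μ hS (fun h => ?_)
    fun h h' hs ω => by simp only [hs.construct]
  simp only [construct, Timed.bind_cost, Timed.pure_cost, add_zero]
  exact measurable_constructAux_cost hR P h S

theorem aemeasurable_construct_space (hR : R.IsLinear c) (P : Params) {S : List U} (hS : S.Nodup) :
    AEMeasurable (fun ω : Hashes U × R.Ω => ((construct P R ω.1 ω.2 S).val.space : ℝ≥0∞))
      ((hashMeasure U).prod R.μ) :=
  aemeasurable_of_sameBuckets P R.μ hS (fun h => measurable_constructAux_space hR P h S)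
    fun h h' hs ω => by simp only [hs.construct]

theorem aemeasurable_constructMinimal_cost (hR : R.IsLinear c) (P : Params) {S : List U}
    (hS : S.Nodup) :
    AEMeasurable (fun ω : Hashes U × R.Ω => ((constructMinimal P R ω.1 ω.2 S).cost : ℝ≥0∞))
      ((hashMeasure U).prod R.μ) := by
  refine aemeasurable_of_sameBuckets P R.μ hS (fun h => ?_)
    fun h h' hs ω => by simp only [hs.constructMinimal]
  simp only [constructMinimal_cost, ENat.toENNReal_add]
  exact (measurable_constructAux_cost hR P h S).add_const _

theorem aemeasurable_constructMinimal_space (hR : R.IsLinear c) (P : Params) {S : List U}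
    (hS : S.Nodup) :
    AEMeasurable (fun ω : Hashes U × R.Ω => ((constructMinimal P R ω.1 ω.2 S).val.space : ℝ≥0∞))
      ((hashMeasure U).prod R.μ) := by
  refine aemeasurable_of_sameBuckets P R.μ hS (fun h => ?_)
    fun h h' hs ω => by simp only [hs.constructMinimal]
  simp only [constructMinimal_val, MPHF.space, Nat.cast_add]
  exact (measurable_constructAux_space hR P h S).add_const _

end Measurability

/-! ## The retrieval data structures -/

section Retrieval

variable {U : Type} {R : Retrieval U} {c : ℕ} {P : Params} {S : List U}

/-- Key–value pairs that are admissible for the retrieval data structure, with keys in `S`. -/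
def Admissible (S : List U) (r : ℕ) (kv : List (U × ℕ)) : Prop :=
  (kv.map Prod.fst).Nodup ∧ (∀ e ∈ kv, e.2 < 2 ^ r) ∧ ∀ e ∈ kv, e.1 ∈ S

theorem countable_admissible (S : List U) (r : ℕ) : {kv | Admissible S r kv}.Countable := by
  have : Countable {x // x ∈ S} := S.finite_toSet.countable.to_subtype
  refine (Set.countable_range (fun l : List ({x // x ∈ S} × ℕ) =>
    l.map fun e => ((e.1 : U), e.2))).mono fun kv hkv => ?_
  refine ⟨kv.pmap (fun (e : U × ℕ) (he : e.1 ∈ S) => (⟨e.1, he⟩, e.2)) hkv.2.2, ?_⟩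
  simp [List.map_pmap]

theorem keyValues_admissible (hS : S.Nodup) (hne : S ≠ []) {h : Hashes U}
    (hp : AllPlaceable P h S) (r : ℕ) : Admissible S r (keyValues P h S r) := by
  obtain ⟨idx, hl⟩ := exists_layoutSpec P h hS hne hp
  refine ⟨hl.nodup_keys hS r, fun e he => ?_, fun e he => ((hl.mem_keyValues hne).mp he).1⟩
  obtain ⟨h1, h2, h3⟩ := (hl.mem_keyValues hne).mp he
  rw [h3, ← h2]
  exact hl.idx_lt e.1 h1

/-- Retrieval is guaranteed for each fixed key–value list only, whereas the list here depends on the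
hash functions. As countably many admissible lists exist, one null set of retrieval randomness
serves them all. -/
theorem ae_retrieval (hR : R.IsLinear c) (hS : S.Nodup) (hne : S ≠ []) :
    ∀ᵐ ω ∂(hashMeasure U).prod R.μ, AllPlaceable P ω.1 S ∧
      RetrievalCorrect R ω.2 (keyValues P ω.1 S) ∧ RetrievalFast R ω.2 (keyValues P ω.1 S) c := by
  have h1 : ∀ᵐ ω ∂(hashMeasure U).prod R.μ, AllPlaceable P ω.1 S :=
    Measure.quasiMeasurePreserving_fst.ae (ae_allPlaceable P hS)
  have h2 : ∀ᵐ ω ∂(R.μ), ∀ r, ∀ kv ∈ {kv | Admissible S r kv}, 1 ≤ r → r ≤ 3 →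
      (∀ e ∈ kv, (R.query ω r (R.build ω r kv).val e.1).val = e.2) ∧
        ∀ x, (R.query ω r (R.build ω r kv).val x).cost ≤ c := by
    rw [ae_all_iff]
    intro r
    rw [ae_ball_iff (countable_admissible S r)]
    intro kv hkv
    by_cases hr : 1 ≤ r ∧ r ≤ 3
    · filter_upwards [hR.correct r hr.1 hr.2 kv hkv.1 hkv.2.1,
        hR.query_time r hr.1 hr.2 kv hkv.1 hkv.2.1] with ω h3 h4
      exact fun _ _ => ⟨h3, h4⟩
    · exact Filter.Eventually.of_forall fun ω h3 h4 => absurd ⟨h3, h4⟩ hr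
  have h3 := Measure.quasiMeasurePreserving_snd (μ := hashMeasure U) |>.ae h2
  filter_upwards [h1, h3] with ω h4 h5
  exact ⟨h4, fun r h6 h7 => (h5 r _ (keyValues_admissible hS hne h4 r) h6 h7).1,
    fun r h6 h7 => (h5 r _ (keyValues_admissible hS hne h4 r) h6 h7).2⟩

/-- By independence the hash functions can be fixed first; the key–value lists are then
deterministic and the bound for a fixed list applies three times. -/
theorem lintegral_retrievalCost_le (hR : R.IsLinear c) (hS : S.Nodup) (hne : S ≠ []) :
    ∫⁻ ω, (retrievalCost P ω.1 S R ω.2 : ℝ≥0∞) ∂(hashMeasure U).prod R.μ ≤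
      3 * (c * (S.length + 1)) := by
  have hm : ∀ h r, Measurable fun ω => ((R.build ω r (keyValues P h S r)).cost : ℝ≥0∞) :=
    fun h r => hR.measurable_cost r _
  have hle : ∀ h, AllPlaceable P h S → ∀ r, 1 ≤ r → r ≤ 3 →
      ∫⁻ ω, ((R.build ω r (keyValues P h S r)).cost : ℝ≥0∞) ∂(R.μ) ≤ c * (S.length + 1) := by
    intro h hp r h1 h3
    have ha := keyValues_admissible hS hne hp r
    refine (hR.build_time r h1 h3 _ ha.1 ha.2.1).trans (mul_le_mul_right ?_ _)
    exact add_le_add (by exact_mod_cast keyValues_length_le hne r) le_rfl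
  simp only [retrievalCost, ENat.toENNReal_add]
  rw [lintegral_prod _ (aemeasurable_of_sameBuckets P R.μ hS (fun h => by
    have := hm h
    fun_prop) fun h h' hs ω => by simp only [hs.keyValues])]
  refine (lintegral_mono_ae (g := fun _ => 3 * (c * (S.length + 1))) ?_).trans (by simp)
  filter_upwards [ae_allPlaceable P hS] with h hp
  rw [lintegral_add_right _ (hm h 3), lintegral_add_right _ (hm h 2)]
  refine (add_le_add (add_le_add (hle h hp 1 (by norm_num) (by norm_num))
    (hle h hp 2 (by norm_num) (by norm_num))) (hle h hp 3 (by norm_num) (by norm_num))).trans_eq ?_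
  ring

theorem lintegral_retrievalSpace_le (hR : R.IsLinear c) (hS : S.Nodup) (hne : S ≠ []) :
    ∫⁻ ω, (retrievalSpace P ω.1 S R ω.2 : ℝ≥0∞) ∂(hashMeasure U).prod R.μ ≤
      3 * (c * (S.length + 1)) := by
  have hm : ∀ h r, Measurable fun ω =>
      ((R.build ω r (keyValues P h S r)).val.length : ℝ≥0∞) := fun h r =>
    (measurable_of_countable fun n : ℕ => (n : ℝ≥0∞)).comp (hR.measurable_length r _)
  have hle : ∀ h, AllPlaceable P h S → ∀ r, 1 ≤ r → r ≤ 3 →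
      ∫⁻ ω, ((R.build ω r (keyValues P h S r)).val.length : ℝ≥0∞) ∂(R.μ) ≤
        c * (S.length + 1) := by
    intro h hp r h1 h3
    have ha := keyValues_admissible hS hne hp r
    refine (hR.space r h1 h3 _ ha.1 ha.2.1).trans (mul_le_mul_right ?_ _)
    exact add_le_add (by exact_mod_cast keyValues_length_le hne r) le_rfl
  simp only [retrievalSpace, Nat.cast_add]
  rw [lintegral_prod _ (aemeasurable_of_sameBuckets P R.μ hS (fun h => by
    have := hm h
    fun_prop) fun h h' hs ω => by simp only [hs.keyValues])]
  refine (lintegral_mono_ae (g := fun _ => 3 * (c * (S.length + 1))) ?_).trans (by simp)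
  filter_upwards [ae_allPlaceable P hS] with h hp
  rw [lintegral_add_right _ (hm h 3), lintegral_add_right _ (hm h 2)]
  refine (add_le_add (add_le_add (hle h hp 1 (by norm_num) (by norm_num))
    (hle h hp 2 (by norm_num) (by norm_num))) (hle h hp 3 (by norm_num) (by norm_num))).trans_eq ?_
  ring

end Retrieval
end SicHash

namespace SicHash

/-! ## Constant success probability -/

/-- This is one term of the union bound, cleared of denominators. The number 18 = 3·3·2 pays a
factor 3 per index for each binomial coefficient, by k^k ≤ 3^k k!, and a factor 2 for geometric
decay in k. -/
theorem choose_mul_choose_le {n k : ℕ} (hk : k ≤ n) :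
    (18 * n).choose k * n.choose (k + 1) * k ^ (2 * (k + 1)) * (4 * 2 ^ k) ≤
      (18 * n) ^ (2 * (k + 1)) := by
  have h1 : (18 * n).choose k * k ^ k ≤ 3 ^ k * (18 * n) ^ k := by
    calc _ ≤ (18 * n).choose k * (3 ^ k * k.factorial) := Nat.mul_le_mul_left _ (pow_self_le k)
      _ = 3 ^ k * (18 * n).descFactorial k := by
        rw [Nat.descFactorial_eq_factorial_mul_choose]
        ring
      _ ≤ _ := Nat.mul_le_mul_left _ (Nat.descFactorial_le_pow _ _)
  have h2 : n.choose (k + 1) * k ^ (k + 1) ≤ 3 ^ k * n ^ (k + 1) := by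
    calc _ ≤ n.choose (k + 1) * (3 ^ k * (k + 1).factorial) := by
          refine Nat.mul_le_mul_left _ ?_
          rw [pow_succ', Nat.factorial_succ]
          calc k * k ^ k ≤ (k + 1) * (3 ^ k * k.factorial) :=
                Nat.mul_le_mul (Nat.le_succ k) (pow_self_le k)
            _ = _ := by ring
      _ = 3 ^ k * n.descFactorial (k + 1) := by
        rw [Nat.descFactorial_eq_factorial_mul_choose]
        ring
      _ ≤ _ := Nat.mul_le_mul_left _ (Nat.descFactorial_le_pow _ _)
  calc _ = ((18 * n).choose k * k ^ k) * (n.choose (k + 1) * k ^ (k + 1)) * k * (4 * 2 ^ k) := by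
        ring
    _ ≤ (3 ^ k * (18 * n) ^ k) * (3 ^ k * n ^ (k + 1)) * n * (4 * 2 ^ k) := by gcongr
    _ = 4 * 18 ^ k * ((18 * n) ^ k * n ^ (k + 2)) := by
        rw [show (18 : ℕ) = 3 * 3 * 2 by norm_num, mul_pow (3 * 3) 2, mul_pow 3 3]
        ring
    -- There is slack 4 ≤ 18²; it makes the sum over k equal to 1/2 instead of a larger constant.
    _ ≤ 18 ^ 2 * 18 ^ k * ((18 * n) ^ k * n ^ (k + 2)) := by gcongr; norm_num
    _ = _ := by rw [mul_pow, mul_pow]; ring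

variable {U : Type}

/-- The first two candidates of the objects in `J` are `2 * J.card` independent uniform cells, each
in `F` with probability `F.card / m`. -/
theorem measure_candCells_mem {X : List U} (hX : X.Nodup) {m seed : ℕ} {J F : Finset ℕ}
    (hJ : ∀ j ∈ J, j < X.length) (hF : F ⊆ Finset.range m) (hm : 0 < m) :
    hashMeasure U {h | ∀ j ∈ J, ∀ i < 2, candCell h X m seed j i ∈ F} =
      (F.card ^ (2 * J.card) : ℕ) * ((m : ℝ≥0∞)⁻¹) ^ (2 * J.card) := by
  classical
  obtain ⟨m, rfl⟩ := Nat.exists_eq_add_of_lt hm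
  rw [zero_add] at hF ⊢
  set F' : Finset (Fin (m + 1)) := Finset.univ.filter fun v => v.val ∈ F with hF'
  have hcard : F'.card = F.card := by
    rw [← Finset.card_map Fin.valEmbedding]
    congr 1
    ext v
    simp only [hF', Finset.mem_map, Finset.mem_filter, Finset.mem_univ, true_and,
      Fin.valEmbedding_apply]
    constructor
    · rintro ⟨a, ha, rfl⟩
      exact ha
    · exact fun hv => ⟨⟨v, Finset.mem_range.mp (hF hv)⟩, hv, rfl⟩
  have h1 : {h : Hashes U | ∀ j ∈ J, ∀ i < 2, candCell h X (m + 1) seed j i ∈ F} =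
      {h | (fun p : J × Fin 2 => h (X[p.1.1]'(hJ _ p.1.2), .cell seed p.2, m)) ∈
        Fintype.piFinset fun _ : J × Fin 2 => F'} := by
    ext h
    have h2 : ∀ j (hj : j ∈ J) i, candCell h X (m + 1) seed j i =
        (h (X[j]'(hJ j hj), .cell seed i, m)).val := by
      intro j hj i
      simp [candCell, List.getElem?_eq_getElem (hJ j hj), hashValue]
    simp only [Set.mem_ofPred_eq, Fintype.mem_piFinset, hF', Finset.mem_filter, Finset.mem_univ,
      true_and, Prod.forall, Subtype.forall]
    constructor
    · intro hh j hj i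
      rw [← h2 j hj]
      exact hh j hj i i.2
    · intro hh j hj i hi
      rw [h2 j hj]
      exact hh j hj ⟨i, hi⟩
  rw [h1, hashMeasure_uniform (fun p : J × Fin 2 => X[p.1.1]'(hJ _ p.1.2))
    (fun p => .cell seed p.2) m ?_ _]
  · simp [hcard, mul_comm]
  · rintro ⟨⟨j, hj⟩, i⟩ ⟨⟨j', hj'⟩, i'⟩ hp
    simp only [Prod.mk.injEq, HashName.cell.injEq, true_and] at hp
    have := (List.Nodup.getElem_inj_iff hX).mp hp.1
    simp [this, Fin.ext_iff, hp.2]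

theorem numCells_inv (n : ℕ) : numCells (1 / 18) n = 18 * n := by
  have : (n : ℚ) / (1 / 18) = (18 * n : ℕ) := by
    push_cast
    ring
  rw [numCells, this, Nat.floor_natCast]

/-- A failed attempt produces k cells that contain all candidates of k + 1 objects, for some k < n.
The union bound over all such pairs, using two candidates per object, is at most ∑ 4⁻¹·2⁻ᵏ = 2⁻¹. -/
theorem measure_failure_le {X : List U} (hX : X.Nodup) {deg : ℕ → ℕ} (hdeg : ∀ j, 2 ≤ deg j)
    (seed : ℕ) : hashMeasure U
      {h | ¬ (tryTable h X (18 * X.length) deg seed).val.isSome} ≤ 2⁻¹ := by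
  classical
  set n := X.length with hn
  set m := 18 * n with hm
  let E : Finset ℕ → Finset ℕ → Set (Hashes U) := fun J F =>
    {h | ∀ j ∈ J, ∀ i < 2, candCell h X m seed j i ∈ F}
  have hsub : {h : Hashes U | ¬ (tryTable h X m deg seed).val.isSome} ⊆
      ⋃ k ∈ Finset.range n, ⋃ F ∈ (Finset.range m).powersetCard k,
        ⋃ J ∈ (Finset.range n).powersetCard (k + 1), E J F := by
    intro h hh
    have hspec := tryTable_spec h X (m := m) (by omega) deg seed
    have hnone : (tryTable h X m deg seed).val = none := by simpa using hh
    rw [hnone] at hspec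
    obtain ⟨J, F, hF, hJ, hc, hJF⟩ := hspec
    have hJ' : J ⊆ Finset.range n := fun j hj => Finset.mem_range.mpr (hJ hj)
    have hle := Finset.card_le_card hJ'
    rw [Finset.card_range, hc] at hle
    simp only [Set.mem_iUnion, Finset.mem_range, Finset.mem_powersetCard]
    exact ⟨F.card, by omega, F, ⟨hF, rfl⟩, J, ⟨hJ', hc⟩,
      fun j hj i hi => hJF j hj i (hi.trans_le (hdeg j))⟩
  have hE : ∀ k < n, ∀ F ∈ (Finset.range m).powersetCard k,
      ∀ J ∈ (Finset.range n).powersetCard (k + 1),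
      hashMeasure U (E J F) = (k ^ (2 * (k + 1)) : ℕ) * ((m : ℝ≥0∞)⁻¹) ^ (2 * (k + 1)) := by
    intro k hk F hF J hJ
    rw [Finset.mem_powersetCard] at hF hJ
    rw [measure_candCells_mem hX (fun j hj => Finset.mem_range.mp (hJ.1 hj)) hF.1 (by omega),
      hF.2, hJ.2]
  have hterm : ∀ k < n, hashMeasure U (⋃ F ∈ (Finset.range m).powersetCard k,
        ⋃ J ∈ (Finset.range n).powersetCard (k + 1), E J F) ≤ 4⁻¹ * 2⁻¹ ^ k := by
    intro k hk
    have h1 : hashMeasure U (⋃ F ∈ (Finset.range m).powersetCard k,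
        ⋃ J ∈ (Finset.range n).powersetCard (k + 1), E J F) ≤
        ∑ F ∈ (Finset.range m).powersetCard k, ∑ J ∈ (Finset.range n).powersetCard (k + 1),
          hashMeasure U (E J F) :=
      (measure_biUnion_finset_le _ _).trans
        (Finset.sum_le_sum fun F _ => measure_biUnion_finset_le _ _)
    refine h1.trans ?_
    rw [Finset.sum_congr rfl fun F hF => Finset.sum_congr rfl fun J hJ => hE k hk F hF J hJ]
    simp only [Finset.sum_const, Finset.card_powersetCard, Finset.card_range, nsmul_eq_mul]
    have h2 := choose_mul_choose_le hk.le
    have hm0 : (m : ℝ≥0∞) ≠ 0 := by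
      have : m ≠ 0 := by omega
      exact_mod_cast this
    have hmt : (m : ℝ≥0∞) ≠ ⊤ := ENNReal.natCast_ne_top m
    have h3 : ((m.choose k * n.choose (k + 1) * k ^ (2 * (k + 1)) * (4 * 2 ^ k) : ℕ) : ℝ≥0∞) ≤
      ((m ^ (2 * (k + 1)) : ℕ) : ℝ≥0∞) := by exact_mod_cast h2
    have h4 : ((4 : ℝ≥0∞)⁻¹ * 2⁻¹ ^ k) = (4 * 2 ^ k)⁻¹ := by
      rw [ENNReal.mul_inv (Or.inl (by norm_num)) (Or.inl (by finiteness)), ENNReal.inv_pow]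
    rw [h4, ← ENNReal.inv_pow, ← mul_assoc, ← mul_assoc, ← div_eq_mul_inv,
      ENNReal.div_le_iff (pow_ne_zero _ hm0) (by finiteness), mul_comm (_⁻¹), ← div_eq_mul_inv,
      ENNReal.le_div_iff_mul_le (Or.inl (by positivity)) (Or.inl (by finiteness))]
    push_cast at h3 ⊢
    exact h3
  calc _ ≤ ∑ k ∈ Finset.range n, hashMeasure U (⋃ F ∈ (Finset.range m).powersetCard k,
        ⋃ J ∈ (Finset.range n).powersetCard (k + 1), E J F) :=
        (measure_mono hsub).trans (measure_biUnion_finset_le _ _)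
    _ ≤ ∑ k ∈ Finset.range n, 4⁻¹ * 2⁻¹ ^ k :=
        Finset.sum_le_sum fun k hk => hterm k (Finset.mem_range.mp hk)
    _ ≤ ∑' k, 4⁻¹ * 2⁻¹ ^ k := ENNReal.sum_le_tsum _
    _ = 2⁻¹ := by
        rw [ENNReal.tsum_mul_left, ENNReal.tsum_geometric, ENNReal.one_sub_inv_two, inv_inv,
          show (4 : ℝ≥0∞) = 2 * 2 by norm_num,
          ENNReal.mul_inv (Or.inl (by norm_num)) (Or.inl (by norm_num)), mul_assoc,
          ENNReal.inv_mul_cancel (by norm_num) (by norm_num), mul_one]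

theorem constantSuccess_inv : ConstantSuccess (1 / 18) := by
  refine ⟨2⁻¹, by simp, fun U X hX deg hdeg seed => ?_⟩
  rw [numCells_inv]
  have h1 := measure_failure_le (U := U) hX (deg := deg)
    (fun j => by rcases hdeg j with h | h | h <;> omega) seed
  -- Subadditivity replaces the complement rule, so measurability of the success event is not
  -- needed.
  have h2 : (1 : ℝ≥0∞) ≤
      hashMeasure U {h | (tryTable h X (18 * X.length) deg seed).val.isSome} + 2⁻¹ := by
    rw [← measure_univ (μ := hashMeasure U)]
    refine (measure_mono fun h _ => ?_).trans ((measure_union_le _ _).trans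
      (add_le_add le_rfl h1))
    exact Classical.em _
  have h3 := tsub_le_iff_right.mpr h2
  rwa [ENNReal.one_sub_inv_two] at h3

end SicHash

namespace SicHash

/-! ## The bounds of the theorem -/

/-- A constant that bounds query time, and construction time and space per object. -/
noncomputable def Params.constant (P : Params) (c : ℕ) : ℕ :=
  P.queryBound c + 400 + P.expansion + P.workBound * (1 + 243 ^ P.b) + 6 * c

section Bounds

variable {U : Type} {R : Retrieval U} {c : ℕ} {P : Params} {S : List U}

theorem lintegral_le_constant (hS : S.Nodup) (hne : S ≠ []) {f g : Hashes U × R.Ω → ℝ≥0∞}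
    (hf : ∀ ω, f ω ≤ (P.workBound : ℝ≥0∞) * (S.length + work P ω.1 S) + g ω)
    (hg : ∫⁻ ω, g ω ∂(hashMeasure U).prod R.μ ≤ 3 * (c * (S.length + 1))) :
    ∫⁻ ω, f ω ∂(hashMeasure U).prod R.μ ≤ P.constant c * S.length := by
  have hm : Measurable fun ω : Hashes U × R.Ω =>
      (P.workBound : ℝ≥0∞) * (S.length + work P ω.1 S) :=
    (((measurable_work P S).comp measurable_fst).const_add _).const_mul _
  have h1 : ∫⁻ ω, (P.workBound : ℝ≥0∞) * (S.length + work P ω.1 S) ∂(hashMeasure U).prod R.μ ≤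
      P.workBound * (S.length + 243 ^ P.b * S.length) := by
    rw [lintegral_prod _ hm.aemeasurable]
    simp only [lintegral_const, measure_univ, mul_one]
    rw [lintegral_const_mul _ ((measurable_work P S).const_add _),
      lintegral_add_left measurable_const, lintegral_const, measure_univ, mul_one]
    exact mul_le_mul_right (add_le_add le_rfl (lintegral_work_le P hS)) _
  refine (lintegral_mono hf).trans ?_
  rw [lintegral_add_left hm]
  refine (add_le_add h1 hg).trans ?_
  have h2 : P.workBound * (S.length + 243 ^ P.b * S.length) + 3 * (c * (S.length + 1)) ≤
      P.constant c * S.length := by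
    have hN := List.length_pos_iff.mpr hne
    unfold Params.constant
    -- Since `S` is nonempty, the additive constants of the three retrieval structures are absorbed
    -- in the linear term, which turns 3c into 6c.
    have h3 : c ≤ c * S.length := Nat.le_mul_of_pos_right c hN
    calc _ = P.workBound * (1 + 243 ^ P.b) * S.length + (3 * (c * S.length) + 3 * c) := by ring
      _ ≤ P.workBound * (1 + 243 ^ P.b) * S.length + 6 * c * S.length := by nlinarith
      _ ≤ _ := by
        rw [← add_mul]
        exact Nat.mul_le_mul_right _ (by omega)
  exact_mod_cast h2

theorem ae_construct (hR : R.IsLinear c) (hS : S.Nodup) (hne : S ≠ []) :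
    ∀ᵐ ω ∂(hashMeasure U).prod R.μ,
      let D := (construct P R ω.1 ω.2 S).val
      Set.InjOn (fun x => (query P R ω.1 ω.2 D x).val) {x | x ∈ S} ∧
        (∀ x ∈ S, (query P R ω.1 ω.2 D x).val < D.M) ∧ P.α * D.M ≤ S.length ∧
        ∀ x : U, (query P R ω.1 ω.2 D x).cost ≤ P.constant c := by
  filter_upwards [ae_retrieval (P := P) hR hS hne] with ω ⟨hp, hc, hq⟩
  obtain ⟨idx, hl⟩ := exists_layoutSpec P ω.1 hS hne hp
  have hval : ∀ x ∈ S, (query P R ω.1 ω.2 (construct P R ω.1 ω.2 S).val x).val =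
      cellOf P ω.1 S idx x := fun x hx => queryAux_val hl hne hc _ hx
  have hM : (construct P R ω.1 ω.2 S).val.M = totalCells P ω.1 S := by
    have : (construct P R ω.1 ω.2 S).val = (constructAux P R ω.1 ω.2 S).val.1 := rfl
    rw [this, constructAux_val]
  refine ⟨fun x hx y hy hxy => ?_, fun x hx => ?_, ?_, fun x => ?_⟩
  · exact hl.inj hx hy (by rw [← hval x hx, ← hval y hy]; exact hxy)
  · rw [hval x hx, hM]
    exact hl.lt x hx
  · rw [hM]
    exact mul_totalCells_le P ω.1 hne
  · refine (query_cost_le hne hq x).trans (Nat.cast_le.mpr ?_)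
    unfold Params.constant
    omega

theorem ae_constructMinimal (hR : R.IsLinear c) (hS : S.Nodup) (hne : S ≠ []) :
    ∀ᵐ ω ∂(hashMeasure U).prod R.μ,
      let D := (constructMinimal P R ω.1 ω.2 S).val
      Set.BijOn (fun x => (queryMinimal P R ω.1 ω.2 D x).val) {x | x ∈ S} (Set.Iio S.length) ∧
        ∀ x : U, (queryMinimal P R ω.1 ω.2 D x).cost ≤ P.constant c := by
  filter_upwards [ae_retrieval (P := P) hR hS hne] with ω ⟨hp, hc, hq⟩
  obtain ⟨idx, hl⟩ := exists_layoutSpec P ω.1 hS hne hp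
  refine ⟨(hl.bijOn hS).congr fun x hx => (queryMinimal_val hl hne hc hx).symm, fun x => ?_⟩
  refine (queryMinimal_cost_le hne hq x).trans (Nat.cast_le.mpr ?_)
  unfold Params.constant
  omega

end Bounds

end SicHash

open SicHash in
theorem mainTheorem1 :
    (∃ α : ℚ, 0 < α ∧ α ≤ 1 ∧ ConstantSuccess α) ∧
    ∀ (P : Params) (c : ℕ), ∃ C : ℕ, ∀ (U : Type) (R : Retrieval U), R.IsLinear c →
      ∀ S : List U, S.Nodup → S ≠ [] →
        ((∀ᵐ ω ∂(hashMeasure U).prod R.μ,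
            let D := (construct P R ω.1 ω.2 S).val
            Set.InjOn (fun x => (query P R ω.1 ω.2 D x).val) {x | x ∈ S} ∧
            (∀ x ∈ S, (query P R ω.1 ω.2 D x).val < D.M) ∧
            P.α * D.M ≤ S.length ∧
            ∀ x : U, (query P R ω.1 ω.2 D x).cost ≤ C) ∧
          AEMeasurable (fun ω : Hashes U × R.Ω => ((construct P R ω.1 ω.2 S).cost : ℝ≥0∞))
            ((hashMeasure U).prod R.μ) ∧
          ∫⁻ ω, ((construct P R ω.1 ω.2 S).cost : ℝ≥0∞) ∂(hashMeasure U).prod R.μ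
            ≤ C * S.length ∧
          AEMeasurable
            (fun ω : Hashes U × R.Ω => ((construct P R ω.1 ω.2 S).val.space : ℝ≥0∞))
            ((hashMeasure U).prod R.μ) ∧
          ∫⁻ ω, ((construct P R ω.1 ω.2 S).val.space : ℝ≥0∞) ∂(hashMeasure U).prod R.μ
            ≤ C * S.length) ∧
        ((∀ᵐ ω ∂(hashMeasure U).prod R.μ,
            let D := (constructMinimal P R ω.1 ω.2 S).val
            Set.BijOn (fun x => (queryMinimal P R ω.1 ω.2 D x).val) {x | x ∈ S}
              (Set.Iio S.length) ∧
            ∀ x : U, (queryMinimal P R ω.1 ω.2 D x).cost ≤ C) ∧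
          AEMeasurable
            (fun ω : Hashes U × R.Ω => ((constructMinimal P R ω.1 ω.2 S).cost : ℝ≥0∞))
            ((hashMeasure U).prod R.μ) ∧
          ∫⁻ ω, ((constructMinimal P R ω.1 ω.2 S).cost : ℝ≥0∞) ∂(hashMeasure U).prod R.μ
            ≤ C * S.length ∧
          AEMeasurable
            (fun ω : Hashes U × R.Ω => ((constructMinimal P R ω.1 ω.2 S).val.space : ℝ≥0∞))
            ((hashMeasure U).prod R.μ) ∧
          ∫⁻ ω, ((constructMinimal P R ω.1 ω.2 S).val.space : ℝ≥0∞) ∂(hashMeasure U).prod R.μ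
            ≤ C * S.length) := by
  refine ⟨⟨1 / 18, by norm_num, by norm_num, constantSuccess_inv⟩, fun P c =>
    ⟨P.constant c, fun U R hR S hS hne => ⟨⟨ae_construct hR hS hne,
      aemeasurable_construct_cost hR P hS,
      lintegral_le_constant hS hne (fun ω => construct_cost_le hne R ω.2)
        (lintegral_retrievalCost_le hR hS hne),
      aemeasurable_construct_space hR P hS,
      lintegral_le_constant hS hne (fun ω => construct_space_le hne R ω.2)
        (lintegral_retrievalSpace_le hR hS hne)⟩,
      ae_constructMinimal hR hS hne,
      aemeasurable_constructMinimal_cost hR P hS,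
      lintegral_le_constant hS hne (fun ω => constructMinimal_cost_le hne R ω.2)
        (lintegral_retrievalCost_le hR hS hne),
      aemeasurable_constructMinimal_space hR P hS,
      lintegral_le_constant hS hne (fun ω => constructMinimal_space_le hne R ω.2)
        (lintegral_retrievalSpace_le hR hS hne)⟩⟩⟩
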